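/- Let $\beta\in\mathbb R$, $\delta<1$, $\zeta\in(0,1)$ with $\delta+\zeta>1$, and let $\gamma_0\in(0,1]$. For $\gamma\in(0,\gamma_0)$ put $m=m(\gamma)=\lfloor\gamma^{-\delta}\rfloor$ (number of firms), $T=T(\gamma)=\lfloor\gamma^{-\zeta}\rfloor$ (number of periods), and $\alpha(\gamma)=\log(1/\gamma)$. Covariates. On a probability space $(\Omega,P)$ let $(V_{i,t})_{i\ge1,\,t\ge0}$ be a real, jointly Gaussian family, stationary in $t$, with $V_{i,t}\sim N(0,1)$ and, for some $K$ and some $\rho\in(0,1)$, $|E(V_{i,t}V_{j,t+k})|\le K\rho^k$ for all $i,j\geq 1$, $t,k\ge0$. Default probabilities. Let $q(x)=e^x(1+h(x))$ with $q(x)\in[0,1]$ and $|h(x)|\le Ce^x$ for all $x\in\mathbb R$ and a constant $C$, where $h$ is three times differentiable and, for all sufficiently small $\gamma>0$, the random variables $\gamma^{-1}h^{(k)}(\beta Z-\alpha(\gamma))$, $k=0,1,2,3$, are integrable for $Z\sim N(0,1)$. For each $\gamma\in(0,\gamma_0)$ let $D_{i,t}\in\{0,1\}$ ($1\le i\le m$,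 $1\le t\le T$, depending on $\gamma$) be default indicators, put $\tau_i=\min\{T-1,\min\{t\ge0:D_{i,t+1}=1\}\}$ and let $\mathcal F_t$ be the $\sigma$-algebra generated by $V_{i,s}$ ($i\le m$, $0\le s\le t$) and $D_{i,s}$ ($i\le m$, $1\le s\le t$). Assume that, for $0\le t<T$, $$P(D_{i,t+1}=1\mid\mathcal F_t)=q(\beta V_{i,t}-\alpha(\gamma))\,\mathbb I(\tau_i\ge t)\quad(i\le m),$$ and that $D_{1,t+1},\dots,D_{m,t+1}$ are conditionally independent given $\mathcal F_t$. Estimators. The proposed estimator is $$\hat\beta(\gamma)=\frac{\sum_{t=0}^{T-1}\sum_{i=1}^{m}V_{i,t}D_{i,t+1}}{\sum_{t=0}^{T-1}\sum_{i=1}^{m}D_{i,t+1}}\qquad(\text{and }\hat\beta(\gamma)=0\text{ if there is no default}).$$ Let $\hat\beta_M(\gamma)$ be a maximum likelihood estimator of $\beta$ with $\alpha(\gamma)$ known, i.e. a random variable that almost surely maximises $$b\mapsto\prod_{i\le m}\prod_{t=0}^{\tau_i}q(bV_{i,t}-\alpha(\gamma))^{D_{i,t+1}}\bigl(1-q(bV_{i,t}-\alpha(\gamma))\bigr)^{1-D_{i,t+1}}$$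 over $\mathbb R$ whenever a maximiser exists (its value is not prescribed otherwise). Put $X_\gamma=\gamma^{-(\delta+\zeta-1)/2}(\hat\beta_M(\gamma)-\beta)$. Claim. If the family $(X_\gamma^2:0<\gamma<\gamma_0)$ is uniformly integrable, then for all sufficiently small $\gamma>0$ both mean squared errors are finite, and $$\lim_{\gamma\downarrow0}\frac{E\bigl((\hat\beta_M(\gamma)-\beta)^2\bigr)}{E\bigl((\hat\beta(\gamma)-\beta)^2\bigr)}=\frac1{1+\beta^2}.$$ -/

import Mathlib

open MeasureTheory ProbabilityTheory Filter Topology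

namespace RareDefault

noncomputable section

/-- Number of firms `m(γ) = γ^{-δ}` (integer part). -/
def numFirms (δ γ : ℝ) : ℕ := ⌊γ ^ (-δ)⌋₊

/-- Number of periods `T(γ) = γ^{-ζ}` (integer part). -/
def numPeriods (ζ γ : ℝ) : ℕ := ⌊γ ^ (-ζ)⌋₊

/-- The known offset `α(γ) = log (1/γ)`. -/
def offset (γ : ℝ) : ℝ := Real.log (1 / γ)

/-- `q(x) = e^x (1 + h(x))`; the conditional default probability of a firm with covariate `v`
under the parameters `(b, a)` is `q(b v - a)`. -/
def link (h : ℝ → ℝ) (x : ℝ) : ℝ := Real.exp x * (1 + h x)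

/-- `τ_i = min {T - 1, min {t ≥ 0 : D_{i,t+1} = 1}}`, where the inner minimum is `∞` if the firm
never defaults. -/
def exitTime {Ω : Type*} (T : ℕ) (D : ℕ → ℕ → Ω → ℝ) (i : ℕ) (ω : Ω) : ℕ :=
  sInf ({t : ℕ | D i (t + 1) ω = 1} ∪ {T - 1})

/-- `ℱ_t`, the sigma algebra generated by the covariates `V_{i,s}`, `0 ≤ s ≤ t`, and the default
indicators `D_{i,s}`, `1 ≤ s ≤ t`, of the `m` firms `i = 0, …, m - 1`. -/
@[reducible] def history {Ω : Type*} (m : ℕ) (V D : ℕ → ℕ → Ω → ℝ) (t : ℕ) : MeasurableSpace Ω :=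
  (⨆ i ∈ Finset.range m, ⨆ s ∈ Finset.Icc 0 t, MeasurableSpace.comap (V i s) inferInstance) ⊔
  (⨆ i ∈ Finset.range m, ⨆ s ∈ Finset.Icc 1 t, MeasurableSpace.comap (D i s) inferInstance)

/-- The covariates `V i t` (firm `i`, time `t`): a stationary, jointly Gaussian process with
standard normal marginals and exponentially decaying correlations. -/
structure IsCovariateProcess {Ω : Type*} [MeasurableSpace Ω] (μ : Measure Ω)
    (V : ℕ → ℕ → Ω → ℝ) (K ρ : ℝ) : Prop where
  measurable : ∀ i t, Measurable (V i t)
  gaussian : IsGaussianProcess (fun p : ℕ × ℕ => V p.1 p.2) μ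
  stationary : ∀ k : ℕ, IdentDistrib (fun ω (p : ℕ × ℕ) => V p.1 (p.2 + k) ω)
    (fun ω (p : ℕ × ℕ) => V p.1 p.2 ω) μ μ
  marginal : ∀ i t, HasLaw (V i t) (gaussianReal 0 1) μ
  decay : ∀ i j t k, |∫ ω, V i t ω * V j (t + k) ω ∂μ| ≤ K * ρ ^ k

/-- The conditions on the relative correction `h`: `q = e^x (1 + h)` takes values in `[0, 1]`,
`|h(x)| ≤ C e^x`, and `h` is three times differentiable, where for all small `γ` the functions
`γ⁻¹ h^{(k)}(β V - α(γ))`, `0 ≤ k ≤ 3`, are integrable for a standard normal `V`. -/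
structure IsCorrection (h : ℝ → ℝ) (β C : ℝ) : Prop where
  prob : ∀ x, link h x ∈ Set.Icc (0 : ℝ) 1
  bound : ∀ x, |h x| ≤ C * Real.exp x
  differentiable : ∀ k : ℕ, k < 3 → Differentiable ℝ (iteratedDeriv k h)
  integrable : ∀ᶠ γ in 𝓝[>] (0 : ℝ), ∀ k : ℕ, k ≤ 3 →
    Integrable (fun v : ℝ => (1 / γ) * iteratedDeriv k h (β * v - offset γ)) (gaussianReal 0 1)

/-- The default indicators `D i t` (`1 ≤ t ≤ T`; `D i (t + 1) = 1` if firm `i` defaults in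
`(t, t + 1]`) of `m` firms with true parameter `β` and offset `a`: given `ℱ_t`, a firm that is
still alive at time `t` defaults with probability `q(β V_{i,t} - a)`, a defaulted firm does not
default again, and the defaults of different firms in the same period are conditionally
independent. -/
structure IsDefaultProcess {Ω : Type*} [MeasurableSpace Ω] (μ : Measure Ω)
    (V D : ℕ → ℕ → Ω → ℝ) (h : ℝ → ℝ) (β a : ℝ) (m T : ℕ) : Prop where
  measurable : ∀ i t, Measurable (D i t)
  zero_or_one : ∀ i t ω, D i t ω = 0 ∨ D i t ω = 1
  condProb : ∀ i < m, ∀ t < T, μ[D i (t + 1) | history m V D t] =ᵐ[μ]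
    fun ω => if t ≤ exitTime T D i ω then link h (β * V i t ω - a) else 0
  condIndep : ∀ t < T, ∀ S ⊆ Finset.range m,
    μ[fun ω => ∏ i ∈ S, D i (t + 1) ω | history m V D t] =ᵐ[μ]
      fun ω => ∏ i ∈ S, (μ[D i (t + 1) | history m V D t]) ω

/-- The likelihood of the parameters `(b, a)` given the data,
`∏_{i} ∏_{t = 0}^{τ_i} p(V_{i,t}, b, a)^{D_{i,t+1}} (1 - p(V_{i,t}, b, a))^{1 - D_{i,t+1}}`
with `p(v, b, a) = q(b v - a)`. -/
def likelihood {Ω : Type*} (h : ℝ → ℝ) (V D : ℕ → ℕ → Ω → ℝ) (m T : ℕ) (b a : ℝ) (ω : Ω) : ℝ :=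
  ∏ i ∈ Finset.range m, ∏ t ∈ Finset.range (exitTime T D i ω + 1),
    if D i (t + 1) ω = 1 then link h (b * V i t ω - a) else 1 - link h (b * V i t ω - a)

/-- `βM` is a maximum likelihood estimator of `β`, for known offset `a`: it maximises the
likelihood whenever a maximiser exists. (With positive probability none exists, for example when
no firm defaults; the value of the estimator is not prescribed then.) -/
def IsMLE {Ω : Type*} [MeasurableSpace Ω] (μ : Measure Ω) (h : ℝ → ℝ) (V D : ℕ → ℕ → Ω → ℝ)
    (m T : ℕ) (a : ℝ) (βM : Ω → ℝ) : Prop :=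
  AEMeasurable βM μ ∧
  ∀ᵐ ω ∂μ, (∃ b, IsMaxOn (fun b' => likelihood h V D m T b' a ω) Set.univ b) →
    IsMaxOn (fun b' => likelihood h V D m T b' a ω) Set.univ (βM ω)

/-- `D̂_γ = (γ T m)⁻¹ ∑_t ∑_i D_{i,t+1}`. -/
def defaultAvg {Ω : Type*} (D : ℕ → ℕ → Ω → ℝ) (m T : ℕ) (γ : ℝ) (ω : Ω) : ℝ :=
  1 / (γ * T * m) * ∑ t ∈ Finset.range T, ∑ i ∈ Finset.range m, D i (t + 1) ω

/-- `V̂_γ = (γ T m)⁻¹ ∑_t ∑_i V_{i,t} D_{i,t+1}`. -/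
def covariateAvg {Ω : Type*} (V D : ℕ → ℕ → Ω → ℝ) (m T : ℕ) (γ : ℝ) (ω : Ω) : ℝ :=
  1 / (γ * T * m) * ∑ t ∈ Finset.range T, ∑ i ∈ Finset.range m, V i t ω * D i (t + 1) ω

/-- The proposed estimator `Σ⁻¹ V̂_γ / D̂_γ` in dimension one with `Σ = 1`; its value is `0` if no
default is observed. -/
def proposedEstimator {Ω : Type*} (V D : ℕ → ℕ → Ω → ℝ) (m T : ℕ) (γ : ℝ) (ω : Ω) : ℝ :=
  covariateAvg V D m T γ ω / defaultAvg D m T γ ω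

end

end RareDefault

set_option linter.unusedSectionVars false

namespace RareDefault

/-! Put `s = γ m T` and `c = exp (β² / 2)`. Since `s ~ γ ^ (-(δ + ζ - 1))`, it tends to infinity. A
living firm with covariate `v` defaults in one period with probability close to `γ e^{βv}`. Tilting
the standard normal law by `e^{βv}` gives mass `c` and the law `N(β, 1)`, so the covariates of the
defaulting firms resemble a sample of about `c s` draws from `N(β, 1)`.

The proposed estimator is the mean of that sample. The numerator of its error, the sum of `(V - β)
D`, is a martingale `M` plus a compensator. To leading order the compensator sums `γ (V - β) e^{βV}`
over living firms. This is centred because `E (Z - β) e^{βZ} = 0`, and `exists_compensator_sq_le`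
makes its mean square `o(s)`. As `M / √s` has second moment tending to `E (Z - β)² e^{βZ} = c`, and
the number of defaults divided by `s` tends to `c`, the normalised error is close to `c⁻¹ M / √s`,
whose second moment tends to `1 / c` (`tendsto_proposedEstimator`).

For the maximum likelihood estimator, the log-likelihood is, up to a constant and a vanishing error,
the concave function `b ∑_{defaults} V - γ ∑_{alive} e^{bV}`. Its score at `β` is a martingale `M'`
with weights `V` up to `o(√s)`, and its curvature is `s I` with `I = E Z² e^{βZ} = (1 + β²) c`.
Hence the normalised error is close to `I⁻¹ M' / √s` (`whp_maximumLikelihood`), with second moment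
tending to `1 / I`. The ratio of the limits is `c / I = 1 / (1 + β²)`.

Closeness in probability passes to second moments under uniform integrability
(`tendsto_integral_sq_of_whp`). The martingales have it through fourth moments, and the maximum
likelihood estimator by assumption. For the proposed estimator it follows from
`normalised_error_sq_le` together with the bound `O(1/T + 1/s²)` for the probability of few
defaults.

Three difficulties shape the proof. Firms are not independent of each other, so laws of large
numbers rest on a Gaussian moment inequality and the decay of correlations in time. Survival depends
on past covariates, so defaulted firms are handled by maximal-type bounds or by Cauchy–Schwarz. The
exact likelihood need be neither concave nor attain its maximum, so large slopes are excluded by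
hand on samples of high probability. -/

/-! ### Functions of exponential growth under the standard normal law. -/

/-- Functions of at most exponential growth. -/
def ExpBdd (g : ℝ → ℝ) : Prop := ∃ B k : ℝ, 0 ≤ B ∧ 0 ≤ k ∧ ∀ v, |g v| ≤ B * Real.exp (k * |v|)

/-- A centred normal variable of variance `v` is `√v` times a standard one. -/
lemma integral_pow_gaussianReal (v : NNReal) (p : ℕ) :
    ∫⁻ z, ENNReal.ofReal (z ^ (2 * p)) ∂(gaussianReal 0 v) =
      ENNReal.ofReal ((v : ℝ) ^ p * ∫ z, z ^ (2 * p) ∂(gaussianReal 0 1)) := by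
  have h1 : gaussianReal 0 v = (gaussianReal 0 1).map (Real.sqrt v * ·) := by
    rw [gaussianReal_map_const_mul]
    congr 1
    · simp
    · ext; simp
  have hint : Integrable (fun z : ℝ => z ^ (2 * p)) (gaussianReal 0 1) := by
    have := (memLp_id_gaussianReal (μ := 0) (v := 1) ((2 * p : ℕ) : NNReal)).integrable_norm_pow'
    refine (this.congr (ae_of_all _ fun z => ?_))
    simp [pow_mul]
  rw [h1, lintegral_map (by fun_prop) (by fun_prop), ← integral_const_mul,
    ofReal_integral_eq_lintegral_ofReal (hint.const_mul _)
      (ae_of_all _ fun z => mul_nonneg (by positivity) ((even_two_mul p).pow_nonneg z))]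
  congr 1
  ext z
  rw [mul_pow, pow_mul (Real.sqrt v), Real.sq_sqrt v.coe_nonneg]

namespace ExpBdd

variable {f g : ℝ → ℝ}

lemma mono (hg : ExpBdd g) (h : ∀ v, |f v| ≤ |g v|) : ExpBdd f := by
  obtain ⟨B, k, hB, hk, hbd⟩ := hg
  exact ⟨B, k, hB, hk, fun v => (h v).trans (hbd v)⟩

lemma const (c : ℝ) : ExpBdd (fun _ => c) :=
  ⟨|c|, 0, abs_nonneg _, le_rfl, fun v => by simp⟩

lemma id : ExpBdd (fun v => v) :=
  ⟨1, 1, zero_le_one, zero_le_one, fun v => by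
    have := Real.add_one_le_exp |v|
    simp only [one_mul]; linarith⟩

lemma exp (b : ℝ) : ExpBdd (fun v => Real.exp (b * v)) :=
  ⟨1, |b|, zero_le_one, abs_nonneg _, fun v => by
    rw [Real.abs_exp, one_mul, ← abs_mul]
    exact Real.exp_le_exp.2 (le_abs_self _)⟩

lemma exp_abs (b : ℝ) : ExpBdd (fun v => Real.exp (b * |v|)) :=
  ⟨1, |b|, zero_le_one, abs_nonneg _, fun v => by
    rw [Real.abs_exp, one_mul]
    exact Real.exp_le_exp.2 (mul_le_mul_of_nonneg_right (le_abs_self b) (abs_nonneg _))⟩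

lemma mul (hf : ExpBdd f) (hg : ExpBdd g) : ExpBdd (fun v => f v * g v) := by
  obtain ⟨B, k, hB, hk, hbd⟩ := hf
  obtain ⟨B', k', hB', hk', hbd'⟩ := hg
  refine ⟨B * B', k + k', by positivity, by positivity, fun v => ?_⟩
  rw [abs_mul, add_mul, Real.exp_add]
  calc |f v| * |g v| ≤ (B * Real.exp (k * |v|)) * (B' * Real.exp (k' * |v|)) :=
        mul_le_mul (hbd v) (hbd' v) (abs_nonneg _) (by positivity)
    _ = _ := by ring

lemma add (hf : ExpBdd f) (hg : ExpBdd g) : ExpBdd (fun v => f v + g v) := by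
  obtain ⟨B, k, hB, hk, hbd⟩ := hf
  obtain ⟨B', k', hB', hk', hbd'⟩ := hg
  refine ⟨B + B', k + k', by positivity, by positivity, fun v => ?_⟩
  have h1 : Real.exp (k * |v|) ≤ Real.exp ((k + k') * |v|) :=
    Real.exp_le_exp.2 (by nlinarith [abs_nonneg v])
  have h2 : Real.exp (k' * |v|) ≤ Real.exp ((k + k') * |v|) :=
    Real.exp_le_exp.2 (by nlinarith [abs_nonneg v])
  calc |f v + g v| ≤ |f v| + |g v| := abs_add_le _ _
    _ ≤ B * Real.exp (k * |v|) + B' * Real.exp (k' * |v|) := add_le_add (hbd v) (hbd' v)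
    _ ≤ _ := by nlinarith

lemma neg (hf : ExpBdd f) : ExpBdd (fun v => - f v) := hf.mono fun v => by simp

lemma sub (hf : ExpBdd f) (hg : ExpBdd g) : ExpBdd (fun v => f v - g v) := by
  simpa [sub_eq_add_neg] using hf.add hg.neg

lemma abs (hf : ExpBdd f) : ExpBdd (fun v => |f v|) := hf.mono fun v => by simp

lemma pow (hf : ExpBdd f) (n : ℕ) : ExpBdd (fun v => f v ^ n) := by
  induction n with
  | zero => simpa using ExpBdd.const 1
  | succ n ih => simpa [pow_succ] using ih.mul hf

lemma integrable (hg : ExpBdd g) (hm : Measurable g) : Integrable g (gaussianReal 0 1) := by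
  obtain ⟨B, k, hB, hk, hbd⟩ := hg
  refine (((integrable_exp_mul_gaussianReal k).add
    (integrable_exp_mul_gaussianReal (-k))).const_mul B).mono' hm.aestronglyMeasurable
    (ae_of_all _ fun v => (hbd v).trans (mul_le_mul_of_nonneg_left ?_ hB))
  simp only [Pi.add_apply]
  rcases abs_cases v with ⟨h, _⟩ | ⟨h, _⟩ <;> rw [h]
  · linarith [Real.exp_pos (-k * v)]
  · rw [mul_neg, ← neg_mul]; linarith [Real.exp_pos (k * v)]

lemma memLp (hg : ExpBdd g) (hm : Measurable g) (n : ℕ) : MemLp g n (gaussianReal 0 1) := by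
  rcases Nat.eq_zero_or_pos n with rfl | hn
  · simpa using hm.aestronglyMeasurable
  · rw [← integrable_norm_rpow_iff hm.aestronglyMeasurable (by positivity) (by simp)]
    simpa using (hg.abs.pow n).integrable (by fun_prop)

end ExpBdd

lemma integral_eval_eq {ι : Type*} (ν : Measure (ι → ℝ)) (hν : ∀ k, ν.map (fun x => x k) = gaussianReal 0 1)
    (k : ι) {f : ℝ → ℝ} (hf : AEStronglyMeasurable f (gaussianReal 0 1)) :
    ∫ x, f (x k) ∂ν = ∫ z, f z ∂(gaussianReal 0 1) := by
  rw [← hν k, integral_map (measurable_pi_apply k).aemeasurable (by rw [hν k]; exact hf)]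

/-! ### Moment inequality of Poincaré type for sums of functions of Gaussian variables. -/

section Poincare

variable {ι : Type*} [Fintype ι]

/-- Schur's test: a symmetric matrix has norm at most its largest absolute row sum. -/
lemma quadratic_form_le (c : ι → ℝ) (S : ι → ι → ℝ) (r : ℝ) (hS : ∀ k l, S k l = S l k)
    (hr : ∀ k, ∑ l, |S k l| ≤ r) :
    ∑ k, ∑ l, c k * c l * S k l ≤ r * ∑ k, c k ^ 2 := by
  have h1 : ∀ k l, c k * c l * S k l ≤ c k ^ 2 / 2 * |S k l| + c l ^ 2 / 2 * |S l k| := by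
    intro k l
    rw [hS l k]
    have : c k * c l * S k l ≤ |c k * c l| * |S k l| := by
      rw [← abs_mul]; exact le_abs_self _
    have h2 : |c k * c l| ≤ c k ^ 2 / 2 + c l ^ 2 / 2 := by
      rw [abs_le]; constructor <;> nlinarith [sq_nonneg (c k - c l), sq_nonneg (c k + c l)]
    nlinarith [abs_nonneg (S k l)]
  calc ∑ k, ∑ l, c k * c l * S k l
      ≤ ∑ k, ∑ l, (c k ^ 2 / 2 * |S k l| + c l ^ 2 / 2 * |S l k|) :=
        Finset.sum_le_sum fun k _ => Finset.sum_le_sum fun l _ => h1 k l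
    _ = ∑ k, c k ^ 2 * ∑ l, |S k l| := by
        simp_rw [Finset.sum_add_distrib]
        rw [Finset.sum_comm (f := fun k l => c l ^ 2 / 2 * |S l k|), ← Finset.sum_add_distrib]
        refine Finset.sum_congr rfl fun k _ => ?_
        rw [← Finset.sum_add_distrib, Finset.mul_sum]
        exact Finset.sum_congr rfl fun l _ => by ring
    _ ≤ ∑ k, c k ^ 2 * r := Finset.sum_le_sum fun k _ =>
        mul_le_mul_of_nonneg_left (hr k) (sq_nonneg _)
    _ = r * ∑ k, c k ^ 2 := by rw [← Finset.sum_mul, mul_comm]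

/-- The path `cos θ x + sin θ y` joins `x` to `y` along a quarter circle. The difference is the
integral of the derivative along this path, and Jensen moves the power inside. -/
lemma sub_pow_le_integral_rotation {g : ℝ → ℝ} (hg : ContDiff ℝ 1 g) (p : ℕ) (hp : 1 ≤ p)
    (x y : ι → ℝ) :
    ((∑ k, g (x k)) - ∑ k, g (y k)) ^ (2 * p) ≤ (Real.pi / 2) ^ (2 * p - 1) *
      ∫ θ in (0 : ℝ)..(Real.pi / 2), (∑ k, deriv g (Real.cos θ * x k + Real.sin θ * y k) *
        (- Real.sin θ * x k + Real.cos θ * y k)) ^ (2 * p) := by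
  have hcont : Continuous (fun θ : ℝ => ∑ k, deriv g (Real.cos θ * x k + Real.sin θ * y k) *
        (- Real.sin θ * x k + Real.cos θ * y k)) := by
    have := hg.continuous_deriv le_rfl
    fun_prop
  have hftc : ∫ θ in (0 : ℝ)..(Real.pi / 2), (∑ k, deriv g (Real.cos θ * x k + Real.sin θ * y k) *
        (- Real.sin θ * x k + Real.cos θ * y k)) = (∑ k, g (y k)) - ∑ k, g (x k) := by
    rw [intervalIntegral.integral_eq_sub_of_hasDerivAt
      (f := fun θ => ∑ k, g (Real.cos θ * x k + Real.sin θ * y k))]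
    · simp
    · intro θ _
      refine HasDerivAt.fun_sum fun k _ => ?_
      have h1 : HasDerivAt g (deriv g (Real.cos θ * x k + Real.sin θ * y k))
        (Real.cos θ * x k + Real.sin θ * y k) :=
        (hg.differentiable (by norm_num) _).hasDerivAt
      exact h1.comp θ (((Real.hasDerivAt_cos θ).mul_const _).add
        ((Real.hasDerivAt_sin θ).mul_const _))
    · exact hcont.intervalIntegrable _ _
  set φ : ℝ → ℝ := fun θ : ℝ => ∑ k, deriv g (Real.cos θ * x k + Real.sin θ * y k) *
        (- Real.sin θ * x k + Real.cos θ * y k) with hφ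
  have hpi : (0 : ℝ) < Real.pi / 2 := by positivity
  -- Jensen is applied to the mean over an interval of length `π / 2`; passing between means and
  -- integrals leaves the factor `(π / 2) ^ (2p - 1)`.
  have hJ := (Even.convexOn_pow (𝕜 := ℝ) (n := 2 * p) (even_two_mul p)).map_set_average_le
    (t := Set.Ioc 0 (Real.pi / 2)) (μ := volume) (f := φ)
    (by fun_prop) isClosed_univ (by simp [hpi]) (by simp) (by simp)
    (by rw [← intervalIntegrable_iff_integrableOn_Ioc_of_le hpi.le]
        exact hcont.intervalIntegrable _ _)
    (by rw [← intervalIntegrable_iff_integrableOn_Ioc_of_le hpi.le]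
        exact (hcont.pow _).intervalIntegrable _ _)
  rw [setAverage_eq, setAverage_eq] at hJ
  simp only [Measure.real, Real.volume_Ioc, sub_zero, ENNReal.toReal_ofReal hpi.le,
    smul_eq_mul] at hJ
  rw [← intervalIntegral.integral_of_le hpi.le, hftc,
    ← intervalIntegral.integral_of_le hpi.le] at hJ
  rw [mul_pow, inv_pow, inv_mul_eq_div, div_le_iff₀ (by positivity)] at hJ
  rw [show ((∑ k, g (x k)) - ∑ k, g (y k)) ^ (2 * p) = ((∑ k, g (y k)) - ∑ k, g (x k)) ^ (2 * p) by
    rw [← neg_sub, Even.neg_pow (even_two_mul p)]]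
  refine hJ.trans (le_of_eq ?_)
  obtain ⟨n, hn⟩ : ∃ n, 2 * p = n + 1 := ⟨2 * p - 1, by omega⟩
  rw [hn, pow_succ]
  simp only [Nat.add_sub_cancel]
  have key : ∀ I P : ℝ, P ≠ 0 → P⁻¹ * I * (P ^ n * P) = P ^ n * I := by
    intro I P hP
    field_simp
  exact key _ _ hpi.ne'

/-- The derivative along the quarter circle is the gradient at the first component of the rotated
pair, applied to the second. Rotations preserve the law of two independent copies, so every angle
contributes the same amount. -/
lemma lintegral_rotation_le {g : ℝ → ℝ} (hg : ContDiff ℝ 1 g) (p : ℕ) (hp : 1 ≤ p)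
    (ν : Measure (ι → ℝ)) [IsGaussian ν] (hν : ∀ k, ν.map (fun x => x k) = gaussianReal 0 1) :
    ∫⁻ x, ∫⁻ y, ENNReal.ofReal (((∑ k, g (x k)) - ∑ k, g (y k)) ^ (2 * p)) ∂ν ∂ν ≤
      ENNReal.ofReal ((Real.pi / 2) ^ (2 * p)) *
        ∫⁻ x, ∫⁻ y, ENNReal.ofReal ((∑ k, deriv g (x k) * y k) ^ (2 * p)) ∂ν ∂ν := by
  have hg' : Continuous (deriv g) := hg.continuous_deriv le_rfl
  have hgc : Continuous g := hg.continuous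
  have hpi : (0 : ℝ) < Real.pi / 2 := by positivity
  -- Rotation invariance of `ν.prod ν` requires a centred law; here centring is read off the
  -- marginals.
  have hcen : ν[id] = 0 := by
    funext k
    have h1 : Integrable (id : (ι → ℝ) → (ι → ℝ)) ν := IsGaussian.integrable_id
    have h2 := (ContinuousLinearMap.proj (R := ℝ) (φ := fun _ : ι => ℝ) k).integral_comp_comm h1
    simp only [id, ContinuousLinearMap.proj_apply] at h2
    have h3 := integral_eval_eq ν hν k (f := id) (by fun_prop)
    simp only [id, integral_id_gaussianReal] at h3
    simp only [id, Pi.zero_apply]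
    rw [← h2, h3]
  set Ψ : (ι → ℝ) × (ι → ℝ) → ENNReal :=
    fun z => ENNReal.ofReal ((∑ k, deriv g (z.1 k) * z.2 k) ^ (2 * p)) with hΨ
  have hΨm : Measurable Ψ := by
    apply ENNReal.measurable_ofReal.comp
    apply Continuous.measurable
    fun_prop
  rw [← lintegral_prod (fun z : (ι → ℝ) × (ι → ℝ) =>
      ENNReal.ofReal (((∑ k, g (z.1 k)) - ∑ k, g (z.2 k)) ^ (2 * p)))
      (ENNReal.continuous_ofReal.comp (by fun_prop)).aemeasurable,
    ← lintegral_prod Ψ hΨm.aemeasurable]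
  have hrot : ∀ θ : ℝ, ∫⁻ z, Ψ (ContinuousLinearMap.rotation θ z) ∂(ν.prod ν) =
      ∫⁻ z, Ψ z ∂(ν.prod ν) := by
    intro θ
    conv_rhs => rw [← IsGaussian.map_rotation_eq_self hcen θ]
    rw [lintegral_map hΨm (by fun_prop)]
  calc ∫⁻ z, ENNReal.ofReal (((∑ k, g (z.1 k)) - ∑ k, g (z.2 k)) ^ (2 * p)) ∂(ν.prod ν)
      ≤ ∫⁻ z, ENNReal.ofReal ((Real.pi / 2) ^ (2 * p - 1)) *
          (∫⁻ θ in Set.Ioc 0 (Real.pi / 2), Ψ (ContinuousLinearMap.rotation θ z)) ∂(ν.prod ν) := by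
        refine lintegral_mono fun z => ?_
        refine (ENNReal.ofReal_le_ofReal (sub_pow_le_integral_rotation hg p hp z.1 z.2)).trans ?_
        rw [ENNReal.ofReal_mul (by positivity), intervalIntegral.integral_of_le hpi.le,
          ofReal_integral_eq_lintegral_ofReal]
        · simp [hΨ, ContinuousLinearMap.rotation_apply]
        · rw [← IntegrableOn, ← intervalIntegrable_iff_integrableOn_Ioc_of_le hpi.le]
          exact Continuous.intervalIntegrable (by fun_prop) _ _
        · exact ae_of_all _ fun θ => (even_two_mul p).pow_nonneg _
    _ = ENNReal.ofReal ((Real.pi / 2) ^ (2 * p - 1)) *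
          ∫⁻ θ in Set.Ioc 0 (Real.pi / 2), ∫⁻ z, Ψ (ContinuousLinearMap.rotation θ z)
            ∂(ν.prod ν) := by
        rw [lintegral_const_mul' _ _ ENNReal.ofReal_ne_top, lintegral_lintegral_swap]
        · refine Measurable.aemeasurable (hΨm.comp (Continuous.measurable ?_))
          simp only [ContinuousLinearMap.rotation_apply]
          fun_prop
    _ = ENNReal.ofReal ((Real.pi / 2) ^ (2 * p)) * ∫⁻ z, Ψ z ∂(ν.prod ν) := by
        simp_rw [hrot]
        rw [lintegral_const, Measure.restrict_apply_univ, Real.volume_Ioc, sub_zero,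
          mul_comm (lintegral _ _), ← mul_assoc, ← ENNReal.ofReal_mul (by positivity),
          ← pow_succ]
        congr 4
        omega

/-- A linear form of a Gaussian vector is normal, so its moments are determined by its variance,
which the row sums of the covariance control. -/
lemma lintegral_linear_le (ν : Measure (ι → ℝ)) [IsGaussian ν]
    (hν : ∀ k, ν.map (fun x => x k) = gaussianReal 0 1) (r : ℝ)
    (hr : ∀ k, ∑ l, |∫ x, x k * x l ∂ν| ≤ r) (p : ℕ) (c : ι → ℝ) :
    ∫⁻ y, ENNReal.ofReal ((∑ k, c k * y k) ^ (2 * p)) ∂ν ≤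
      ENNReal.ofReal ((r * ∑ k, c k ^ 2) ^ p * ∫ z, z ^ (2 * p) ∂(gaussianReal 0 1)) := by
  let L : (ι → ℝ) →L[ℝ] ℝ := ∑ k, c k • ContinuousLinearMap.proj k
  have hL : ∀ y, L y = ∑ k, c k * y k := fun y => by
    simp [L]
  have hmem : ∀ k, MemLp (fun y : ι → ℝ => y k) 2 ν := fun k =>
    IsGaussian.memLp_dual ν (ContinuousLinearMap.proj k) 2 (by simp)
  have hmean : ∫ y, L y ∂ν = 0 := by
    simp_rw [hL]
    rw [integral_finsetSum _ fun k _ => ((hmem k).integrable (by norm_num)).const_mul _]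
    refine Finset.sum_eq_zero fun k _ => ?_
    have h3 := integral_eval_eq ν hν k (f := id) (by fun_prop)
    simp only [id, integral_id_gaussianReal] at h3
    rw [integral_const_mul, h3, mul_zero]
  have hvar : Var[L; ν] ≤ r * ∑ k, c k ^ 2 := by
    rw [variance_of_integral_eq_zero (by fun_prop) hmean]
    have : ∫ y, L y ^ 2 ∂ν = ∑ k, ∑ l, c k * c l * ∫ y, y k * y l ∂ν := by
      have h1 : ∀ y, L y ^ 2 = ∑ k, ∑ l, c k * c l * (y k * y l) := by
        intro y
        rw [hL, sq, Finset.sum_mul_sum]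
        exact Finset.sum_congr rfl fun k _ => Finset.sum_congr rfl fun l _ => by ring
      simp_rw [h1]
      have hi : ∀ k l, Integrable (fun y : ι → ℝ => c k * c l * (y k * y l)) ν :=
        fun k l => ((hmem k).integrable_mul (hmem l)).const_mul _
      rw [integral_finsetSum _ fun k _ => integrable_finsetSum _ fun l _ => hi k l]
      refine Finset.sum_congr rfl fun k _ => ?_
      rw [integral_finsetSum _ fun l _ => hi k l]
      exact Finset.sum_congr rfl fun l _ => integral_const_mul _ _
    rw [this]
    refine quadratic_form_le c _ r (fun k l => ?_) hr
    simp_rw [mul_comm]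
  have hlaw := IsGaussian.map_eq_gaussianReal (μ := ν) L
  rw [hmean] at hlaw
  calc ∫⁻ y, ENNReal.ofReal ((∑ k, c k * y k) ^ (2 * p)) ∂ν
      = ∫⁻ z, ENNReal.ofReal (z ^ (2 * p)) ∂(ν.map L) := by
        rw [lintegral_map (by fun_prop) (by fun_prop)]
        simp_rw [hL]
    _ ≤ _ := by
        rw [hlaw, integral_pow_gaussianReal]
        refine ENNReal.ofReal_le_ofReal (mul_le_mul_of_nonneg_right ?_ ?_)
        · rw [Real.coe_toNNReal _ (variance_nonneg _ _)]
          exact pow_le_pow_left₀ (variance_nonneg _ _) hvar p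
        · exact integral_nonneg fun z => (even_two_mul p).pow_nonneg z

/-- The constant in the moment inequality for sums of functions of Gaussian variables. -/
noncomputable def momentConst (g : ℝ → ℝ) (p : ℕ) : ℝ :=
  (Real.pi / 2) ^ (2 * p) * (∫ z, z ^ (2 * p) ∂(gaussianReal 0 1)) *
    ∫ z, deriv g z ^ (2 * p) ∂(gaussianReal 0 1)

lemma momentConst_nonneg (g : ℝ → ℝ) (p : ℕ) : 0 ≤ momentConst g p := by
  have h1 : 0 ≤ ∫ z, z ^ (2 * p) ∂(gaussianReal 0 1) :=
    integral_nonneg fun z => (even_two_mul p).pow_nonneg z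
  have h2 : 0 ≤ ∫ z, deriv g z ^ (2 * p) ∂(gaussianReal 0 1) :=
    integral_nonneg fun z => (even_two_mul p).pow_nonneg _
  unfold momentConst
  positivity

/-- For fixed `x` the inner integral is a moment of a linear form in `y`; only one-dimensional
integrals against the marginals remain. -/
lemma lintegral_gradient_le {g : ℝ → ℝ} (hg : ContDiff ℝ 1 g)
    (hb' : ExpBdd (deriv g)) (p : ℕ) (hp : 1 ≤ p)
    (ν : Measure (ι → ℝ)) [IsGaussian ν] (hν : ∀ k, ν.map (fun x => x k) = gaussianReal 0 1)
    (r : ℝ) (hr0 : 0 ≤ r) (hr : ∀ k, ∑ l, |∫ x, x k * x l ∂ν| ≤ r) :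
    ∫⁻ x, ∫⁻ y, ENNReal.ofReal ((∑ k, deriv g (x k) * y k) ^ (2 * p)) ∂ν ∂ν ≤
      ENNReal.ofReal (r ^ p * (Fintype.card ι : ℝ) ^ p *
        ((∫ z, z ^ (2 * p) ∂(gaussianReal 0 1)) * ∫ z, deriv g z ^ (2 * p) ∂(gaussianReal 0 1))) := by
  have hm' : Measurable (deriv g) := measurable_deriv g
  have hc0 : 0 ≤ ∫ z, z ^ (2 * p) ∂(gaussianReal 0 1) :=
    integral_nonneg fun z => (even_two_mul p).pow_nonneg z
  have hi : ∀ k, Integrable (fun x : ι → ℝ => deriv g (x k) ^ (2 * p)) ν := by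
    intro k
    have h1 := (hb'.pow (2 * p)).integrable (by fun_prop)
    rw [← hν k] at h1
    exact h1.comp_measurable (measurable_pi_apply k)
  -- Power mean inequality, so that the moment of `∑ deriv g (x k) ^ 2` reduces to moments of single
  -- coordinates.
  have hq : ∀ c : ι → ℝ, (r * ∑ k, c k ^ 2) ^ p ≤
      r ^ p * (Fintype.card ι : ℝ) ^ (p - 1) * ∑ k, c k ^ (2 * p) := by
    intro c
    obtain ⟨n, rfl⟩ : ∃ n, p = n + 1 := ⟨p - 1, by omega⟩
    have h := pow_sum_le_card_mul_sum_pow (s := Finset.univ) (f := fun k => c k ^ 2)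
      (fun k _ => sq_nonneg _) n
    simp only [← pow_mul, Finset.card_univ] at h
    rw [mul_pow, Nat.add_sub_cancel, mul_assoc]
    exact mul_le_mul_of_nonneg_left h (by positivity)
  calc ∫⁻ x, ∫⁻ y, ENNReal.ofReal ((∑ k, deriv g (x k) * y k) ^ (2 * p)) ∂ν ∂ν
      ≤ ∫⁻ x, ENNReal.ofReal ((r ^ p * (Fintype.card ι : ℝ) ^ (p - 1) *
          ∑ k, deriv g (x k) ^ (2 * p)) * ∫ z, z ^ (2 * p) ∂(gaussianReal 0 1)) ∂ν := by
        refine lintegral_mono fun x => (lintegral_linear_le ν hν r hr p _).trans ?_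
        exact ENNReal.ofReal_le_ofReal (mul_le_mul_of_nonneg_right (hq _) hc0)
    _ = ENNReal.ofReal (∫ x, (r ^ p * (Fintype.card ι : ℝ) ^ (p - 1) *
          ∑ k, deriv g (x k) ^ (2 * p)) * (∫ z, z ^ (2 * p) ∂(gaussianReal 0 1)) ∂ν) := by
        rw [ofReal_integral_eq_lintegral_ofReal]
        · exact ((integrable_finsetSum _ fun k _ => hi k).const_mul _).mul_const _
        · refine ae_of_all _ fun x => ?_
          have : 0 ≤ ∑ k, deriv g (x k) ^ (2 * p) :=
            Finset.sum_nonneg fun k _ => (even_two_mul p).pow_nonneg _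
          simp only [Pi.zero_apply]
          positivity
    _ = _ := by
        rw [integral_mul_const, integral_const_mul, integral_finsetSum _ fun k _ => hi k]
        simp_rw [integral_eval_eq ν hν _ (f := fun z => deriv g z ^ (2 * p)) (by fun_prop)]
        rw [Finset.sum_const, Finset.card_univ, nsmul_eq_mul]
        obtain ⟨n, rfl⟩ : ∃ n, p = n + 1 := ⟨p - 1, by omega⟩
        simp only [Nat.add_sub_cancel]
        congr 1
        ring

/-- Symmetrise with an independent copy, then use the rotation argument. The only trace of
dependence is `r`, so the bound has the same order as for independent summands when correlations are
summable. -/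
theorem integral_sum_sub_pow_le {g : ℝ → ℝ} (hg : ContDiff ℝ 1 g) (hb : ExpBdd g)
    (hb' : ExpBdd (deriv g)) (p : ℕ) (hp : 1 ≤ p)
    (ν : Measure (ι → ℝ)) [IsGaussian ν] (hν : ∀ k, ν.map (fun x => x k) = gaussianReal 0 1)
    (r : ℝ) (hr0 : 0 ≤ r) (hr : ∀ k, ∑ l, |∫ x, x k * x l ∂ν| ≤ r) :
    ∫ x, (∑ k, (g (x k) - ∫ z, g z ∂(gaussianReal 0 1))) ^ (2 * p) ∂ν ≤
      momentConst g p * r ^ p * (Fintype.card ι : ℝ) ^ p := by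
  have hgm : Measurable g := hg.continuous.measurable
  have hF : MemLp (fun x : ι → ℝ => ∑ k, g (x k)) ((2 * p : ℕ) : ENNReal) ν := by
    refine memLp_finsetSum _ fun k _ => ?_
    have h1 := hb.memLp hgm (2 * p)
    rw [← hν k] at h1
    exact h1.comp_of_map (measurable_pi_apply k).aemeasurable
  set F : (ι → ℝ) → ℝ := fun x => ∑ k, g (x k) with hFdef
  have hFi : Integrable F ν := hF.integrable (by
    rw [← Nat.cast_one, Nat.cast_le]; omega)
  have hsub : ∀ a, Integrable (fun x => (F x - a) ^ (2 * p)) ν := by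
    intro a
    have := (hF.sub (memLp_const a)).integrable_norm_pow'
    refine this.congr (ae_of_all _ fun x => ?_)
    simp [pow_mul]
  have hsub' : ∀ a, Integrable (fun x => (a - F x) ^ (2 * p)) ν := by
    intro a
    refine (hsub a).congr (ae_of_all _ fun x => ?_)
    simp only
    rw [← neg_sub, (even_two_mul p).neg_pow]
  have hEF : ∫ x, F x ∂ν = ∑ _k : ι, ∫ z, g z ∂(gaussianReal 0 1) := by
    rw [hFdef, integral_finsetSum]
    · exact Finset.sum_congr rfl fun k _ => integral_eval_eq ν hν k (by fun_prop)
    · intro k _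
      have h1 := hb.integrable hgm
      rw [← hν k] at h1
      exact h1.comp_measurable (measurable_pi_apply k)
  -- Jensen in the independent copy replaces the mean by `F y`.
  have hJ : ∀ x, (F x - ∫ y, F y ∂ν) ^ (2 * p) ≤ ∫ y, (F x - F y) ^ (2 * p) ∂ν := by
    intro x
    have h1 := (Even.convexOn_pow (𝕜 := ℝ) (n := 2 * p) (even_two_mul p)).map_integral_le
      (μ := ν) (f := fun y => F x - F y) (by fun_prop) isClosed_univ (by simp)
      ((integrable_const _).sub hFi) (hsub' _)
    rwa [integral_sub (integrable_const _) hFi, integral_const, probReal_univ, one_smul] at h1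
  have hle : ∫⁻ x, ENNReal.ofReal ((F x - ∫ y, F y ∂ν) ^ (2 * p)) ∂ν ≤
      ENNReal.ofReal (momentConst g p * r ^ p * (Fintype.card ι : ℝ) ^ p) := by
    calc ∫⁻ x, ENNReal.ofReal ((F x - ∫ y, F y ∂ν) ^ (2 * p)) ∂ν
        ≤ ∫⁻ x, ∫⁻ y, ENNReal.ofReal ((F x - F y) ^ (2 * p)) ∂ν ∂ν := by
          refine lintegral_mono fun x => ?_
          rw [← ofReal_integral_eq_lintegral_ofReal (hsub' _)
            (ae_of_all _ fun y => (even_two_mul p).pow_nonneg _)]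
          exact ENNReal.ofReal_le_ofReal (hJ x)
      _ ≤ _ := lintegral_rotation_le hg p hp ν hν
      _ ≤ _ := mul_le_mul_right (lintegral_gradient_le hg hb' p hp ν hν r hr0 hr) _
      _ = _ := by
          rw [← ENNReal.ofReal_mul (by positivity)]
          congr 1
          unfold momentConst
          ring
  have heq : ∀ x : ι → ℝ, (∑ k, (g (x k) - ∫ z, g z ∂(gaussianReal 0 1))) = F x - ∫ y, F y ∂ν := by
    intro x
    rw [hEF, Finset.sum_sub_distrib]
  simp_rw [heq]
  rw [← ofReal_integral_eq_lintegral_ofReal (hsub _)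
    (ae_of_all _ fun y => (even_two_mul p).pow_nonneg _)] at hle
  refine (ENNReal.ofReal_le_ofReal_iff ?_).1 hle
  have := momentConst_nonneg g p
  positivity

end Poincare
-- Decaying correlations and moments of covariate sums.
-- Past and future of `t` each give a geometric series. Both include `t` itself, which is harmless
-- for nonnegative terms.
lemma sum_pow_dist_le {ρ : ℝ} (hρ0 : 0 < ρ) (hρ1 : ρ < 1) (t n : ℕ) (c : ℕ → ℝ) {K : ℝ}
    (hK : 0 ≤ K) (h1 : ∀ k, c (t + k) ≤ K * ρ ^ k) (h2 : ∀ s k, s + k = t → c s ≤ K * ρ ^ k)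
    (hc : ∀ s, 0 ≤ c s) :
    ∑ s ∈ Finset.range n, c s ≤ 2 * K / (1 - ρ) := by
  have hgeo : ∀ j, ∑ k ∈ Finset.range j, ρ ^ k ≤ 1 / (1 - ρ) := by
    intro j
    rw [geom_sum_eq hρ1.ne, ← neg_div_neg_eq, neg_sub, neg_sub]
    have := pow_pos hρ0 j
    exact div_le_div_of_nonneg_right (by linarith) (by linarith)
  have hA : ∑ s ∈ Finset.range (t + 1), c s ≤ K * (1 / (1 - ρ)) := by
    rw [← Finset.sum_range_reflect]
    refine le_trans (Finset.sum_le_sum (g := fun k => K * ρ ^ k) fun k hk => ?_) ?_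
    · have := Finset.mem_range.1 hk
      exact h2 _ k (by omega)
    · rw [← Finset.mul_sum]
      exact mul_le_mul_of_nonneg_left (hgeo _) hK
  have hB : ∑ s ∈ Finset.Ico t (t + n), c s ≤ K * (1 / (1 - ρ)) := by
    rw [Finset.sum_Ico_eq_sum_range]
    refine le_trans (Finset.sum_le_sum (g := fun k => K * ρ ^ k) fun k _ => h1 k) ?_
    rw [← Finset.mul_sum]
    exact mul_le_mul_of_nonneg_left (hgeo _) hK
  calc ∑ s ∈ Finset.range n, c s
      ≤ ∑ s ∈ Finset.range (t + 1) ∪ Finset.Ico t (t + n), c s := by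
        refine Finset.sum_le_sum_of_subset_of_nonneg ?_ fun s _ _ => hc s
        intro s hs
        simp only [Finset.mem_union, Finset.mem_range, Finset.mem_Ico] at hs ⊢
        omega
    _ ≤ ∑ s ∈ Finset.range (t + 1), c s + ∑ s ∈ Finset.Ico t (t + n), c s := by
        rw [← Finset.sum_union_inter]
        have : 0 ≤ ∑ s ∈ Finset.range (t + 1) ∩ Finset.Ico t (t + n), c s :=
          Finset.sum_nonneg fun s _ => hc s
        linarith
    _ ≤ 2 * K / (1 - ρ) := by
        have : 2 * K / (1 - ρ) = K * (1 / (1 - ρ)) + K * (1 / (1 - ρ)) := by ring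
        linarith

namespace IsCovariateProcess

variable {Ω : Type*} [MeasurableSpace Ω] {μ : Measure Ω} {V : ℕ → ℕ → Ω → ℝ} {K ρ : ℝ}

lemma integrable_comp (hV : IsCovariateProcess μ V K ρ) {f : ℝ → ℝ} (hf : ExpBdd f)
    (hm : Measurable f) (i t : ℕ) : Integrable (fun ω => f (V i t ω)) μ := by
  have h := hf.integrable hm
  rw [← (hV.marginal i t).map_eq] at h
  exact h.comp_measurable (hV.measurable i t)

lemma integral_comp (hV : IsCovariateProcess μ V K ρ) {f : ℝ → ℝ}
    (hm : Measurable f) (i t : ℕ) : ∫ ω, f (V i t ω) ∂μ = ∫ z, f z ∂(gaussianReal 0 1) := by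
  rw [← (hV.marginal i t).map_eq, integral_map (hV.measurable i t).aemeasurable
    hm.aestronglyMeasurable]

lemma one_le (hV : IsCovariateProcess μ V K ρ) : 1 ≤ K := by
  have h := hV.decay 0 0 0 0
  have h2 : ∫ ω, V 0 0 ω * V 0 0 ω ∂μ = 1 := by
    rw [hV.integral_comp (f := fun z => z * z) (by fun_prop)]
    have h3 := variance_of_integral_eq_zero (μ := gaussianReal 0 1) (X := fun x => x)
      (by fun_prop) (by simp)
    rw [variance_fun_id_gaussianReal] at h3
    simpa [sq] using h3.symm
  simpa [h2] using h

lemma integral_sum_sub_pow_le (hV : IsCovariateProcess μ V K ρ) {g : ℝ → ℝ} (hg : ContDiff ℝ 1 g)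
    (hb : ExpBdd g) (hb' : ExpBdd (deriv g)) (p : ℕ) (hp : 1 ≤ p) (I : Finset (ℕ × ℕ))
    (r : ℝ) (hr0 : 0 ≤ r)
    (hr : ∀ k ∈ I, ∑ l ∈ I, |∫ ω, V k.1 k.2 ω * V l.1 l.2 ω ∂μ| ≤ r) :
    ∫ ω, (∑ k ∈ I, (g (V k.1 k.2 ω) - ∫ z, g z ∂(gaussianReal 0 1))) ^ (2 * p) ∂μ ≤
      momentConst g p * r ^ p * (I.card : ℝ) ^ p := by
  set X : Ω → I → ℝ := fun ω => I.restrict (fun k => V k.1 k.2 ω) with hX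
  have hXm : Measurable X := measurable_pi_lambda _ fun k => hV.measurable _ _
  have hG : IsGaussian (μ.map X) := (hV.gaussian.hasGaussianLaw I).isGaussian_map
  have hmarg : ∀ k, (μ.map X).map (fun x => x k) = gaussianReal 0 1 := by
    intro k
    rw [Measure.map_map (by fun_prop) hXm]
    exact (hV.marginal k.1.1 k.1.2).map_eq
  have hgm : Measurable g := hg.continuous.measurable
  have h := RareDefault.integral_sum_sub_pow_le hg hb hb' p hp (μ.map X) hmarg r hr0 (by
    intro k
    have : ∀ l : I, ∫ x, x k * x l ∂(μ.map X) =
        ∫ ω, V k.1.1 k.1.2 ω * V l.1.1 l.1.2 ω ∂μ := by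
      intro l
      rw [integral_map hXm.aemeasurable (by fun_prop)]
      rfl
    simp_rw [this]
    rw [Finset.sum_coe_sort I (fun l => |∫ ω, V k.1.1 k.1.2 ω * V l.1 l.2 ω ∂μ|)]
    exact hr k k.2)
  have hgc := hg.continuous
  rw [integral_map hXm.aemeasurable (Continuous.aestronglyMeasurable (by fun_prop)),
    Fintype.card_coe] at h
  refine le_trans (le_of_eq ?_) h
  refine integral_congr_ae (ae_of_all _ fun ω => ?_)
  simp only [hX, Finset.restrict]
  rw [Finset.sum_coe_sort I (fun k => g (V k.1 k.2 ω) - ∫ z, g z ∂(gaussianReal 0 1))]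

/-- Correlations decay in time only. Every firm of `J` may share a common factor, whence the factor
`J.card`. -/
lemma sum_cov_le (hV : IsCovariateProcess μ V K ρ) (hρ : ρ ∈ Set.Ioo (0 : ℝ) 1) (J : Finset ℕ)
    (n i t : ℕ) :
    ∑ l ∈ J ×ˢ Finset.range n, |∫ ω, V i t ω * V l.1 l.2 ω ∂μ| ≤ J.card * (2 * K / (1 - ρ)) := by
  rw [Finset.sum_product, ← nsmul_eq_mul]
  refine Finset.sum_le_card_nsmul _ _ _ fun j _ => ?_
  refine sum_pow_dist_le hρ.1 hρ.2 t n _ (zero_le_one.trans hV.one_le) (fun k => hV.decay i j t k)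
    (fun s k hsk => ?_) (fun _ => abs_nonneg _)
  subst hsk
  have := hV.decay j i s k
  simpa only [mul_comm] using this

/-- Moments of centred sums of a function of the covariates of the firms in `J`. -/
lemma integral_sum_rect_le (hV : IsCovariateProcess μ V K ρ) (hρ : ρ ∈ Set.Ioo (0 : ℝ) 1)
    {g : ℝ → ℝ} (hg : ContDiff ℝ 1 g) (hb : ExpBdd g) (hb' : ExpBdd (deriv g)) (p : ℕ)
    (hp : 1 ≤ p) (J : Finset ℕ) (n : ℕ) :
    ∫ ω, (∑ i ∈ J, ∑ t ∈ Finset.range n, (g (V i t ω) - ∫ z, g z ∂(gaussianReal 0 1))) ^ (2 * p) ∂μ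
      ≤ momentConst g p * (2 * K / (1 - ρ)) ^ p * ((J.card : ℝ) ^ 2 * n) ^ p := by
  have hK := hV.one_le
  have hρ' : 0 < 1 - ρ := sub_pos.2 hρ.2
  have h := hV.integral_sum_sub_pow_le hg hb hb' p hp (J ×ˢ Finset.range n)
    (J.card * (2 * K / (1 - ρ))) (by positivity) (fun k _ => hV.sum_cov_le hρ J n k.1 k.2)
  simp_rw [Finset.sum_product] at h
  refine h.trans (le_of_eq ?_)
  rw [Finset.card_product, Finset.card_range]
  push_cast
  ring

end IsCovariateProcess
-- One step of a martingale with Bernoulli innovations.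
/-- The data of one step of a martingale with Bernoulli innovations `w (d - p)`. -/
structure BernoulliStep {Ω : Type*} (𝒢 : MeasurableSpace Ω) [m0 : MeasurableSpace Ω]
    (μ : Measure Ω) (d p M w : Ω → ℝ) : Prop where
  le : 𝒢 ≤ m0
  measurable_d : Measurable d
  zero_or_one : ∀ ω, d ω = 0 ∨ d ω = 1
  condExp : μ[d | 𝒢] =ᵐ[μ] p
  measurable_p : Measurable[𝒢] p
  p_mem : ∀ ω, p ω ∈ Set.Icc (0 : ℝ) 1
  measurable_M : Measurable[𝒢] M
  measurable_w : Measurable[𝒢] w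
  M4 : Integrable (fun ω => M ω ^ 4) μ
  w4 : Integrable (fun ω => w ω ^ 4) μ

section OneStep

variable {Ω : Type*} {𝒢 : MeasurableSpace Ω} [m0 : MeasurableSpace Ω] {μ : Measure Ω}
  [IsProbabilityMeasure μ] {d p M w : Ω → ℝ}

lemma integral_mul_eq_of_condExp (h𝒢 : 𝒢 ≤ m0) (hd : Integrable d μ) (hdp : μ[d | 𝒢] =ᵐ[μ] p)
    {f : Ω → ℝ} (hf : Measurable[𝒢] f) (hfd : Integrable (fun ω => f ω * d ω) μ) :
    ∫ ω, f ω * d ω ∂μ = ∫ ω, f ω * p ω ∂μ := by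
  have h := condExp_mul_of_stronglyMeasurable_left (m := 𝒢) (μ := μ) hf.stronglyMeasurable hfd hd
  rw [← integral_condExp h𝒢]
  refine integral_congr_ae ?_
  filter_upwards [h, hdp] with ω h1 h2
  have h3 : (f * d : Ω → ℝ) = fun ω => f ω * d ω := rfl
  rw [h3] at h1
  rw [h1, Pi.mul_apply, h2]

lemma integrable_mul_of_pow_four (hM4 : Integrable (fun ω => M ω ^ 4) μ) (hw4 : Integrable (fun ω => w ω ^ 4) μ)
    (f : Ω → ℝ) (hf : Measurable f) (h : ∀ ω, |f ω| ≤ M ω ^ 4 + w ω ^ 4) : Integrable f μ :=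
  (hM4.add hw4).mono' hf.aestronglyMeasurable (ae_of_all _ h)

lemma abs_cube_mul_le (x y : ℝ) : |x ^ 3 * y| ≤ x ^ 4 + y ^ 4 := by
  rw [abs_le]
  constructor
  · nlinarith [sq_nonneg (x ^ 2 - y ^ 2), sq_nonneg (x * (x + y)), sq_nonneg (y * (x + y)),
      sq_nonneg (x ^ 2), sq_nonneg (y ^ 2)]
  · nlinarith [sq_nonneg (x ^ 2 - y ^ 2), sq_nonneg (x * (x - y)), sq_nonneg (y * (x - y)),
      sq_nonneg (x ^ 2), sq_nonneg (y ^ 2)]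

lemma abs_sq_mul_sq_le (x y : ℝ) : |x ^ 2 * y ^ 2| ≤ x ^ 4 + y ^ 4 := by
  rw [abs_of_nonneg (by positivity)]
  nlinarith [sq_nonneg (x ^ 2 - y ^ 2), sq_nonneg (x ^ 2), sq_nonneg (y ^ 2)]

namespace BernoulliStep

lemma integrable_d (h : BernoulliStep 𝒢 μ d p M w) : Integrable d μ :=
  (integrable_const (1 : ℝ)).mono' h.measurable_d.aestronglyMeasurable
    (ae_of_all _ fun ω => by rcases h.zero_or_one ω with h | h <;> simp [h])

/-- Pulling `f` out of the conditional expectation replaces `d` by `p`; boundedness of `d` and `p`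
supplies integrability. -/
lemma integral_mul_resid (h : BernoulliStep 𝒢 μ d p M w) {f : Ω → ℝ} (hf : Measurable[𝒢] f)
    (hfi : Integrable f μ) : ∫ ω, f ω * (d ω - p ω) ∂μ = 0 := by
  have hfd : Integrable (fun ω => f ω * d ω) μ :=
    hfi.norm.mono' (hfi.1.mul h.measurable_d.aestronglyMeasurable) (ae_of_all _ fun ω => by
      rcases h.zero_or_one ω with h | h <;> simp [h])
  have hpm := h.measurable_p.mono h.le le_rfl
  have hfp : Integrable (fun ω => f ω * p ω) μ :=
    hfi.norm.mono' (hfi.1.mul hpm.aestronglyMeasurable) (ae_of_all _ fun ω => by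
      have h1 := h.p_mem ω
      rw [norm_mul, Real.norm_of_nonneg h1.1]
      exact mul_le_of_le_one_right (norm_nonneg _) h1.2)
  simp_rw [mul_sub]
  rw [integral_sub hfd hfp, integral_mul_eq_of_condExp h.le h.integrable_d h.condExp hf hfd, sub_self]

/-- Because `d² = d`, one has `(d - p)² = (1 - 2p)(d - p) + (p - p²)`, and the first term integrates
to zero. -/
lemma integral_mul_resid_sq (h : BernoulliStep 𝒢 μ d p M w) {f : Ω → ℝ} (hf : Measurable[𝒢] f)
    (hfi : Integrable f μ) :
    ∫ ω, f ω * (d ω - p ω) ^ 2 ∂μ = ∫ ω, f ω * (p ω - p ω ^ 2) ∂μ := by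
  have hpm := h.measurable_p.mono h.le le_rfl
  have h1 : ∀ q : Ω → ℝ, Measurable q → (∀ ω, |q ω| ≤ 1) → Integrable (fun ω => f ω * q ω) μ :=
    fun q hq hb => hfi.norm.mono' (hfi.1.mul hq.aestronglyMeasurable) (ae_of_all _ fun ω => by
      rw [norm_mul]
      exact mul_le_of_le_one_right (norm_nonneg _) (hb ω))
  have hpp : ∀ ω, |p ω| ≤ 1 := fun ω => by
    rw [abs_of_nonneg (h.p_mem ω).1]; exact (h.p_mem ω).2
  have h2p : ∀ ω, |1 - 2 * p ω| ≤ 1 := fun ω => by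
    have := h.p_mem ω
    rw [abs_le]; constructor <;> linarith [this.1, this.2]
  have hi1 : Integrable (fun ω => f ω * (1 - 2 * p ω)) μ := h1 _ (by fun_prop) h2p
  have h2 := h.integral_mul_resid (f := fun ω => f ω * (1 - 2 * p ω))
    (hf.mul (measurable_const.sub (h.measurable_p.const_mul 2))) hi1
  have hi2 : Integrable (fun ω => f ω * (1 - 2 * p ω) * (d ω - p ω)) μ := by
    refine hi1.norm.mono' (hi1.1.mul (h.measurable_d.sub hpm).aestronglyMeasurable)
      (ae_of_all _ fun ω => ?_)
    rw [norm_mul]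
    refine mul_le_of_le_one_right (norm_nonneg _) ?_
    have := h.p_mem ω
    rw [Real.norm_eq_abs, abs_le]
    rcases h.zero_or_one ω with h | h <;> rw [h] <;> constructor <;> linarith [this.1, this.2]
  have hi3 : Integrable (fun ω => f ω * (p ω - p ω ^ 2)) μ := h1 _ (by fun_prop) fun ω => by
    have := h.p_mem ω
    rw [abs_le]; constructor <;> nlinarith [this.1, this.2]
  calc ∫ ω, f ω * (d ω - p ω) ^ 2 ∂μ
      = ∫ ω, (f ω * (1 - 2 * p ω) * (d ω - p ω) + f ω * (p ω - p ω ^ 2)) ∂μ := by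
        refine integral_congr_ae (ae_of_all _ fun ω => ?_)
        rcases h.zero_or_one ω with h | h <;> simp only [h] <;> ring
    _ = _ := by rw [integral_add hi2 hi3, h2, zero_add]

lemma abs_resid_le (h : BernoulliStep 𝒢 μ d p M w) (ω : Ω) : |d ω - p ω| ≤ 1 := by
  have := h.p_mem ω
  rw [abs_le]
  rcases h.zero_or_one ω with h | h <;> rw [h] <;> constructor <;> linarith [this.1, this.2]

lemma integrable_sq_mul_sq (h : BernoulliStep 𝒢 μ d p M w) :
    Integrable (fun ω => M ω ^ 2 * w ω ^ 2) μ := by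
  have hM := h.measurable_M.mono h.le le_rfl
  have hw := h.measurable_w.mono h.le le_rfl
  exact integrable_mul_of_pow_four h.M4 h.w4 _ (by fun_prop) fun ω => abs_sq_mul_sq_le _ _

lemma integrable_sq {f : Ω → ℝ} (hf : Measurable f) (h : Integrable (fun ω => f ω ^ 4) μ) :
    Integrable (fun ω => f ω ^ 2) μ :=
  (h.add (integrable_const (1 : ℝ))).mono' (by fun_prop) (ae_of_all _ fun ω => by
    rw [Real.norm_of_nonneg (by positivity)]
    simp only [Pi.add_apply]
    nlinarith [sq_nonneg (f ω ^ 2 - 1), sq_nonneg (f ω ^ 2)])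

/-- Second moment after one step. -/
lemma integral_sq (h : BernoulliStep 𝒢 μ d p M w) :
    ∫ ω, (M ω + w ω * (d ω - p ω)) ^ 2 ∂μ =
      ∫ ω, M ω ^ 2 ∂μ + ∫ ω, w ω ^ 2 * (p ω - p ω ^ 2) ∂μ := by
  have hM := h.measurable_M.mono h.le le_rfl
  have hw := h.measurable_w.mono h.le le_rfl
  have hp := h.measurable_p.mono h.le le_rfl
  have hd := h.measurable_d
  have hM2 := integrable_sq hM h.M4
  have hw2 := integrable_sq hw h.w4
  have hMw : Integrable (fun ω => 2 * M ω * w ω) μ :=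
    (hM2.add hw2).mono' (by fun_prop) (ae_of_all _ fun ω => by
      simp only [Pi.add_apply]
      rw [Real.norm_eq_abs, abs_le]
      constructor <;> nlinarith [sq_nonneg (M ω + w ω), sq_nonneg (M ω - w ω)])
  have hr : ∀ f : Ω → ℝ, Integrable f μ → Integrable (fun ω => f ω * (d ω - p ω)) μ :=
    fun f hf => hf.norm.mono' (hf.1.mul (by fun_prop)) (ae_of_all _ fun ω => by
      rw [norm_mul]; exact mul_le_of_le_one_right (norm_nonneg _) (h.abs_resid_le ω))
  have hr2 : Integrable (fun ω => w ω ^ 2 * (d ω - p ω) ^ 2) μ := by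
    refine (hr _ (hr _ hw2)).congr (ae_of_all _ fun ω => ?_)
    simp only
    ring
  calc ∫ ω, (M ω + w ω * (d ω - p ω)) ^ 2 ∂μ
      = ∫ ω, (M ω ^ 2 + (2 * M ω * w ω * (d ω - p ω) + w ω ^ 2 * (d ω - p ω) ^ 2)) ∂μ :=
        integral_congr_ae (ae_of_all _ fun ω => by simp only; ring)
    _ = _ := by
        have hi : Integrable (fun ω => 2 * M ω * w ω * (d ω - p ω) + w ω ^ 2 * (d ω - p ω) ^ 2) μ :=
          (hr _ hMw).add hr2
        rw [integral_add hM2 hi, integral_add (hr _ hMw) hr2,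
          h.integral_mul_resid (f := fun ω => 2 * M ω * w ω) ((h.measurable_M.const_mul 2).mul h.measurable_w) hMw,
          h.integral_mul_resid_sq (f := fun ω => w ω ^ 2) (h.measurable_w.pow_const 2) hw2, zero_add]

lemma integrable_pow_four (h : BernoulliStep 𝒢 μ d p M w) :
    Integrable (fun ω => (M ω + w ω * (d ω - p ω)) ^ 4) μ := by
  have hM := h.measurable_M.mono h.le le_rfl
  have hw := h.measurable_w.mono h.le le_rfl
  have hp := h.measurable_p.mono h.le le_rfl
  have hd := h.measurable_d
  refine ((h.M4.add h.w4).const_mul 8).mono' (by fun_prop) (ae_of_all _ fun ω => ?_)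
  rw [Real.norm_of_nonneg (by positivity)]
  have h1 : (w ω * (d ω - p ω)) ^ 4 ≤ w ω ^ 4 := by
    rw [mul_pow]
    refine mul_le_of_le_one_right (by positivity) ?_
    have := pow_le_one₀ (n := 4) (abs_nonneg _) (h.abs_resid_le ω)
    rwa [Even.pow_abs (by decide)] at this
  simp only [Pi.add_apply]
  generalize w ω * (d ω - p ω) = y at h1
  nlinarith [sq_nonneg (M ω - y), sq_nonneg (M ω + y), sq_nonneg (M ω ^ 2 - y ^ 2),
    sq_nonneg (M ω * (M ω - y)), sq_nonneg (y * (M ω - y)), mul_nonneg (sq_nonneg (M ω - y)) (sq_nonneg (M ω + y)), sq_nonneg ((M ω - y)^2)]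

/-- Fourth moment after one step. -/
lemma integral_pow_four_le (h : BernoulliStep 𝒢 μ d p M w) :
    ∫ ω, (M ω + w ω * (d ω - p ω)) ^ 4 ∂μ ≤
      ∫ ω, M ω ^ 4 ∂μ + 8 * ∫ ω, M ω ^ 2 * (w ω ^ 2 * p ω) ∂μ + 3 * ∫ ω, w ω ^ 4 * p ω ∂μ := by
  have hM := h.measurable_M.mono h.le le_rfl
  have hw := h.measurable_w.mono h.le le_rfl
  have hp := h.measurable_p.mono h.le le_rfl
  have hd := h.measurable_d
  have hr : ∀ q f : Ω → ℝ, Measurable q → (∀ ω, |q ω| ≤ 1) → Integrable f μ →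
      Integrable (fun ω => f ω * q ω) μ :=
    fun q f hq hb hf => hf.norm.mono' (hf.1.mul hq.aestronglyMeasurable) (ae_of_all _ fun ω => by
      rw [norm_mul]; exact mul_le_of_le_one_right (norm_nonneg _) (hb ω))
  have hM3 : Integrable (fun ω => 4 * (M ω ^ 3 * w ω)) μ := (integrable_mul_of_pow_four h.M4
    h.w4 (fun ω => M ω ^ 3 * w ω) (by fun_prop) fun ω => abs_cube_mul_le _ _).const_mul 4
  have hf : Integrable (fun ω => 8 * (M ω ^ 2 * w ω ^ 2) + 3 * w ω ^ 4) μ :=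
    (h.integrable_sq_mul_sq.const_mul 8).add (h.w4.const_mul 3)
  have hi1 := hr (fun ω => d ω - p ω) _ (by fun_prop) h.abs_resid_le hM3
  have hi2 := hr (fun ω => (d ω - p ω) ^ 2) _ (by fun_prop)
    (fun ω => by rw [abs_pow]; exact pow_le_one₀ (abs_nonneg _) (h.abs_resid_le ω)) hf
  have hpp : ∀ ω, |p ω| ≤ 1 := fun ω => by
    rw [abs_of_nonneg (h.p_mem ω).1]; exact (h.p_mem ω).2
  have hpq : ∀ ω, |p ω - p ω ^ 2| ≤ 1 := fun ω => by
    have := h.p_mem ω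
    rw [abs_le]; constructor <;> nlinarith [this.1, this.2]
  have hA : Integrable (fun ω => M ω ^ 2 * (w ω ^ 2 * p ω)) μ :=
    (hr p _ hp hpp h.integrable_sq_mul_sq).congr (ae_of_all _ fun ω => by simp only; ring)
  have hB : Integrable (fun ω => w ω ^ 4 * p ω) μ := hr p _ hp hpp h.w4
  calc ∫ ω, (M ω + w ω * (d ω - p ω)) ^ 4 ∂μ
      ≤ ∫ ω, (M ω ^ 4 + (4 * (M ω ^ 3 * w ω) * (d ω - p ω) +
          (8 * (M ω ^ 2 * w ω ^ 2) + 3 * w ω ^ 4) * (d ω - p ω) ^ 2)) ∂μ := by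
        refine integral_mono h.integrable_pow_four (h.M4.add (hi1.add hi2)) fun ω => ?_
        simp only
        have h1 : (d ω - p ω) ^ 2 ≤ 1 := by
          rw [← sq_abs]; exact pow_le_one₀ (abs_nonneg _) (h.abs_resid_le ω)
        have h2 := abs_le.1 (h.abs_resid_le ω)
        generalize d ω - p ω = e at h1 h2
        -- The term cubic in `e` is absorbed by `2xy ≤ x² + y²` and `|e| ≤ 1`. It raises the
        -- coefficient of `M²w²e²` from 6 to 8 and that of `w⁴e²` from 1 to 3.
        have h3 : 4 * (M ω * w ω ^ 3 * e ^ 3) ≤ 2 * (M ω ^ 2 * w ω ^ 2 + w ω ^ 4) * e ^ 2 := by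
          have : 0 ≤ w ω ^ 2 * e ^ 2 * (M ω ^ 2 - 2 * M ω * w ω * e + w ω ^ 2) := by
            refine mul_nonneg (by positivity) ?_
            have : 0 ≤ w ω ^ 2 * (1 - e ^ 2) := mul_nonneg (sq_nonneg _) (by linarith)
            nlinarith [sq_nonneg (M ω - w ω * e)]
          nlinarith
        have h4 : w ω ^ 4 * e ^ 4 ≤ w ω ^ 4 * e ^ 2 := by
          have : 0 ≤ w ω ^ 4 * e ^ 2 * (1 - e ^ 2) := mul_nonneg (by positivity) (by linarith)
          nlinarith
        nlinarith
    _ = ∫ ω, M ω ^ 4 ∂μ + ∫ ω, (8 * (M ω ^ 2 * w ω ^ 2) + 3 * w ω ^ 4) * (p ω - p ω ^ 2) ∂μ := by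
        have hi12 : Integrable (fun ω => 4 * (M ω ^ 3 * w ω) * (d ω - p ω) +
          (8 * (M ω ^ 2 * w ω ^ 2) + 3 * w ω ^ 4) * (d ω - p ω) ^ 2) μ := hi1.add hi2
        rw [integral_add h.M4 hi12, integral_add hi1 hi2,
          h.integral_mul_resid (f := fun ω => 4 * (M ω ^ 3 * w ω)) (((h.measurable_M.pow_const 3).mul h.measurable_w).const_mul 4) hM3,
          h.integral_mul_resid_sq (f := fun ω => 8 * (M ω ^ 2 * w ω ^ 2) + 3 * w ω ^ 4) ((((h.measurable_M.pow_const 2).mul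
            (h.measurable_w.pow_const 2)).const_mul 8).add
            ((h.measurable_w.pow_const 4).const_mul 3)) hf, zero_add]
    _ ≤ ∫ ω, M ω ^ 4 ∂μ + ∫ ω, (8 * (M ω ^ 2 * (w ω ^ 2 * p ω)) + 3 * (w ω ^ 4 * p ω)) ∂μ := by
        refine (add_le_add_iff_left _).2 (integral_mono (hr _ _ (by fun_prop) hpq hf)
          ((hA.const_mul 8).add (hB.const_mul 3)) fun ω => ?_)
        simp only
        have : 0 ≤ (8 * (M ω ^ 2 * w ω ^ 2) + 3 * w ω ^ 4) * p ω ^ 2 := by positivity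
        nlinarith
    _ = _ := by
        rw [integral_add (hA.const_mul 8) (hB.const_mul 3), integral_const_mul, integral_const_mul]
        ring

/-- Growth of the fourth moment in one step, in a form suited to iteration. -/
lemma integral_pow_four_le_sq (h : BernoulliStep 𝒢 μ d p M w) {x κ : ℝ} (hx : 1 ≤ x) (hκ : 0 < κ)
    (hMx : ∫ ω, M ω ^ 4 ∂μ ≤ x ^ 2) (h2 : ∫ ω, w ω ^ 4 * p ω ^ 2 ∂μ ≤ κ ^ 2)
    (h1 : ∫ ω, w ω ^ 4 * p ω ∂μ ≤ κ) :
    ∫ ω, (M ω + w ω * (d ω - p ω)) ^ 4 ∂μ ≤ (x + 8 * κ) ^ 2 := by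
  have hM := h.measurable_M.mono h.le le_rfl
  have hw := h.measurable_w.mono h.le le_rfl
  have hp := h.measurable_p.mono h.le le_rfl
  have hcs : ∫ ω, M ω ^ 2 * (w ω ^ 2 * p ω) ∂μ ≤ x * κ := by
    have hi2 : Integrable (fun ω => w ω ^ 4 * p ω ^ 2) μ :=
      h.w4.mono' (by fun_prop) (ae_of_all _ fun ω => by
        have := h.p_mem ω
        rw [Real.norm_of_nonneg (by positivity)]
        exact mul_le_of_le_one_right (by positivity) (pow_le_one₀ this.1 this.2))
    have hx0 : 0 < x := by linarith
    -- Cauchy–Schwarz in the form of a weighted arithmetic-geometric mean; with these weights both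
    -- terms integrate to at most `x κ / 2`.
    have hpt : ∀ ω, M ω ^ 2 * (w ω ^ 2 * p ω) ≤
        κ / (2 * x) * M ω ^ 4 + x / (2 * κ) * (w ω ^ 4 * p ω ^ 2) := by
      intro ω
      have : 0 ≤ (κ * M ω ^ 2 - x * (w ω ^ 2 * p ω)) ^ 2 / (2 * x * κ) := by positivity
      have h3 : κ / (2 * x) * M ω ^ 4 + x / (2 * κ) * (w ω ^ 4 * p ω ^ 2) -
          M ω ^ 2 * (w ω ^ 2 * p ω) =
          (κ * M ω ^ 2 - x * (w ω ^ 2 * p ω)) ^ 2 / (2 * x * κ) := by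
        field_simp
        ring
      linarith
    calc ∫ ω, M ω ^ 2 * (w ω ^ 2 * p ω) ∂μ
        ≤ ∫ ω, (κ / (2 * x) * M ω ^ 4 + x / (2 * κ) * (w ω ^ 4 * p ω ^ 2)) ∂μ := by
          refine integral_mono_of_nonneg (ae_of_all _ fun ω => ?_)
            ((h.M4.const_mul _).add (hi2.const_mul _)) (ae_of_all _ hpt)
          have := (h.p_mem ω).1
          simp only [Pi.zero_apply]
          positivity
      _ = κ / (2 * x) * ∫ ω, M ω ^ 4 ∂μ + x / (2 * κ) * ∫ ω, w ω ^ 4 * p ω ^ 2 ∂μ := by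
          rw [integral_add (h.M4.const_mul _) (hi2.const_mul _), integral_const_mul,
            integral_const_mul]
      _ ≤ κ / (2 * x) * x ^ 2 + x / (2 * κ) * κ ^ 2 := by gcongr
      _ = x * κ := by field_simp; ring
  -- It remains that `x² + 8xκ + 3κ ≤ (x + 8κ)²`, where `x ≥ 1` absorbs the last term on the left.
  refine h.integral_pow_four_le.trans ?_
  nlinarith

end BernoulliStep

end OneStep

/-! ### Default times, histories, and the successive disclosure of defaults. -/

section DefaultTimes

variable {Ω : Type*} {V D : ℕ → ℕ → Ω → ℝ}
  {h : ℝ → ℝ} {β a : ℝ} {m T : ℕ}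

/-- For `t < T` the cap `T - 1` in `exitTime` plays no role. -/
lemma le_exitTime_iff (T : ℕ) (D : ℕ → ℕ → Ω → ℝ) (i t : ℕ) (ht : t < T) (ω : Ω) :
    t ≤ exitTime T D i ω ↔ ∀ s < t, D i (s + 1) ω ≠ 1 := by
  constructor
  · intro h s hs hD
    have : exitTime T D i ω ≤ s := Nat.sInf_le (Or.inl hD)
    omega
  · intro h
    refine le_csInf ⟨T - 1, Or.inr rfl⟩ ?_
    rintro b (hb | hb)
    · by_contra hlt
      exact h b (not_le.1 hlt) hb
    · rw [Set.mem_singleton_iff] at hb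
      omega

/-- The conditional default probability of firm `i` in `(t, t + 1]`. -/
noncomputable def defaultProb (T : ℕ) (V D : ℕ → ℕ → Ω → ℝ) (h : ℝ → ℝ) (β a : ℝ) (i t : ℕ) (ω : Ω) :
    ℝ :=
  if t ≤ exitTime T D i ω then link h (β * V i t ω - a) else 0

lemma defaultProb_mem (hq : ∀ x, link h x ∈ Set.Icc (0 : ℝ) 1) (T : ℕ) (V D : ℕ → ℕ → Ω → ℝ)
    (β a : ℝ) (i t : ℕ) (ω : Ω) : defaultProb T V D h β a i t ω ∈ Set.Icc (0 : ℝ) 1 := by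
  unfold defaultProb
  split_ifs
  · exact hq _
  · simp

lemma measurable_covariate_history {i t s : ℕ} (hi : i < m) (hs : s ≤ t) :
    Measurable[history m V D t] (V i s) := by
  rw [measurable_iff_comap_le]
  refine le_trans ?_ le_sup_left
  exact le_iSup₂_of_le i (Finset.mem_range.2 hi)
    (le_iSup₂_of_le (f := fun s _ => MeasurableSpace.comap (V i s) inferInstance) s
      (Finset.mem_Icc.2 ⟨Nat.zero_le _, hs⟩) le_rfl)

lemma measurable_default_history {i t s : ℕ} (hi : i < m) (hs1 : 1 ≤ s) (hs : s ≤ t) :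
    Measurable[history m V D t] (D i s) := by
  rw [measurable_iff_comap_le]
  refine le_trans ?_ le_sup_right
  exact le_iSup₂_of_le i (Finset.mem_range.2 hi)
    (le_iSup₂_of_le (f := fun s _ => MeasurableSpace.comap (D i s) inferInstance) s
      (Finset.mem_Icc.2 ⟨hs1, hs⟩) le_rfl)

lemma history_le [m0 : MeasurableSpace Ω] (hV : ∀ i t, Measurable (V i t)) (hD : ∀ i t, Measurable (D i t)) (m t : ℕ) :
    history m V D t ≤ m0 :=
  sup_le (iSup₂_le fun i _ => iSup₂_le fun s _ => (hV i s).comap_le)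
    (iSup₂_le fun i _ => iSup₂_le fun s _ => (hD i s).comap_le)

/-- Being alive at `t` is decided by the indicators dated `1, …, t`, which belong to the history at
`t`. -/
lemma measurableSet_alive {i t : ℕ} (hi : i < m) (ht : t < T) :
    MeasurableSet[history m V D t] {ω | t ≤ exitTime T D i ω} := by
  have : {ω | t ≤ exitTime T D i ω} = ⋂ s ∈ Finset.range t, {ω | D i (s + 1) ω = 1}ᶜ := by
    ext ω
    simp only [Set.mem_ofPred_eq, le_exitTime_iff T D i t ht, Set.mem_iInter, Finset.mem_range,
      Set.mem_compl_iff, ne_eq]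
  rw [this]
  refine Finset.measurableSet_biInter _ fun s hs => ?_
  have hs' := Finset.mem_range.1 hs
  exact (measurable_default_history hi (by omega) (by omega) (measurableSet_singleton 1)).compl

lemma measurable_link (hh : Continuous h) : Measurable (link h) := by
  unfold link
  exact Continuous.measurable (by fun_prop)

lemma measurable_defaultProb_history (hh : Continuous h) {i t : ℕ} (hi : i < m) (ht : t < T) :
    Measurable[history m V D t] (defaultProb T V D h β a i t) := by
  unfold defaultProb
  refine Measurable.ite (measurableSet_alive hi ht) ?_ measurable_const
  have h1 : Measurable fun v : ℝ => link h (β * v - a) :=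
    (measurable_link hh).comp (by fun_prop)
  exact h1.comp (measurable_covariate_history hi le_rfl)

/-- The information available just before the default indicator of firm `i` in `(t, t + 1]` is
revealed, when the firms are revealed in order. -/
@[reducible] def fineHistory (m : ℕ) (V D : ℕ → ℕ → Ω → ℝ) (t i : ℕ) : MeasurableSpace Ω :=
  MeasurableSpace.generateFrom {A | ∃ B, MeasurableSet[history m V D t] B ∧
    ∃ S ⊆ Finset.range i, A = B ∩ {ω | ∀ j ∈ S, D j (t + 1) ω = 1}}

lemma history_le_fineHistory (t i : ℕ) : history m V D t ≤ fineHistory m V D t i := by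
  intro B hB
  exact MeasurableSpace.measurableSet_generateFrom ⟨B, hB, ∅, by simp, by simp⟩

lemma measurable_default_fineHistory (hD : ∀ i t ω, D i t ω = 0 ∨ D i t ω = 1) {t i j : ℕ}
    (hj : j < i) : Measurable[fineHistory m V D t i] (D j (t + 1)) := by
  have hA : MeasurableSet[fineHistory m V D t i] {ω | D j (t + 1) ω = 1} :=
    MeasurableSpace.measurableSet_generateFrom
      ⟨Set.univ, @MeasurableSet.univ _ (history m V D t), {j}, by simpa using hj, by simp⟩
  have h1 : D j (t + 1) = Set.indicator {ω | D j (t + 1) ω = 1} (fun _ => (1 : ℝ)) := by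
    funext ω
    rcases hD j (t + 1) ω with h | h <;> simp [Set.indicator, h]
  rw [h1]
  exact Measurable.indicator (m := fineHistory m V D t i) measurable_const hA

lemma fineHistory_le [m0 : MeasurableSpace Ω] (hV : ∀ i t, Measurable (V i t)) (hD : ∀ i t, Measurable (D i t))
    (m t i : ℕ) : fineHistory m V D t i ≤ m0 := by
  refine MeasurableSpace.generateFrom_le ?_
  rintro A ⟨B, hB, S, -, rfl⟩
  refine (history_le hV hD m t B hB).inter ?_
  have : {ω | ∀ j ∈ S, D j (t + 1) ω = 1} = ⋂ j ∈ S, {ω | D j (t + 1) ω = 1} := by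
    ext; simp
  rw [this]
  exact Finset.measurableSet_biInter _ fun j _ => measurableSet_eq_fun (hD j _) measurable_const

namespace IsDefaultProcess

variable [m0 : MeasurableSpace Ω] {μ : Measure Ω} [IsProbabilityMeasure μ]

lemma prod_default_eq (hDp : IsDefaultProcess μ V D h β a m T) (S : Finset ℕ) (t : ℕ) (ω : Ω) :
    ∏ j ∈ S, D j t ω = Set.indicator {ω | ∀ j ∈ S, D j t ω = 1} (fun _ => (1 : ℝ)) ω := by
  by_cases hω : ∀ j ∈ S, D j t ω = 1
  · rw [Set.indicator_of_mem (show ω ∈ {ω | ∀ j ∈ S, D j t ω = 1} from hω)]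
    exact Finset.prod_eq_one hω
  · rw [Set.indicator_of_notMem (show ω ∉ {ω | ∀ j ∈ S, D j t ω = 1} from hω)]
    push Not at hω
    obtain ⟨j, hj, hne⟩ := hω
    exact Finset.prod_eq_zero hj ((hDp.zero_or_one j t ω).resolve_right hne)

lemma abs_prod_le (hDp : IsDefaultProcess μ V D h β a m T) (S : Finset ℕ) (t : ℕ) (ω : Ω) :
    ‖∏ j ∈ S, D j t ω‖ ≤ 1 := by
  rw [hDp.prod_default_eq]
  refine (norm_indicator_le_norm_self _ _).trans (by simp)

lemma integrable_prod (hDp : IsDefaultProcess μ V D h β a m T) (S : Finset ℕ) (t : ℕ) :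
    Integrable (fun ω => ∏ j ∈ S, D j t ω) μ :=
  (integrable_const (1 : ℝ)).mono'
    (Finset.measurable_fun_prod _ fun j _ => hDp.measurable j t).aestronglyMeasurable
    (ae_of_all _ fun ω => hDp.abs_prod_le S t ω)

lemma condExp_prod (hDp : IsDefaultProcess μ V D h β a m T) {t : ℕ} (ht : t < T) (S : Finset ℕ)
    (hS : S ⊆ Finset.range m) :
    μ[fun ω => ∏ j ∈ S, D j (t + 1) ω | history m V D t] =ᵐ[μ]
      fun ω => ∏ j ∈ S, defaultProb T V D h β a j t ω := by
  have h1 : ∀ᵐ ω ∂μ, ∀ j ∈ S, (μ[D j (t + 1) | history m V D t]) ω =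
      defaultProb T V D h β a j t ω := by
    refine (Finset.eventually_all S).2 fun j hj => ?_
    exact hDp.condProb j (Finset.mem_range.1 (hS hj)) t ht
  filter_upwards [hDp.condIndep t ht S hS, h1] with ω h2 h3
  rw [h2]
  exact Finset.prod_congr rfl h3

/-- The default probability of firm `i` is not changed by the default indicators of the firms
that precede it. -/
lemma condExp_fineHistory (hDp : IsDefaultProcess μ V D h β a m T) (hV : ∀ i t, Measurable (V i t))
    (hh : Continuous h) (hq : ∀ x, link h x ∈ Set.Icc (0 : ℝ) 1) {t i : ℕ} (ht : t < T)
    (hi : i < m) :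
    μ[D i (t + 1) | fineHistory m V D t i] =ᵐ[μ] defaultProb T V D h β a i t := by
  have hF := history_le hV hDp.measurable m t
  have hG := fineHistory_le hV hDp.measurable m t i
  have hpm := measurable_defaultProb_history (V := V) (D := D) (β := β) (a := a) hh hi ht
  have hdi : Integrable (D i (t + 1)) μ := by
    simpa using hDp.integrable_prod {i} (t + 1)
  have hpi : Integrable (defaultProb T V D h β a i t) μ :=
    (integrable_const (1 : ℝ)).mono' (hpm.mono hF le_rfl).aestronglyMeasurable
      (ae_of_all _ fun ω => by
        have := defaultProb_mem hq T V D β a i t ω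
        rw [Real.norm_of_nonneg this.1]; exact this.2)
  -- On a generating set the indicator of "all firms of `S` default" is a product, so both integrals
  -- are computed from conditional expectations of products given the coarse history.
  have hbase : ∀ B, MeasurableSet[history m V D t] B → ∀ S ⊆ Finset.range i,
      ∫ ω in B ∩ {ω | ∀ j ∈ S, D j (t + 1) ω = 1}, defaultProb T V D h β a i t ω ∂μ =
      ∫ ω in B ∩ {ω | ∀ j ∈ S, D j (t + 1) ω = 1}, D i (t + 1) ω ∂μ := by
    intro B hB S hS
    have hSm : S ⊆ Finset.range m := hS.trans (Finset.range_mono hi.le)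
    have hiS : i ∉ S := fun h => by simpa using hS h
    have hins : insert i S ⊆ Finset.range m :=
      Finset.insert_subset (Finset.mem_range.2 hi) hSm
    have hmeas : MeasurableSet {ω | ∀ j ∈ S, D j (t + 1) ω = 1} := by
      have : {ω | ∀ j ∈ S, D j (t + 1) ω = 1} = ⋂ j ∈ S, {ω | D j (t + 1) ω = 1} := by
        ext; simp
      rw [this]
      exact Finset.measurableSet_biInter _ fun j _ =>
        measurableSet_eq_fun (hDp.measurable j _) measurable_const
    have hconv : ∀ f : Ω → ℝ, ∫ ω in B ∩ {ω | ∀ j ∈ S, D j (t + 1) ω = 1}, f ω ∂μ =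
        ∫ ω in B, f ω * ∏ j ∈ S, D j (t + 1) ω ∂μ := by
      intro f
      rw [← setIntegral_indicator hmeas]
      refine integral_congr_ae (ae_of_all _ fun ω => ?_)
      simp only
      rw [hDp.prod_default_eq]
      by_cases hω : ω ∈ {ω | ∀ j ∈ S, D j (t + 1) ω = 1}
      · rw [Set.indicator_of_mem hω, Set.indicator_of_mem hω, mul_one]
      · rw [Set.indicator_of_notMem hω, Set.indicator_of_notMem hω, mul_zero]
    rw [hconv, hconv]
    -- Conditional independence is used for `insert i S` here and for `S` in `hL`; both sides become
    -- the integral of the same product of default probabilities.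
    have hR : ∫ ω in B, D i (t + 1) ω * ∏ j ∈ S, D j (t + 1) ω ∂μ =
        ∫ ω in B, ∏ j ∈ insert i S, defaultProb T V D h β a j t ω ∂μ := by
      have h1 : ∀ ω, D i (t + 1) ω * ∏ j ∈ S, D j (t + 1) ω = ∏ j ∈ insert i S, D j (t + 1) ω :=
        fun ω => (Finset.prod_insert (f := fun j => D j (t + 1) ω) hiS).symm
      simp_rw [h1]
      rw [← setIntegral_condExp hF (hDp.integrable_prod (insert i S) (t + 1)) hB]
      exact integral_congr_ae (ae_restrict_of_ae (hDp.condExp_prod ht _ hins))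
    have hfi : Integrable (fun ω => defaultProb T V D h β a i t ω *
        ∏ j ∈ S, D j (t + 1) ω) μ := by
      refine hpi.norm.mono' (hpi.1.mul (hDp.integrable_prod S (t + 1)).1) (ae_of_all _ fun ω => ?_)
      rw [norm_mul]
      exact mul_le_of_le_one_right (norm_nonneg _) (hDp.abs_prod_le S _ ω)
    have hL : ∫ ω in B, defaultProb T V D h β a i t ω * ∏ j ∈ S, D j (t + 1) ω ∂μ =
        ∫ ω in B, ∏ j ∈ insert i S, defaultProb T V D h β a j t ω ∂μ := by
      rw [← setIntegral_condExp hF hfi hB]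
      refine integral_congr_ae (ae_restrict_of_ae ?_)
      filter_upwards [condExp_mul_of_stronglyMeasurable_left (m := history m V D t) (μ := μ)
        hpm.stronglyMeasurable hfi (hDp.integrable_prod S (t + 1)), hDp.condExp_prod ht S hSm]
        with ω h1 h2
      rw [Finset.prod_insert hiS, ← h2]
      exact h1
    rw [hL, hR]
  symm
  refine ae_eq_condExp_of_forall_setIntegral_eq hG hdi (fun s _ _ => hpi.integrableOn) ?_
    (hpm.mono (history_le_fineHistory t i) le_rfl).stronglyMeasurable.aestronglyMeasurable
  intro s hs _
  have huniv : ∫ ω, defaultProb T V D h β a i t ω ∂μ = ∫ ω, D i (t + 1) ω ∂μ := by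
    have := hbase Set.univ (@MeasurableSet.univ _ (history m V D t)) ∅ (by simp)
    simpa using this
  -- The generating sets of `fineHistory` are stable under intersection, so agreement on them
  -- extends to the whole sigma-algebra.
  refine MeasurableSpace.induction_on_inter
    (C := fun s _ => ∫ ω in s, defaultProb T V D h β a i t ω ∂μ =
      ∫ ω in s, D i (t + 1) ω ∂μ) (m := fineHistory m V D t i) rfl ?_ ?_ ?_ ?_ ?_ s hs
  · rintro _ ⟨B, hB, S, hS, rfl⟩ _ ⟨B', hB', S', hS', rfl⟩ _
    refine ⟨B ∩ B', @MeasurableSet.inter _ (history m V D t) _ _ hB hB', S ∪ S',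
      Finset.union_subset hS hS', ?_⟩
    ext ω
    simp only [Set.mem_inter_iff, Set.mem_ofPred_eq, Finset.mem_union]
    constructor
    · rintro ⟨⟨h1, h2⟩, h3, h4⟩
      exact ⟨⟨h1, h3⟩, fun j hj => hj.elim (h2 j) (h4 j)⟩
    · rintro ⟨⟨h1, h3⟩, h2⟩
      exact ⟨⟨h1, fun j hj => h2 j (Or.inl hj)⟩, h3, fun j hj => h2 j (Or.inr hj)⟩
  · simp
  · rintro _ ⟨B, hB, S, hS, rfl⟩
    exact hbase B hB S hS
  · intro A hA ih
    rw [setIntegral_compl (hG A hA) hpi, setIntegral_compl (hG A hA) hdi, huniv, ih]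
  · intro f hdisj hf ih
    rw [integral_iUnion (fun n => hG _ (hf n)) hdisj hpi.integrableOn,
      integral_iUnion (fun n => hG _ (hf n)) hdisj hdi.integrableOn]
    simp_rw [ih]

end IsDefaultProcess

end DefaultTimes

/-! ### Moments of the weighted sum of default innovations. -/

section Martingale

variable {Ω : Type*} {V D : ℕ → ℕ → Ω → ℝ} {h : ℝ → ℝ} {β a : ℝ} {m T : ℕ}

lemma history_mono {s t : ℕ} (hst : s ≤ t) : history m V D s ≤ history m V D t := by
  refine sup_le_sup ?_ ?_
  · refine iSup₂_mono fun i _ => biSup_mono fun u hu => ?_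
    rw [Finset.mem_Icc] at hu ⊢
    exact ⟨hu.1, hu.2.trans hst⟩
  · refine iSup₂_mono fun i _ => biSup_mono fun u hu => ?_
    rw [Finset.mem_Icc] at hu ⊢
    exact ⟨hu.1, hu.2.trans hst⟩

/-- The weighted innovation of firm `i` in `(t, t + 1]`. -/
noncomputable def innovation (T : ℕ) (V D : ℕ → ℕ → Ω → ℝ) (h : ℝ → ℝ) (β a : ℝ) (w : ℝ → ℝ)
    (i t : ℕ) (ω : Ω) : ℝ :=
  w (V i t ω) * (D i (t + 1) ω - defaultProb T V D h β a i t ω)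

/-- The weighted sum of the innovations before the default indicator of firm `i` in `(t, t + 1]`
is revealed. -/
noncomputable def partialMartingale (m T : ℕ) (V D : ℕ → ℕ → Ω → ℝ) (h : ℝ → ℝ) (β a : ℝ)
    (w : ℝ → ℝ) (t i : ℕ) (ω : Ω) : ℝ :=
  ∑ s ∈ Finset.range t, ∑ j ∈ Finset.range m, innovation T V D h β a w j s ω +
    ∑ j ∈ Finset.range i, innovation T V D h β a w j t ω

lemma partialMartingale_succ (w : ℝ → ℝ) (t i : ℕ) (ω : Ω) :
    partialMartingale m T V D h β a w t (i + 1) ω =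
      partialMartingale m T V D h β a w t i ω + innovation T V D h β a w i t ω := by
  rw [partialMartingale, partialMartingale, Finset.sum_range_succ _ i, add_assoc]

lemma partialMartingale_end (w : ℝ → ℝ) (t : ℕ) :
    partialMartingale m T V D h β a w (t + 1) 0 = partialMartingale m T V D h β a w t m := by
  funext ω
  simp [partialMartingale, Finset.sum_range_succ]

lemma measurable_partialMartingale (hD : ∀ i t ω, D i t ω = 0 ∨ D i t ω = 1) (hh : Continuous h)
    {w : ℝ → ℝ} (hw : Measurable w) {t i : ℕ} (ht : t < T) (hi : i ≤ m) :
    Measurable[fineHistory m V D t i] (partialMartingale m T V D h β a w t i) := by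
  have hle := history_le_fineHistory (m := m) (V := V) (D := D) t i
  unfold partialMartingale
  refine Measurable.add (Finset.measurable_fun_sum _ fun s hs => Finset.measurable_fun_sum _
    fun j hj => ?_) (Finset.measurable_fun_sum _ fun j hj => ?_)
  · have hs' := Finset.mem_range.1 hs
    have hj' := Finset.mem_range.1 hj
    refine Measurable.mul (hw.comp ((measurable_covariate_history hj' hs'.le).mono hle le_rfl))
      (Measurable.sub ?_ ?_)
    · exact (measurable_default_history hj' (by omega) hs').mono hle le_rfl
    · exact (measurable_defaultProb_history hh hj' (hs'.trans ht)).mono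
        ((history_mono hs'.le).trans hle) le_rfl
  · have hj' := (Finset.mem_range.1 hj).trans_le hi
    refine Measurable.mul (hw.comp ((measurable_covariate_history hj' le_rfl).mono hle le_rfl))
      (Measurable.sub ?_ ?_)
    · exact measurable_default_fineHistory hD (Finset.mem_range.1 hj)
    · exact (measurable_defaultProb_history hh hj' ht).mono hle le_rfl

variable [m0 : MeasurableSpace Ω] {μ : Measure Ω} [IsProbabilityMeasure μ] {K ρ : ℝ}

lemma bernoulliStep (hV : IsCovariateProcess μ V K ρ) (hDp : IsDefaultProcess μ V D h β a m T)
    (hh : Continuous h) (hq : ∀ x, link h x ∈ Set.Icc (0 : ℝ) 1) {w : ℝ → ℝ} (hw : Measurable w)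
    (hwb : ExpBdd w) {t i : ℕ} (ht : t < T) (hi : i < m)
    (hM4 : Integrable (fun ω => partialMartingale m T V D h β a w t i ω ^ 4) μ) :
    BernoulliStep (fineHistory m V D t i) μ (D i (t + 1)) (defaultProb T V D h β a i t)
      (partialMartingale m T V D h β a w t i) (fun ω => w (V i t ω)) where
  le := fineHistory_le hV.measurable hDp.measurable m t i
  measurable_d := hDp.measurable _ _
  zero_or_one := hDp.zero_or_one _ _
  condExp := hDp.condExp_fineHistory hV.measurable hh hq ht hi
  measurable_p := (measurable_defaultProb_history hh hi ht).mono (history_le_fineHistory t i) le_rfl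
  p_mem := defaultProb_mem hq T V D β a i t
  measurable_M := measurable_partialMartingale hDp.zero_or_one hh hw ht hi.le
  measurable_w := hw.comp
    ((measurable_covariate_history hi le_rfl).mono (history_le_fineHistory t i) le_rfl)
  M4 := hM4
  w4 := hV.integrable_comp (hwb.pow 4) (by fun_prop) i t

/-- Double induction over periods and, within a period, over firms. Each disclosed indicator is one
`BernoulliStep`: the second moment is additive, and the square root of the fourth-moment bound grows
by `8κ`. -/
lemma partialMartingale_moments (hV : IsCovariateProcess μ V K ρ)
    (hDp : IsDefaultProcess μ V D h β a m T) (hh : Continuous h)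
    (hq : ∀ x, link h x ∈ Set.Icc (0 : ℝ) 1) {w : ℝ → ℝ} (hw : Measurable w) (hwb : ExpBdd w)
    {κ : ℝ} (hκ : 0 < κ)
    (h2 : ∀ i < m, ∀ t < T, ∫ ω, w (V i t ω) ^ 4 * defaultProb T V D h β a i t ω ^ 2 ∂μ ≤ κ ^ 2)
    (h1 : ∀ i < m, ∀ t < T, ∫ ω, w (V i t ω) ^ 4 * defaultProb T V D h β a i t ω ∂μ ≤ κ) :
    ∀ t < T, ∀ i ≤ m, Integrable (fun ω => partialMartingale m T V D h β a w t i ω ^ 4) μ ∧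
      ∫ ω, partialMartingale m T V D h β a w t i ω ^ 2 ∂μ =
        (∑ s ∈ Finset.range t, ∑ j ∈ Finset.range m, ∫ ω, w (V j s ω) ^ 2 *
          (defaultProb T V D h β a j s ω - defaultProb T V D h β a j s ω ^ 2) ∂μ) +
        ∑ j ∈ Finset.range i, ∫ ω, w (V j t ω) ^ 2 *
          (defaultProb T V D h β a j t ω - defaultProb T V D h β a j t ω ^ 2) ∂μ ∧
      ∫ ω, partialMartingale m T V D h β a w t i ω ^ 4 ∂μ ≤ (1 + 8 * κ * (t * m + i)) ^ 2 := by
  intro t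
  induction t with
  | zero =>
    intro ht i
    induction i with
    | zero => intro _; simp [partialMartingale]
    | succ i ih =>
      intro hi
      obtain ⟨i4, e2, e4⟩ := ih (by omega)
      have hs := bernoulliStep hV hDp hh hq hw hwb ht (by omega) i4
      have hx : (1 : ℝ) ≤ 1 + 8 * κ * ((0 : ℕ) * m + i) := by
        have : 0 ≤ 8 * κ * ((0 : ℕ) * m + i) := by positivity
        linarith
      simp_rw [partialMartingale_succ]
      refine ⟨hs.integrable_pow_four, ?_, ?_⟩
      · rw [show (∫ ω, (partialMartingale m T V D h β a w 0 i ω +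
          innovation T V D h β a w i 0 ω) ^ 2 ∂μ) = _ from hs.integral_sq, e2,
          Finset.sum_range_succ _ i, add_assoc]
      · refine (hs.integral_pow_four_le_sq hx hκ e4 (h2 i (by omega) 0 ht)
          (h1 i (by omega) 0 ht)).trans (le_of_eq ?_)
        push_cast
        ring
  | succ t iht =>
    intro ht i
    induction i with
    | zero =>
      intro _
      obtain ⟨i4, e2, e4⟩ := iht (by omega) m le_rfl
      rw [partialMartingale_end]
      refine ⟨i4, ?_, ?_⟩
      · rw [e2, Finset.sum_range_succ _ t]; simp
      · refine e4.trans (le_of_eq ?_)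
        push_cast
        ring
    | succ i ih =>
      intro hi
      obtain ⟨i4, e2, e4⟩ := ih (by omega)
      have hs := bernoulliStep hV hDp hh hq hw hwb ht (by omega) i4
      have hx : (1 : ℝ) ≤ 1 + 8 * κ * ((t + 1 : ℕ) * m + i) := by
        have : 0 ≤ 8 * κ * ((t + 1 : ℕ) * m + i) := by positivity
        linarith
      simp_rw [partialMartingale_succ]
      refine ⟨hs.integrable_pow_four, ?_, ?_⟩
      · rw [show (∫ ω, (partialMartingale m T V D h β a w (t + 1) i ω +
          innovation T V D h β a w i (t + 1) ω) ^ 2 ∂μ) = _ from hs.integral_sq, e2,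
          Finset.sum_range_succ _ i, add_assoc]
      · refine (hs.integral_pow_four_le_sq hx hκ e4 (h2 i (by omega) _ ht)
          (h1 i (by omega) _ ht)).trans (le_of_eq ?_)
        push_cast
        ring

/-- The sum over all firms and periods of the weighted innovations. -/
noncomputable def fullMartingale (m T : ℕ) (V D : ℕ → ℕ → Ω → ℝ) (h : ℝ → ℝ) (β a : ℝ)
    (w : ℝ → ℝ) (ω : Ω) : ℝ :=
  ∑ s ∈ Finset.range T, ∑ j ∈ Finset.range m, innovation T V D h β a w j s ω

lemma fullMartingale_moments (hV : IsCovariateProcess μ V K ρ)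
    (hDp : IsDefaultProcess μ V D h β a m T) (hh : Continuous h)
    (hq : ∀ x, link h x ∈ Set.Icc (0 : ℝ) 1) {w : ℝ → ℝ} (hw : Measurable w) (hwb : ExpBdd w)
    {κ : ℝ} (hκ : 0 < κ)
    (h2 : ∀ i < m, ∀ t < T, ∫ ω, w (V i t ω) ^ 4 * defaultProb T V D h β a i t ω ^ 2 ∂μ ≤ κ ^ 2)
    (h1 : ∀ i < m, ∀ t < T, ∫ ω, w (V i t ω) ^ 4 * defaultProb T V D h β a i t ω ∂μ ≤ κ) :
    Integrable (fun ω => fullMartingale m T V D h β a w ω ^ 4) μ ∧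
      ∫ ω, fullMartingale m T V D h β a w ω ^ 2 ∂μ =
        ∑ s ∈ Finset.range T, ∑ j ∈ Finset.range m, ∫ ω, w (V j s ω) ^ 2 *
          (defaultProb T V D h β a j s ω - defaultProb T V D h β a j s ω ^ 2) ∂μ ∧
      ∫ ω, fullMartingale m T V D h β a w ω ^ 4 ∂μ ≤ (1 + 8 * κ * (T * m)) ^ 2 := by
  rcases T with _ | T
  · simp [fullMartingale]
  · have := partialMartingale_moments hV hDp hh hq hw hwb hκ h2 h1 T (by omega) m le_rfl
    have heq : ∀ ω, fullMartingale m (T + 1) V D h β a w ω =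
        partialMartingale m (T + 1) V D h β a w T m ω := fun ω => by
      rw [fullMartingale, Finset.sum_range_succ, partialMartingale]
    simp_rw [heq]
    refine ⟨this.1, ?_, this.2.2.trans (le_of_eq ?_)⟩
    · rw [this.2.1, Finset.sum_range_succ _ T]
    · push_cast
      ring

end Martingale

/-! ### Cauchy–Schwarz for expectations. -/

section CauchySchwarz

variable {Ω : Type*} [MeasurableSpace Ω] {μ : Measure Ω}

lemma integral_mul_le_sqrt_mul_sqrt {f g : Ω → ℝ} (hf : AEStronglyMeasurable f μ)
    (hg : AEStronglyMeasurable g μ) (hf2 : Integrable (fun ω => f ω ^ 2) μ)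
    (hg2 : Integrable (fun ω => g ω ^ 2) μ) (hf0 : 0 ≤ᵐ[μ] f) (hg0 : 0 ≤ᵐ[μ] g) :
    ∫ ω, f ω * g ω ∂μ ≤ √(∫ ω, f ω ^ 2 ∂μ) * √(∫ ω, g ω ^ 2 ∂μ) := by
  have h := integral_mul_le_Lp_mul_Lq_of_nonneg (p := 2) (q := 2) (μ := μ) (f := f) (g := g)
    Real.HolderConjugate.two_two hf0 hg0
    (by simpa using (memLp_two_iff_integrable_sq hf).2 hf2)
    (by simpa using (memLp_two_iff_integrable_sq hg).2 hg2)
  simpa [Real.sqrt_eq_rpow] using h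

lemma integral_abs_le_sqrt [IsProbabilityMeasure μ] {f : Ω → ℝ} (hf : AEStronglyMeasurable f μ)
    (hf2 : Integrable (fun ω => f ω ^ 2) μ) : ∫ ω, |f ω| ∂μ ≤ √(∫ ω, f ω ^ 2 ∂μ) := by
  have h := integral_mul_le_sqrt_mul_sqrt (μ := μ) (f := fun ω => |f ω|) (g := fun _ => 1)
    hf.norm aestronglyMeasurable_const (by simpa using hf2) (by simp)
    (ae_of_all _ fun ω => abs_nonneg _) (ae_of_all _ fun ω => zero_le_one)
  simpa using h

end CauchySchwarz

/-! ### Size of default probabilities and the effect of past defaults. -/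

/-- Expectation under the standard normal distribution. -/
noncomputable def gaussExp (f : ℝ → ℝ) : ℝ := ∫ z, f z ∂(gaussianReal 0 1)

lemma gaussExp_nonneg {f : ℝ → ℝ} (hf : ∀ z, 0 ≤ f z) : 0 ≤ gaussExp f := integral_nonneg hf

/-- Upper bound for the default probability, up to the factor `γ`. -/
noncomputable def probBound (β C v : ℝ) : ℝ := Real.exp (β * v) + C * Real.exp (2 * β * v)

lemma expBdd_probBound (β C : ℝ) : ExpBdd (probBound β C) :=
  (ExpBdd.exp β).add ((ExpBdd.const C).mul (ExpBdd.exp (2 * β)))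

lemma measurable_probBound (β C : ℝ) : Measurable (probBound β C) := by
  unfold probBound
  fun_prop

namespace IsCorrection

variable {h : ℝ → ℝ} {β C : ℝ}

lemma continuous (hh : IsCorrection h β C) : Continuous h := by
  have := hh.differentiable 0 (by norm_num)
  rw [iteratedDeriv_zero] at this
  exact this.continuous

lemma nonneg (hh : IsCorrection h β C) : 0 ≤ C := by
  have := (abs_nonneg _).trans (hh.bound 0)
  simpa using this

lemma probBound_nonneg (hh : IsCorrection h β C) (v : ℝ) : 0 ≤ probBound β C v := by
  have := hh.nonneg
  unfold probBound
  positivity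

lemma abs_link_sub_le (hh : IsCorrection h β C) (x : ℝ) :
    |link h x - Real.exp x| ≤ C * Real.exp x ^ 2 := by
  have h1 : link h x - Real.exp x = Real.exp x * h x := by unfold link; ring
  rw [h1, abs_mul, Real.abs_exp, sq]
  nlinarith [hh.bound x, Real.exp_pos x]

lemma exp_sub_offset {γ : ℝ} (hγ : 0 < γ) (x : ℝ) :
    Real.exp (x - offset γ) = γ * Real.exp x := by
  rw [offset, one_div, Real.log_inv, sub_neg_eq_add, Real.exp_add, Real.exp_log hγ, mul_comm]

lemma abs_link_offset_sub_le (hh : IsCorrection h β C) {γ : ℝ} (hγ : 0 < γ) (b v : ℝ) :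
    |link h (b * v - offset γ) - γ * Real.exp (b * v)| ≤ C * γ ^ 2 * Real.exp (2 * b * v) := by
  have h1 := hh.abs_link_sub_le (b * v - offset γ)
  rw [exp_sub_offset hγ] at h1
  refine h1.trans (le_of_eq ?_)
  rw [mul_pow, ← Real.exp_nat_mul]
  push_cast
  ring_nf

lemma link_offset_le (hh : IsCorrection h β C) {γ : ℝ} (hγ : 0 < γ) (hγ1 : γ ≤ 1) (v : ℝ) :
    link h (β * v - offset γ) ≤ γ * probBound β C v := by
  have h1 := (abs_le.1 (hh.abs_link_offset_sub_le hγ β v)).2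
  have h2 : C * γ ^ 2 * Real.exp (2 * β * v) ≤ C * γ * Real.exp (2 * β * v) := by
    have := hh.nonneg
    gcongr
    nlinarith
  unfold probBound
  linarith

end IsCorrection

/-- The indicator that firm `i` has not defaulted by time `t`. -/
noncomputable def alive {Ω : Type*} (T : ℕ) (D : ℕ → ℕ → Ω → ℝ) (i t : ℕ) (ω : Ω) : ℝ :=
  if t ≤ exitTime T D i ω then 1 else 0

section FixedScale

variable {Ω : Type*} {V D : ℕ → ℕ → Ω → ℝ} {h : ℝ → ℝ} {β C K ρ γ : ℝ} {m T i t : ℕ}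

lemma alive_mem (T : ℕ) (D : ℕ → ℕ → Ω → ℝ) (i t : ℕ) (ω : Ω) :
    alive T D i t ω = 0 ∨ alive T D i t ω = 1 := by
  unfold alive
  split_ifs <;> simp

lemma alive_nonneg (T : ℕ) (D : ℕ → ℕ → Ω → ℝ) (i t : ℕ) (ω : Ω) : 0 ≤ alive T D i t ω := by
  rcases alive_mem T D i t ω with h | h <;> rw [h]
  exact zero_le_one

lemma alive_le_one (T : ℕ) (D : ℕ → ℕ → Ω → ℝ) (i t : ℕ) (ω : Ω) : alive T D i t ω ≤ 1 := by
  rcases alive_mem T D i t ω with h | h <;> rw [h]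
  exact zero_le_one

lemma defaultProb_eq_alive_mul (a : ℝ) (ω : Ω) :
    defaultProb T V D h β a i t ω = alive T D i t ω * link h (β * V i t ω - a) := by
  unfold defaultProb alive
  split_ifs <;> simp

lemma defaultProb_le (hh : IsCorrection h β C) (hγ : 0 < γ) (hγ1 : γ ≤ 1) (ω : Ω) :
    defaultProb T V D h β (offset γ) i t ω ≤ γ * probBound β C (V i t ω) := by
  rw [defaultProb_eq_alive_mul]
  refine le_trans ?_ (hh.link_offset_le hγ hγ1 _)
  exact mul_le_of_le_one_left (hh.prob _).1 (alive_le_one _ _ _ _ _)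

lemma abs_defaultProb_sub_le (hh : IsCorrection h β C) (hγ : 0 < γ) (ω : Ω) :
    |defaultProb T V D h β (offset γ) i t ω - alive T D i t ω * (γ * Real.exp (β * V i t ω))| ≤
      C * γ ^ 2 * Real.exp (2 * β * V i t ω) := by
  rw [defaultProb_eq_alive_mul, ← mul_sub, abs_mul, abs_of_nonneg (alive_nonneg _ _ _ _ _)]
  refine le_trans ?_ (hh.abs_link_offset_sub_le hγ β _)
  exact mul_le_of_le_one_left (abs_nonneg _) (alive_le_one _ _ _ _ _)

/-- A firm that is gone at `t` has an earlier indicator equal to one; the sum is the union bound. -/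
lemma one_sub_alive_le (hD : ∀ i t ω, D i t ω = 0 ∨ D i t ω = 1) (ht : t < T) (ω : Ω) :
    1 - alive T D i t ω ≤ ∑ s ∈ Finset.range t, D i (s + 1) ω := by
  have hnn : ∀ s, 0 ≤ D i (s + 1) ω := fun s => by
    rcases hD i (s + 1) ω with h | h <;> rw [h]
    exact zero_le_one
  unfold alive
  split_ifs with h
  · rw [sub_self]
    exact Finset.sum_nonneg fun s _ => hnn s
  · rw [le_exitTime_iff T D i t ht] at h
    push Not at h
    obtain ⟨s, hs, hD1⟩ := h
    rw [sub_zero, ← hD1]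
    exact Finset.single_le_sum (f := fun s => D i (s + 1) ω) (fun s _ => hnn s)
      (Finset.mem_range.2 hs)

variable [m0 : MeasurableSpace Ω] {μ : Measure Ω} [IsProbabilityMeasure μ]

lemma measurable_alive (hV : IsCovariateProcess μ V K ρ) (hD : ∀ i t, Measurable (D i t))
    (ht : t < T) : Measurable (alive T D i t) := by
  unfold alive
  refine Measurable.ite ?_ measurable_const measurable_const
  -- The history of the first `i + 1` firms already contains firm `i`, so no bound on `i` is needed.
  exact history_le hV.measurable hD (i + 1) t _ (measurableSet_alive (Nat.lt_succ_self i) ht)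

lemma measurable_defaultProb (hV : IsCovariateProcess μ V K ρ) (hD : ∀ i t, Measurable (D i t))
    (hh : Continuous h) (a : ℝ) (ht : t < T) : Measurable (defaultProb T V D h β a i t) :=
  (measurable_defaultProb_history hh (Nat.lt_succ_self i) ht).mono
    (history_le hV.measurable hD (i + 1) t) le_rfl

lemma integrable_comp_mul (hV : IsCovariateProcess μ V K ρ) {f : ℝ → ℝ} (hf : ExpBdd f)
    (hm : Measurable f) {g : Ω → ℝ} (hg : Measurable g) (hb : ∀ ω, |g ω| ≤ 1) :
    Integrable (fun ω => f (V i t ω) * g ω) μ := by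
  have hi := hV.integrable_comp hf hm i t
  refine hi.norm.mono' (hi.1.mul hg.aestronglyMeasurable) (ae_of_all _ fun ω => ?_)
  rw [norm_mul]
  exact mul_le_of_le_one_right (norm_nonneg _) (hb ω)

lemma abs_default_le (hD : ∀ i t ω, D i t ω = 0 ∨ D i t ω = 1) (i t : ℕ) (ω : Ω) :
    |D i t ω| ≤ 1 := by
  rcases hD i t ω with h | h <;> simp [h]

lemma abs_defaultProb_le (hh : IsCorrection h β C) (a : ℝ) (i t : ℕ) (ω : Ω) :
    |defaultProb T V D h β a i t ω| ≤ 1 := by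
  have := defaultProb_mem hh.prob T V D β a i t ω
  rw [abs_of_nonneg this.1]
  exact this.2

lemma abs_alive_le (T : ℕ) (D : ℕ → ℕ → Ω → ℝ) (i t : ℕ) (ω : Ω) : |alive T D i t ω| ≤ 1 := by
  rw [abs_of_nonneg (alive_nonneg _ _ _ _ _)]
  exact alive_le_one _ _ _ _ _

lemma integral_comp_mul_default (hV : IsCovariateProcess μ V K ρ) {a : ℝ}
    (hDp : IsDefaultProcess μ V D h β a m T) {f : ℝ → ℝ} (hf : ExpBdd f) (hm : Measurable f)
    (hi : i < m) (ht : t < T) :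
    ∫ ω, f (V i t ω) * D i (t + 1) ω ∂μ =
      ∫ ω, f (V i t ω) * defaultProb T V D h β a i t ω ∂μ := by
  have hd : Integrable (D i (t + 1)) μ := by simpa using hDp.integrable_prod {i} (t + 1)
  exact integral_mul_eq_of_condExp (history_le hV.measurable hDp.measurable m t) hd
    (hDp.condProb i hi t ht) (f := fun ω => f (V i t ω))
    (hm.comp (measurable_covariate_history hi le_rfl))
    (integrable_comp_mul hV hf hm (hDp.measurable _ _) (abs_default_le hDp.zero_or_one _ _))

lemma integral_comp_mul_defaultProb_le (hV : IsCovariateProcess μ V K ρ) (hh : IsCorrection h β C)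
    (hD : ∀ i t, Measurable (D i t))
    (hγ : 0 < γ) (hγ1 : γ ≤ 1) {f : ℝ → ℝ} (hf : ExpBdd f) (hm : Measurable f) (hf0 : ∀ z, 0 ≤ f z)
    (ht : t < T) :
    ∫ ω, f (V i t ω) * defaultProb T V D h β (offset γ) i t ω ∂μ ≤
      γ * gaussExp (fun z => f z * probBound β C z) := by
  have hb := hf.mul (expBdd_probBound β C)
  have hbm : Measurable fun z => f z * probBound β C z := hm.mul (measurable_probBound β C)
  rw [gaussExp, ← hV.integral_comp hbm i t, ← integral_const_mul]
  refine integral_mono (integrable_comp_mul hV hf hm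
    (measurable_defaultProb hV hD hh.continuous _ ht) (abs_defaultProb_le hh _ _ _))
    ((hV.integrable_comp hb hbm i t).const_mul γ) fun ω => ?_
  have := mul_le_mul_of_nonneg_left (defaultProb_le (T := T) (V := V) (D := D) (i := i) (t := t)
    hh hγ hγ1 ω) (hf0 (V i t ω))
  simp only
  linarith

lemma integral_comp_mul_defaultProb_sq_le (hV : IsCovariateProcess μ V K ρ)
    (hh : IsCorrection h β C) (hD : ∀ i t, Measurable (D i t))
    (hγ : 0 < γ) (hγ1 : γ ≤ 1) {f : ℝ → ℝ} (hf : ExpBdd f) (hm : Measurable f) (hf0 : ∀ z, 0 ≤ f z)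
    (ht : t < T) :
    ∫ ω, f (V i t ω) * defaultProb T V D h β (offset γ) i t ω ^ 2 ∂μ ≤
      γ ^ 2 * gaussExp (fun z => f z * probBound β C z ^ 2) := by
  have hb := hf.mul ((expBdd_probBound β C).pow 2)
  have hbm : Measurable fun z => f z * probBound β C z ^ 2 :=
    hm.mul ((measurable_probBound β C).pow_const 2)
  have hpm := measurable_defaultProb (i := i) (β := β) hV hD hh.continuous (offset γ) ht
  rw [gaussExp, ← hV.integral_comp hbm i t, ← integral_const_mul]
  refine integral_mono (integrable_comp_mul hV hf hm (hpm.pow_const 2) fun ω => ?_)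
    ((hV.integrable_comp hb hbm i t).const_mul _) fun ω => ?_
  · rw [abs_pow]
    exact pow_le_one₀ (abs_nonneg _) (abs_defaultProb_le hh _ _ _ _)
  · have h1 := defaultProb_le (T := T) (V := V) (D := D) (i := i) (t := t) hh hγ hγ1 ω
    have h2 := pow_le_pow_left₀ (defaultProb_mem hh.prob T V D β (offset γ) i t ω).1 h1 2
    have := mul_le_mul_of_nonneg_left h2 (hf0 (V i t ω))
    simp only
    rw [mul_pow] at this
    linarith

/-- Union bound over at most `T` periods, each with a default probability of order `γ`. -/
lemma integral_dead_le (hV : IsCovariateProcess μ V K ρ) (hh : IsCorrection h β C)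
    (hγ : 0 < γ) (hγ1 : γ ≤ 1) (hDp : IsDefaultProcess μ V D h β (offset γ) m T) (hi : i < m)
    (ht : t < T) :
    ∫ ω, (1 - alive T D i t ω) ∂μ ≤ γ * T * gaussExp (probBound β C) := by
  have hdi : ∀ s, Integrable (D i (s + 1)) μ := fun s => by
    simpa using hDp.integrable_prod {i} (s + 1)
  have hq0 : 0 ≤ gaussExp (probBound β C) := gaussExp_nonneg hh.probBound_nonneg
  calc ∫ ω, (1 - alive T D i t ω) ∂μ
      ≤ ∫ ω, ∑ s ∈ Finset.range t, D i (s + 1) ω ∂μ := by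
        refine integral_mono_of_nonneg (ae_of_all _ fun ω => sub_nonneg.2 (alive_le_one _ _ _ _ _))
          (integrable_finsetSum _ fun s _ => hdi s)
          (ae_of_all _ fun ω => one_sub_alive_le hDp.zero_or_one ht ω)
    _ = ∑ s ∈ Finset.range t, ∫ ω, D i (s + 1) ω ∂μ := integral_finsetSum _ fun s _ => hdi s
    _ ≤ ∑ s ∈ Finset.range t, γ * gaussExp (probBound β C) := by
        refine Finset.sum_le_sum fun s hs => ?_
        have hs' := (Finset.mem_range.1 hs).trans ht
        have h1 := integral_comp_mul_default hV hDp (ExpBdd.const 1) measurable_const hi hs'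
        have h2 := integral_comp_mul_defaultProb_le (i := i) hV hh hDp.measurable hγ hγ1
          (ExpBdd.const 1) measurable_const (fun _ => zero_le_one) hs'
        simp only [one_mul] at h1 h2
        rw [h1]
        exact h2
    _ ≤ γ * T * gaussExp (probBound β C) := by
        rw [Finset.sum_const, Finset.card_range, nsmul_eq_mul]
        have : (t : ℝ) ≤ T := by exact_mod_cast ht.le
        have h3 : 0 ≤ γ * gaussExp (probBound β C) := by positivity
        nlinarith

/-- Survival and the current covariate are dependent, so the expectation does not factor.
Cauchy–Schwarz separates them at the price of a square root. -/
lemma integral_abs_comp_mul_dead_le (hV : IsCovariateProcess μ V K ρ) (hh : IsCorrection h β C)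
    (hγ : 0 < γ) (hγ1 : γ ≤ 1) (hDp : IsDefaultProcess μ V D h β (offset γ) m T) (hi : i < m)
    (ht : t < T) {f : ℝ → ℝ} (hf : ExpBdd f) (hm : Measurable f) :
    ∫ ω, |f (V i t ω)| * (1 - alive T D i t ω) ∂μ ≤
      √(gaussExp (fun z => f z ^ 2)) * √(γ * T * gaussExp (probBound β C)) := by
  have hal := measurable_alive (i := i) hV hDp.measurable ht
  have hfm : Measurable fun ω => |f (V i t ω)| := (hm.comp (hV.measurable i t)).abs
  have hsq : ∀ ω, (1 - alive T D i t ω) ^ 2 = 1 - alive T D i t ω := fun ω => by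
    rcases alive_mem T D i t ω with h | h <;> rw [h] <;> norm_num
  refine (integral_mul_le_sqrt_mul_sqrt (g := fun ω => 1 - alive T D i t ω)
    hfm.aestronglyMeasurable (measurable_const.sub hal).aestronglyMeasurable ?_ ?_ (ae_of_all _ fun ω => abs_nonneg _)
    (ae_of_all _ fun ω => sub_nonneg.2 (alive_le_one _ _ _ _ _))).trans ?_
  · simpa using hV.integrable_comp (hf.pow 2) (hm.pow_const 2) i t
  · simp_rw [hsq]
    exact (integrable_const 1).sub ((integrable_const (1 : ℝ)).mono' hal.aestronglyMeasurable
      (ae_of_all _ fun ω => abs_alive_le _ _ _ _ _))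
  · simp_rw [hsq, sq_abs]
    rw [hV.integral_comp (f := fun z => f z ^ 2) (hm.pow_const 2)]
    exact mul_le_mul_of_nonneg_left (Real.sqrt_le_sqrt (integral_dead_le hV hh hγ hγ1 hDp hi ht))
      (Real.sqrt_nonneg _)

end FixedScale

/-! ### The class of test functions for the laws of large numbers. -/

/-- Continuously differentiable functions of at most exponential growth, together with their
derivative. -/
structure SmoothExp (g : ℝ → ℝ) : Prop where
  contDiff : ContDiff ℝ 1 g
  bdd : ExpBdd g
  bdd_deriv : ExpBdd (deriv g)

namespace SmoothExp

variable {f g : ℝ → ℝ}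

lemma measurable (hg : SmoothExp g) : Measurable g := hg.contDiff.continuous.measurable

lemma const (c : ℝ) : SmoothExp (fun _ => c) :=
  ⟨contDiff_const, ExpBdd.const c, by simpa using ExpBdd.const 0⟩

lemma id : SmoothExp (fun v => v) :=
  ⟨contDiff_id, ExpBdd.id, by simpa using ExpBdd.const 1⟩

lemma exp (b : ℝ) : SmoothExp (fun v => Real.exp (b * v)) := by
  refine ⟨by fun_prop, ExpBdd.exp b, ?_⟩
  have : deriv (fun v => Real.exp (b * v)) = fun v => b * Real.exp (b * v) := by
    funext v
    have h := ((hasDerivAt_id v).const_mul b).exp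
    simp only [_root_.id, mul_one] at h
    rw [h.deriv, mul_comm]
  rw [this]
  exact (ExpBdd.const b).mul (ExpBdd.exp b)

lemma mul (hf : SmoothExp f) (hg : SmoothExp g) : SmoothExp (fun v => f v * g v) := by
  refine ⟨hf.contDiff.mul hg.contDiff, hf.bdd.mul hg.bdd, ?_⟩
  have : deriv (fun v => f v * g v) = fun v => deriv f v * g v + f v * deriv g v := by
    funext v
    exact deriv_fun_mul (hf.contDiff.differentiable (by norm_num) v)
      (hg.contDiff.differentiable (by norm_num) v)
  rw [this]
  exact (hf.bdd_deriv.mul hg.bdd).add (hf.bdd.mul hg.bdd_deriv)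

lemma add (hf : SmoothExp f) (hg : SmoothExp g) : SmoothExp (fun v => f v + g v) := by
  refine ⟨hf.contDiff.add hg.contDiff, hf.bdd.add hg.bdd, ?_⟩
  have : deriv (fun v => f v + g v) = fun v => deriv f v + deriv g v := by
    funext v
    exact deriv_fun_add (hf.contDiff.differentiable (by norm_num) v)
      (hg.contDiff.differentiable (by norm_num) v)
  rw [this]
  exact hf.bdd_deriv.add hg.bdd_deriv

lemma pow (hf : SmoothExp f) (n : ℕ) : SmoothExp (fun v => f v ^ n) := by
  induction n with
  | zero => simpa using SmoothExp.const 1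
  | succ n ih => simpa [pow_succ] using ih.mul hf

lemma sub_const (hf : SmoothExp f) (c : ℝ) : SmoothExp (fun v => f v - c) := by
  simpa [sub_eq_add_neg] using hf.add (SmoothExp.const (-c))

end SmoothExp

/-! ### Laws of large numbers for survivors and defaulters, and martingale moments. -/

section LawOfLargeNumbers

variable {Ω : Type*} {V : ℕ → ℕ → Ω → ℝ} {h : ℝ → ℝ} {β C K ρ : ℝ}
  [m0 : MeasurableSpace Ω] {μ : Measure Ω} [IsProbabilityMeasure μ]

lemma abs_sum_sum_le {m T : ℕ} (f : ℕ → ℕ → ℝ) :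
    |∑ t ∈ Finset.range T, ∑ i ∈ Finset.range m, f i t| ≤
      ∑ t ∈ Finset.range T, ∑ i ∈ Finset.range m, |f i t| :=
  (Finset.abs_sum_le_sum_abs _ _).trans
    (Finset.sum_le_sum fun _ _ => Finset.abs_sum_le_sum_abs _ _)

lemma integral_sum_sum {m T : ℕ} {f : ℕ → ℕ → Ω → ℝ}
    (hf : ∀ i < m, ∀ t < T, Integrable (f i t) μ) :
    ∫ ω, ∑ t ∈ Finset.range T, ∑ i ∈ Finset.range m, f i t ω ∂μ =
      ∑ t ∈ Finset.range T, ∑ i ∈ Finset.range m, ∫ ω, f i t ω ∂μ := by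
  rw [integral_finsetSum _ fun t ht => integrable_finsetSum _ fun i hi =>
    hf i (Finset.mem_range.1 hi) t (Finset.mem_range.1 ht)]
  exact Finset.sum_congr rfl fun t ht => integral_finsetSum _ fun i hi =>
    hf i (Finset.mem_range.1 hi) t (Finset.mem_range.1 ht)

lemma integrable_sum_sum {m T : ℕ} {f : ℕ → ℕ → Ω → ℝ}
    (hf : ∀ i < m, ∀ t < T, Integrable (f i t) μ) :
    Integrable (fun ω => ∑ t ∈ Finset.range T, ∑ i ∈ Finset.range m, f i t ω) μ :=
  integrable_finsetSum _ fun t ht => integrable_finsetSum _ fun i hi =>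
    hf i (Finset.mem_range.1 hi) t (Finset.mem_range.1 ht)

lemma sum_sum_le_of_le {m T : ℕ} {f : ℕ → ℕ → ℝ} {B : ℝ} (hf : ∀ i < m, ∀ t < T, f i t ≤ B) :
    ∑ t ∈ Finset.range T, ∑ i ∈ Finset.range m, f i t ≤ m * T * B := by
  calc ∑ t ∈ Finset.range T, ∑ i ∈ Finset.range m, f i t
      ≤ ∑ t ∈ Finset.range T, ∑ i ∈ Finset.range m, B :=
        Finset.sum_le_sum fun t ht => Finset.sum_le_sum fun i hi =>
          hf i (Finset.mem_range.1 hi) t (Finset.mem_range.1 ht)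
    _ = m * T * B := by
        simp only [Finset.sum_const, Finset.card_range, nsmul_eq_mul]
        ring

/-- The order is `m² T`, not `m T`: averaging takes place over time only, and the relative
fluctuation is `T^{-1/2}`. -/
lemma integral_centred_sum_sq_le (hV : IsCovariateProcess μ V K ρ) (hρ : ρ ∈ Set.Ioo (0 : ℝ) 1)
    {g : ℝ → ℝ} (hg : SmoothExp g) (m T : ℕ) :
    ∫ ω, (∑ t ∈ Finset.range T, ∑ i ∈ Finset.range m, (g (V i t ω) - gaussExp g)) ^ 2 ∂μ ≤
      momentConst g 1 * (2 * K / (1 - ρ)) * ((m : ℝ) ^ 2 * T) := by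
  have h := hV.integral_sum_rect_le hρ hg.contDiff hg.bdd hg.bdd_deriv 1 le_rfl (Finset.range m) T
  simp only [mul_one, pow_one, Finset.card_range] at h
  refine le_trans (le_of_eq ?_) h
  refine integral_congr_ae (ae_of_all _ fun ω => ?_)
  simp only
  rw [Finset.sum_comm]
  rfl

lemma memLp_centred_sum (hV : IsCovariateProcess μ V K ρ)
    {g : ℝ → ℝ} (hg : SmoothExp g) (m T n : ℕ) :
    MemLp (fun ω => ∑ t ∈ Finset.range T, ∑ i ∈ Finset.range m, (g (V i t ω) - gaussExp g)) n μ := by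
  refine memLp_finsetSum _ fun t _ => memLp_finsetSum _ fun i _ => MemLp.sub ?_ (memLp_const _)
  have h := hg.bdd.memLp hg.measurable n
  rw [← (hV.marginal i t).map_eq] at h
  exact h.comp_of_map (hV.measurable i t).aemeasurable

/-- Law of large numbers for the covariates of the surviving firms. -/
lemma exists_lln_alive (hV : IsCovariateProcess μ V K ρ) (hρ : ρ ∈ Set.Ioo (0 : ℝ) 1)
    (hh : IsCorrection h β C) {g : ℝ → ℝ} (hg : SmoothExp g) :
    ∃ A : ℝ, 0 ≤ A ∧ ∀ (D : ℕ → ℕ → Ω → ℝ) (m T : ℕ) (γ : ℝ), 0 < γ → γ ≤ 1 →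
      IsDefaultProcess μ V D h β (offset γ) m T →
      ∫ ω, |∑ t ∈ Finset.range T, ∑ i ∈ Finset.range m,
        (g (V i t ω) * alive T D i t ω - gaussExp g)| ∂μ ≤
      A * (m * T * (√(1 / T) + √(γ * T))) := by
  set A₁ : ℝ := √(momentConst g 1 * (2 * K / (1 - ρ)))
  set A₂ : ℝ := √(gaussExp (fun z => g z ^ 2)) * √(gaussExp (probBound β C)) with hA₂
  have hA₁0 : 0 ≤ A₁ := Real.sqrt_nonneg _
  have hA₂0 : 0 ≤ A₂ := by positivity
  refine ⟨A₁ + A₂, by positivity, fun D m T γ hγ hγ1 hDp => ?_⟩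
  rcases T with _ | T'
  · simp
  set T := T' + 1
  have hT : (0 : ℝ) < T := by positivity
  set X : Ω → ℝ := fun ω => ∑ t ∈ Finset.range T, ∑ i ∈ Finset.range m, (g (V i t ω) - gaussExp g)
  set Y : Ω → ℝ := fun ω => ∑ t ∈ Finset.range T, ∑ i ∈ Finset.range m,
    |g (V i t ω)| * (1 - alive T D i t ω) with hY
  have hXm := memLp_centred_sum hV hg m T 2
  have hX : ∫ ω, |X ω| ∂μ ≤ A₁ * (m * T * √(1 / T)) := by
    refine (integral_abs_le_sqrt hXm.1 (by exact_mod_cast hXm.integrable_sq)).trans ?_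
    refine (Real.sqrt_le_sqrt (integral_centred_sum_sq_le hV hρ hg m T)).trans (le_of_eq ?_)
    rw [Real.sqrt_mul' _ (by positivity)]
    congr 1
    rw [Real.sqrt_mul (by positivity), Real.sqrt_sq (by positivity), one_div, Real.sqrt_inv,
      mul_assoc, ← div_eq_mul_inv, Real.div_sqrt]
  have hdi : ∀ i < m, ∀ t < T, Integrable (fun ω => |g (V i t ω)| * (1 - alive T D i t ω)) μ :=
    fun i _ t ht => integrable_comp_mul hV hg.bdd.abs (by have := hg.measurable; fun_prop)
      (measurable_const.sub (measurable_alive hV hDp.measurable ht)) fun ω => by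
        rcases alive_mem T D i t ω with h | h <;> rw [h] <;> norm_num
  have hYi : Integrable Y μ := integrable_sum_sum hdi
  have hYle : ∫ ω, Y ω ∂μ ≤ A₂ * (m * T * √(γ * T)) := by
    rw [hY, integral_sum_sum hdi]
    refine (sum_sum_le_of_le fun i hi t ht =>
      integral_abs_comp_mul_dead_le hV hh hγ hγ1 hDp hi ht hg.bdd hg.measurable).trans
      (le_of_eq ?_)
    rw [Real.sqrt_mul (by positivity) (gaussExp _), hA₂]
    ring
  have hXi : Integrable (fun ω => |X ω|) μ := (hXm.integrable (by norm_num)).abs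
  calc ∫ ω, |∑ t ∈ Finset.range T, ∑ i ∈ Finset.range m,
        (g (V i t ω) * alive T D i t ω - gaussExp g)| ∂μ
      ≤ ∫ ω, (|X ω| + Y ω) ∂μ := by
        refine integral_mono_of_nonneg (ae_of_all _ fun ω => abs_nonneg _) (hXi.add hYi)
          (ae_of_all _ fun ω => ?_)
        have h1 : ∑ t ∈ Finset.range T, ∑ i ∈ Finset.range m,
            (g (V i t ω) * alive T D i t ω - gaussExp g) = X ω -
            ∑ t ∈ Finset.range T, ∑ i ∈ Finset.range m, g (V i t ω) * (1 - alive T D i t ω) := by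
          simp only [X, ← Finset.sum_sub_distrib]
          exact Finset.sum_congr rfl fun t _ => Finset.sum_congr rfl fun i _ => by ring
        simp only
        rw [h1]
        refine (abs_sub _ _).trans (add_le_add_right ((abs_sum_sum_le _).trans (le_of_eq ?_)) _)
        refine Finset.sum_congr rfl fun t _ => Finset.sum_congr rfl fun i _ => ?_
        rw [abs_mul, abs_of_nonneg (sub_nonneg.2 (alive_le_one T D i t ω))]
    _ = ∫ ω, |X ω| ∂μ + ∫ ω, Y ω ∂μ := integral_add hXi hYi
    _ ≤ A₁ * (m * T * √(1 / T)) + A₂ * (m * T * √(γ * T)) := add_le_add hX hYle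
    _ ≤ _ := by
        have h1 : 0 ≤ A₁ * (m * T * √(γ * T)) := by positivity
        have h2 : 0 ≤ A₂ * (m * T * √(1 / T)) := by positivity
        nlinarith

lemma integrable_sq_sub_sq_term {D : ℕ → ℕ → Ω → ℝ} {a : ℝ} {i t T : ℕ}
    (hV : IsCovariateProcess μ V K ρ) (hh : IsCorrection h β C) (hD : ∀ i t, Measurable (D i t))
    (ht : t < T) {w : ℝ → ℝ} (hw : ExpBdd w) (hwm : Measurable w) :
    Integrable (fun ω => w (V i t ω) ^ 2 *
      (defaultProb T V D h β a i t ω - defaultProb T V D h β a i t ω ^ 2)) μ := by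
  have hp := measurable_defaultProb (i := i) (β := β) hV hD hh.continuous a ht
  refine integrable_comp_mul (f := fun z => w z ^ 2) hV (hw.pow 2) (hwm.pow_const 2)
    (hp.sub (hp.pow_const 2)) fun ω => ?_
  have := defaultProb_mem hh.prob T V D β a i t ω
  rw [abs_le]
  constructor <;> nlinarith [this.1, this.2]

/-- Moments of the weighted sum of innovations. -/
lemma exists_martingale_moments (hV : IsCovariateProcess μ V K ρ) (hh : IsCorrection h β C)
    {w : ℝ → ℝ} (hw : ExpBdd w) (hwm : Measurable w) :
    ∃ A : ℝ, 0 ≤ A ∧ ∀ (D : ℕ → ℕ → Ω → ℝ) (m T : ℕ) (γ : ℝ), 0 < γ → γ ≤ 1 →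
      IsDefaultProcess μ V D h β (offset γ) m T →
      Integrable (fun ω => fullMartingale m T V D h β (offset γ) w ω ^ 4) μ ∧
      ∫ ω, fullMartingale m T V D h β (offset γ) w ω ^ 4 ∂μ ≤ A * (1 + γ * m * T) ^ 2 ∧
      ∫ ω, fullMartingale m T V D h β (offset γ) w ω ^ 2 ∂μ ≤ A * (γ * m * T) ∧
      |∫ ω, fullMartingale m T V D h β (offset γ) w ω ^ 2 ∂μ -
        γ * m * T * gaussExp (fun z => w z ^ 2 * Real.exp (β * z))| ≤
        A * (γ * m * T * (γ + √(γ * T))) := by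
  set a₄ : ℝ := gaussExp (fun z => w z ^ 4 * probBound β C z)
  set b₄ : ℝ := gaussExp (fun z => w z ^ 4 * probBound β C z ^ 2)
  set a₂ : ℝ := gaussExp (fun z => w z ^ 2 * probBound β C z)
  set b₂ : ℝ := gaussExp (fun z => w z ^ 2 * probBound β C z ^ 2)
  set c₂ : ℝ := gaussExp (fun z => w z ^ 2 * Real.exp (2 * β * z))
  set d₂ : ℝ := √(gaussExp (fun z => (w z ^ 2 * Real.exp (β * z)) ^ 2)) *
    √(gaussExp (probBound β C)) with hd₂
  have hpb := hh.probBound_nonneg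
  have ha₄ : 0 ≤ a₄ := gaussExp_nonneg fun z => mul_nonneg (by positivity) (hpb z)
  have hb₄ : 0 ≤ b₄ := gaussExp_nonneg fun z => by positivity
  have ha₂ : 0 ≤ a₂ := gaussExp_nonneg fun z => mul_nonneg (by positivity) (hpb z)
  have hb₂ : 0 ≤ b₂ := gaussExp_nonneg fun z => by positivity
  have hc₂ : 0 ≤ c₂ := gaussExp_nonneg fun z => by positivity
  have hd₂0 : 0 ≤ d₂ := by positivity
  have hC := hh.nonneg
  -- With `κ ≥ 1` one has `a₄ ≤ κ` and `b₄ ≤ κ²`, so `γ κ` meets both moment conditions of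
  -- `fullMartingale_moments`.
  set κ : ℝ := 1 + a₄ + b₄ with hκ
  have hκ1 : 1 ≤ κ := by linarith
  refine ⟨(8 * κ) ^ 2 + a₂ + b₂ + C * c₂ + d₂, by positivity, fun D m T γ hγ hγ1 hDp => ?_⟩
  have hw4 := hw.pow 4
  obtain ⟨hi4, he2, he4⟩ := fullMartingale_moments (κ := γ * κ) hV hDp hh.continuous hh.prob hwm hw
    (by positivity)
    (fun i hi t ht => (integral_comp_mul_defaultProb_sq_le hV hh hDp.measurable hγ hγ1 hw4
      (hwm.pow_const 4) (fun z => by positivity) ht).trans (by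
        rw [mul_pow]
        refine mul_le_mul_of_nonneg_left ?_ (by positivity)
        nlinarith))
    (fun i hi t ht => (integral_comp_mul_defaultProb_le hV hh hDp.measurable hγ hγ1 hw4
      (hwm.pow_const 4) (fun z => by positivity) ht).trans
      (mul_le_mul_of_nonneg_left (by linarith) hγ.le))
  have hs0 : 0 ≤ γ * m * T := by positivity
  have hterm := fun i t (ht : t < T) => integrable_sq_sub_sq_term (i := i) (a := offset γ) hV hh
    hDp.measurable ht hw hwm
  have hP := fun i t (ht : t < T) => measurable_defaultProb (i := i) (β := β) hV hDp.measurable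
    hh.continuous (offset γ) ht
  have hP2i := fun i t (ht : t < T) => integrable_comp_mul (i := i) (t := t)
    (f := fun z => w z ^ 2) hV (hw.pow 2) (hwm.pow_const 2) ((hP i t ht).pow_const 2) (fun ω => by
      rw [abs_pow]
      exact pow_le_one₀ (abs_nonneg _) (abs_defaultProb_le hh _ _ _ _))
  refine ⟨hi4, ?_, ?_, ?_⟩
  · refine he4.trans ?_
    have h1 : (1 + 8 * (γ * κ) * (T * m)) ^ 2 ≤ (8 * κ * (1 + γ * m * T)) ^ 2 := by
      refine pow_le_pow_left₀ (by positivity) ?_ 2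
      nlinarith
    rw [mul_pow] at h1
    refine h1.trans (mul_le_mul_of_nonneg_right ?_ (by positivity))
    have : 0 ≤ C * c₂ := by positivity
    linarith
  · rw [he2]
    refine (sum_sum_le_of_le (B := γ * a₂) fun i hi t ht => ?_).trans ?_
    · refine le_trans ?_ (integral_comp_mul_defaultProb_le (i := i) hV hh hDp.measurable hγ hγ1 (hw.pow 2)
        (hwm.pow_const 2) (fun z => by positivity) ht)
      refine integral_mono (hterm i t ht) (integrable_comp_mul (f := fun z => w z ^ 2) hV (hw.pow 2)
        (hwm.pow_const 2) (hP i t ht) (abs_defaultProb_le hh _ _ _)) fun ω => ?_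
      exact mul_le_mul_of_nonneg_left (sub_le_self _ (sq_nonneg _)) (sq_nonneg _)
    · have : 0 ≤ ((8 * κ) ^ 2 + b₂ + C * c₂ + d₂) * (γ * m * T) := by positivity
      nlinarith
  · rw [he2]
    have hsum : γ * m * T * gaussExp (fun z => w z ^ 2 * Real.exp (β * z)) =
        ∑ t ∈ Finset.range T, ∑ i ∈ Finset.range m,
          γ * gaussExp (fun z => w z ^ 2 * Real.exp (β * z)) := by
      simp only [Finset.sum_const, Finset.card_range, nsmul_eq_mul]
      ring
    rw [hsum]
    simp_rw [← Finset.sum_sub_distrib]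
    refine (abs_sum_sum_le fun i t => ∫ ω, w (V i t ω) ^ 2 * (defaultProb T V D h β (offset γ) i t ω
      - defaultProb T V D h β (offset γ) i t ω ^ 2) ∂μ -
      γ * gaussExp (fun z => w z ^ 2 * Real.exp (β * z))).trans ?_
    -- Three errors per firm and period: the squared probability in the Bernoulli variance, the
    -- correction `h` in the link, and the event that the firm has already defaulted.
    refine (sum_sum_le_of_le (B := γ ^ 2 * b₂ + C * γ ^ 2 * c₂ + γ * (d₂ * √(γ * T)))
      fun i hi t ht => ?_).trans ?_
    · have hwe : ExpBdd fun z => w z ^ 2 * Real.exp (β * z) := (hw.pow 2).mul (ExpBdd.exp β)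
      have hwem : Measurable fun z => w z ^ 2 * Real.exp (β * z) := by fun_prop
      have hwe2 : ExpBdd fun z => w z ^ 2 * Real.exp (2 * β * z) := (hw.pow 2).mul (ExpBdd.exp _)
      have hwem2 : Measurable fun z => w z ^ 2 * Real.exp (2 * β * z) := by fun_prop
      have hal := measurable_alive (i := i) hV hDp.measurable ht
      have hi3 := integrable_comp_mul (i := i) (t := t) (g := fun ω => 1 - alive T D i t ω) hV
        hwe.abs hwem.abs (measurable_const.sub hal) (fun ω => by
          rcases alive_mem T D i t ω with h | h <;> rw [h] <;> norm_num)
      have hi0 := hV.integrable_comp hwe hwem i t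
      have hi2 := (hV.integrable_comp hwe2 hwem2 i t).const_mul (C * γ ^ 2)
      rw [gaussExp, ← hV.integral_comp hwem i t, ← integral_const_mul,
        ← integral_sub (hterm i t ht) (hi0.const_mul γ)]
      refine (abs_integral_le_integral_abs).trans ?_
      have hdom : ∫ ω, (w (V i t ω) ^ 2 * defaultProb T V D h β (offset γ) i t ω ^ 2 +
          C * γ ^ 2 * (w (V i t ω) ^ 2 * Real.exp (2 * β * V i t ω)) +
          γ * (|w (V i t ω) ^ 2 * Real.exp (β * V i t ω)| * (1 - alive T D i t ω))) ∂μ ≤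
          γ ^ 2 * b₂ + C * γ ^ 2 * c₂ + γ * (d₂ * √(γ * T)) := by
        have hi12 : Integrable (fun ω => w (V i t ω) ^ 2 *
          defaultProb T V D h β (offset γ) i t ω ^ 2 +
          C * γ ^ 2 * (w (V i t ω) ^ 2 * Real.exp (2 * β * V i t ω))) μ := (hP2i i t ht).add hi2
        rw [integral_add hi12 (hi3.const_mul γ), integral_add (hP2i i t ht) hi2,
          integral_const_mul, integral_const_mul]
        refine add_le_add (add_le_add ?_ ?_) ?_
        · exact integral_comp_mul_defaultProb_sq_le hV hh hDp.measurable hγ hγ1 (hw.pow 2)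
            (hwm.pow_const 2) (fun z => by positivity) ht
        · rw [hV.integral_comp hwem2 i t]
          exact le_rfl
        · refine mul_le_mul_of_nonneg_left ?_ hγ.le
          refine (integral_abs_comp_mul_dead_le hV hh hγ hγ1 hDp hi ht hwe hwem).trans (le_of_eq ?_)
          rw [Real.sqrt_mul (by positivity) (gaussExp _), hd₂]
          ring
      refine le_trans (integral_mono_of_nonneg (ae_of_all _ fun ω => abs_nonneg _)
        (((hP2i i t ht).add hi2).add (hi3.const_mul γ)) (ae_of_all _ fun ω => ?_)) hdom
      have h1 := abs_le.1 (abs_defaultProb_sub_le (T := T) (V := V) (D := D) (i := i) (t := t) hh hγ ω)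
      simp only [Pi.add_apply]
      set p := defaultProb T V D h β (offset γ) i t ω
      set e := Real.exp (β * V i t ω) with he
      set e' := Real.exp (2 * β * V i t ω)
      set l := alive T D i t ω
      set W := w (V i t ω) ^ 2
      have hW : 0 ≤ W := sq_nonneg _
      have he0 : 0 < e := Real.exp_pos _
      have hl : l ≤ 1 := alive_le_one _ _ _ _ _
      rw [abs_of_nonneg (mul_nonneg hW he0.le), abs_le]
      have h2 := mul_le_mul_of_nonneg_left h1.1 hW
      have h3 := mul_le_mul_of_nonneg_left h1.2 hW
      have h4 : 0 ≤ γ * (W * e * (1 - l)) := by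
        have := sub_nonneg.2 hl
        positivity
      have h5 : 0 ≤ W * p ^ 2 := by positivity
      constructor <;> nlinarith
    · have h1 : 0 ≤ √(γ * T) := Real.sqrt_nonneg _
      have h2 : 0 ≤ γ * m * T * γ := by positivity
      have h3 : 0 ≤ γ * m * T * √(γ * T) := by positivity
      have h4 : 0 ≤ C * c₂ := by positivity
      have h5 : 0 ≤ ((8 * κ) ^ 2 + a₂ + d₂) * (γ * m * T * γ) := by positivity
      have h6 : 0 ≤ ((8 * κ) ^ 2 + a₂ + b₂ + C * c₂) * (γ * m * T * √(γ * T)) := by positivity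
      nlinarith

lemma sum_sum_sq_le {m T : ℕ} (f : ℕ → ℕ → ℝ) :
    (∑ t ∈ Finset.range T, ∑ i ∈ Finset.range m, f i t) ^ 2 ≤
      m * T * ∑ t ∈ Finset.range T, ∑ i ∈ Finset.range m, f i t ^ 2 := by
  have h := sq_sum_le_card_mul_sum_sq (s := Finset.range T ×ˢ Finset.range m)
    (f := fun k => f k.2 k.1)
  rw [Finset.sum_product, Finset.sum_product, Finset.card_product, Finset.card_range,
    Finset.card_range] at h
  push_cast at h
  linarith

/-- The error made in replacing the default probabilities by their leading order. -/
lemma exists_remainder_sq_le (hV : IsCovariateProcess μ V K ρ) (hh : IsCorrection h β C)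
    {f : ℝ → ℝ} (hf : ExpBdd f) (hfm : Measurable f) :
    ∃ A : ℝ, 0 ≤ A ∧ ∀ (D : ℕ → ℕ → Ω → ℝ) (m T : ℕ) (γ : ℝ), 0 < γ → γ ≤ 1 →
      IsDefaultProcess μ V D h β (offset γ) m T →
      Integrable (fun ω => (∑ t ∈ Finset.range T, ∑ i ∈ Finset.range m, f (V i t ω) *
        (defaultProb T V D h β (offset γ) i t ω -
          alive T D i t ω * (γ * Real.exp (β * V i t ω)))) ^ 2) μ ∧
      ∫ ω, (∑ t ∈ Finset.range T, ∑ i ∈ Finset.range m, f (V i t ω) *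
        (defaultProb T V D h β (offset γ) i t ω -
          alive T D i t ω * (γ * Real.exp (β * V i t ω)))) ^ 2 ∂μ ≤
      A * (γ * (γ * m * T)) ^ 2 := by
  have hF : ExpBdd fun z => (f z * Real.exp (2 * β * z)) ^ 2 := (hf.mul (ExpBdd.exp _)).pow 2
  have hFm : Measurable fun z => (f z * Real.exp (2 * β * z)) ^ 2 := by fun_prop
  have hA : 0 ≤ gaussExp fun z => (f z * Real.exp (2 * β * z)) ^ 2 :=
    gaussExp_nonneg fun z => by positivity
  refine ⟨C ^ 2 * gaussExp fun z => (f z * Real.exp (2 * β * z)) ^ 2, by positivity,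
    fun D m T γ hγ hγ1 hDp => ?_⟩
  -- No cancellation is needed: each summand is at most of order `γ²`, and Cauchy–Schwarz over the
  -- `m T` summands suffices.
  have hdom : ∀ ω, (∑ t ∈ Finset.range T, ∑ i ∈ Finset.range m, f (V i t ω) *
        (defaultProb T V D h β (offset γ) i t ω -
          alive T D i t ω * (γ * Real.exp (β * V i t ω)))) ^ 2 ≤
      m * T * ∑ t ∈ Finset.range T, ∑ i ∈ Finset.range m,
        C ^ 2 * γ ^ 4 * (f (V i t ω) * Real.exp (2 * β * V i t ω)) ^ 2 := by
    intro ω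
    refine (sum_sum_sq_le fun i t => f (V i t ω) * (defaultProb T V D h β (offset γ) i t ω -
          alive T D i t ω * (γ * Real.exp (β * V i t ω)))).trans ?_
    refine mul_le_mul_of_nonneg_left (Finset.sum_le_sum fun t _ => Finset.sum_le_sum fun i _ => ?_)
      (by positivity)
    have h1 := pow_le_pow_left₀ (abs_nonneg _) (abs_defaultProb_sub_le (T := T) (V := V) (D := D)
      (i := i) (t := t) hh hγ ω) 2
    rw [sq_abs] at h1
    rw [mul_pow]
    refine (mul_le_mul_of_nonneg_left h1 (sq_nonneg _)).trans (le_of_eq ?_)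
    ring
  have hint : Integrable (fun ω => (m * T : ℝ) * ∑ t ∈ Finset.range T, ∑ i ∈ Finset.range m,
        C ^ 2 * γ ^ 4 * (f (V i t ω) * Real.exp (2 * β * V i t ω)) ^ 2) μ :=
    (integrable_sum_sum fun i _ t _ => (hV.integrable_comp hF hFm i t).const_mul _).const_mul _
  have hmeas : Measurable (fun ω => (∑ t ∈ Finset.range T, ∑ i ∈ Finset.range m, f (V i t ω) *
        (defaultProb T V D h β (offset γ) i t ω -
          alive T D i t ω * (γ * Real.exp (β * V i t ω)))) ^ 2) := by
    refine (Finset.measurable_fun_sum _ fun t ht => Finset.measurable_fun_sum _ fun i _ => ?_).pow_const 2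
    have h1 := measurable_defaultProb (i := i) (β := β) hV hDp.measurable hh.continuous (offset γ)
      (Finset.mem_range.1 ht)
    have h2 := measurable_alive (i := i) hV hDp.measurable (Finset.mem_range.1 ht)
    have h3 := hV.measurable i t
    fun_prop
  refine ⟨hint.mono' hmeas.aestronglyMeasurable (ae_of_all _ fun ω => ?_), ?_⟩
  · rw [Real.norm_of_nonneg (sq_nonneg _)]
    exact hdom ω
  refine (integral_mono_of_nonneg (ae_of_all _ fun ω => sq_nonneg _) hint (ae_of_all _ hdom)).trans
    (le_of_eq ?_)
  rw [integral_const_mul, integral_sum_sum fun i _ t _ =>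
    (hV.integrable_comp hF hFm i t).const_mul _]
  simp_rw [integral_const_mul, hV.integral_comp hFm]
  simp only [Finset.sum_const, Finset.card_range, nsmul_eq_mul]
  rw [← gaussExp]
  ring

/-- Law of large numbers for the covariates of the defaulting firms. -/
lemma exists_lln_default (hV : IsCovariateProcess μ V K ρ) (hρ : ρ ∈ Set.Ioo (0 : ℝ) 1)
    (hh : IsCorrection h β C) {g : ℝ → ℝ} (hg : SmoothExp g) :
    ∃ A : ℝ, 0 ≤ A ∧ ∀ (D : ℕ → ℕ → Ω → ℝ) (m T : ℕ) (γ : ℝ), 0 < γ → γ ≤ 1 →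
      IsDefaultProcess μ V D h β (offset γ) m T →
      ∫ ω, |∑ t ∈ Finset.range T, ∑ i ∈ Finset.range m,
        (g (V i t ω) * D i (t + 1) ω - γ * gaussExp (fun z => g z * Real.exp (β * z)))| ∂μ ≤
      A * (√(γ * m * T) + γ * m * T * (γ + (√(1 / T) + √(γ * T)))) := by
  obtain ⟨A₁, hA₁, hM⟩ := exists_martingale_moments hV hh hg.bdd hg.measurable
  obtain ⟨A₂, hA₂, hR⟩ := exists_remainder_sq_le hV hh hg.bdd hg.measurable
  obtain ⟨A₃, hA₃, hL⟩ := exists_lln_alive hV hρ hh (hg.mul (SmoothExp.exp β))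
  refine ⟨√A₁ + √A₂ + A₃, by positivity, fun D m T γ hγ hγ1 hDp => ?_⟩
  obtain ⟨hM4, -, hM2, -⟩ := hM D m T γ hγ hγ1 hDp
  obtain ⟨hRi, hR2⟩ := hR D m T γ hγ hγ1 hDp
  have hL1 := hL D m T γ hγ hγ1 hDp
  have hgm := hg.measurable
  have hPm := fun i t (ht : t < T) => measurable_defaultProb (i := i) (β := β) hV hDp.measurable
    hh.continuous (offset γ) ht
  have hal := fun i t (ht : t < T) => measurable_alive (i := i) hV hDp.measurable ht
  set M := fullMartingale m T V D h β (offset γ) g with hMdef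
  set R : Ω → ℝ := fun ω => ∑ t ∈ Finset.range T, ∑ i ∈ Finset.range m, g (V i t ω) *
        (defaultProb T V D h β (offset γ) i t ω -
          alive T D i t ω * (γ * Real.exp (β * V i t ω))) with hRdef
  set L : Ω → ℝ := fun ω => ∑ t ∈ Finset.range T, ∑ i ∈ Finset.range m,
    (g (V i t ω) * Real.exp (β * V i t ω) * alive T D i t ω -
      gaussExp (fun z => g z * Real.exp (β * z))) with hLdef
  have hMm : Measurable M := by
    refine Finset.measurable_fun_sum _ fun t ht => Finset.measurable_fun_sum _ fun i _ => ?_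
    have h1 := hPm i t (Finset.mem_range.1 ht)
    have h2 := hV.measurable i t
    have h3 := hDp.measurable i (t + 1)
    unfold innovation
    fun_prop
  have hRm : Measurable R := by
    refine Finset.measurable_fun_sum _ fun t ht => Finset.measurable_fun_sum _ fun i _ => ?_
    have h1 := hPm i t (Finset.mem_range.1 ht)
    have h2 := hal i t (Finset.mem_range.1 ht)
    have h3 := hV.measurable i t
    fun_prop
  have hMi2 : Integrable (fun ω => M ω ^ 2) μ := BernoulliStep.integrable_sq hMm hM4
  have hMi : Integrable (fun ω => |M ω|) μ :=
    ((memLp_two_iff_integrable_sq hMm.aestronglyMeasurable).2 hMi2).integrable (by norm_num) |>.abs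
  have hRi1 : Integrable (fun ω => |R ω|) μ :=
    ((memLp_two_iff_integrable_sq hRm.aestronglyMeasurable).2 hRi).integrable (by norm_num) |>.abs
  have hge := hg.mul (SmoothExp.exp β)
  have hLi : Integrable (fun ω => |L ω|) μ := by
    refine (integrable_sum_sum fun i _ t ht => ?_).abs
    exact (integrable_comp_mul hV hge.bdd hge.measurable (hal i t ht) (abs_alive_le _ _ _ _)).sub
      (integrable_const _)
  have hs0 : 0 ≤ γ * m * T := by positivity
  have e1 : ∫ ω, |M ω| ∂μ ≤ √A₁ * √(γ * m * T) := by
    rw [← Real.sqrt_mul hA₁]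
    exact (integral_abs_le_sqrt hMm.aestronglyMeasurable hMi2).trans (Real.sqrt_le_sqrt hM2)
  have e2 : ∫ ω, |R ω| ∂μ ≤ √A₂ * (γ * (γ * m * T)) := by
    rw [← Real.sqrt_sq (show 0 ≤ γ * (γ * m * T) by positivity), ← Real.sqrt_mul hA₂]
    exact (integral_abs_le_sqrt hRm.aestronglyMeasurable hRi).trans (Real.sqrt_le_sqrt hR2)
  calc ∫ ω, |∑ t ∈ Finset.range T, ∑ i ∈ Finset.range m,
        (g (V i t ω) * D i (t + 1) ω - γ * gaussExp (fun z => g z * Real.exp (β * z)))| ∂μ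
      ≤ ∫ ω, ((|M ω| + |R ω|) + γ * |L ω|) ∂μ := by
        refine integral_mono_of_nonneg (ae_of_all _ fun ω => abs_nonneg _)
          ((hMi.add hRi1).add (hLi.const_mul γ)) (ae_of_all _ fun ω => ?_)
        -- The three parts are the innovations, the link correction, and `γ` times the centred sum
        -- over survivors of the tilted function.
        have h1 : ∑ t ∈ Finset.range T, ∑ i ∈ Finset.range m,
            (g (V i t ω) * D i (t + 1) ω - γ * gaussExp (fun z => g z * Real.exp (β * z))) =
            M ω + R ω + γ * L ω := by
          simp only [hMdef, hRdef, hLdef, fullMartingale, innovation, Finset.mul_sum,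
            ← Finset.sum_add_distrib]
          exact Finset.sum_congr rfl fun t _ => Finset.sum_congr rfl fun i _ => by ring
        simp only
        rw [h1]
        refine (abs_add_le _ _).trans (add_le_add (abs_add_le _ _) ?_)
        rw [abs_mul, abs_of_pos hγ]
    _ = ∫ ω, |M ω| ∂μ + ∫ ω, |R ω| ∂μ + γ * ∫ ω, |L ω| ∂μ := by
        have hMR : Integrable (fun ω => |M ω| + |R ω|) μ := hMi.add hRi1
        rw [integral_add hMR (hLi.const_mul γ), integral_add hMi hRi1, integral_const_mul]
    _ ≤ √A₁ * √(γ * m * T) + √A₂ * (γ * (γ * m * T)) +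
          γ * (A₃ * (m * T * (√(1 / T) + √(γ * T)))) :=
        add_le_add (add_le_add e1 e2) (mul_le_mul_of_nonneg_left hL1 hγ.le)
    _ ≤ _ := by
        have h1 : 0 ≤ √A₁ * (γ * m * T * (γ + (√(1 / T) + √(γ * T)))) := by positivity
        have h2 : 0 ≤ √A₂ * (√(γ * m * T) + γ * m * T * (√(1 / T) + √(γ * T))) := by positivity
        have h3 : 0 ≤ A₃ * (√(γ * m * T) + γ * m * T * γ) := by positivity
        linarith

end LawOfLargeNumbers

/-! ### Gaussian integrals under exponential tilting. -/

/-- Exponential tilting of the standard normal distribution is a shift. -/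
lemma gaussExp_mul_exp (f : ℝ → ℝ) (b : ℝ) :
    gaussExp (fun z => f z * Real.exp (b * z)) =
      Real.exp (b ^ 2 / 2) * gaussExp (fun z => f (z + b)) := by
  unfold gaussExp
  rw [integral_gaussianReal_eq_integral_smul one_ne_zero,
    integral_gaussianReal_eq_integral_smul one_ne_zero, ← integral_const_mul,
    ← integral_add_right_eq_self _ b]
  refine integral_congr_ae (ae_of_all _ fun z => ?_)
  simp only [gaussianPDFReal, smul_eq_mul, NNReal.coe_one, mul_one, sub_zero]
  have : Real.exp (-(z + b) ^ 2 / 2) * Real.exp (b * (z + b)) =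
      Real.exp (b ^ 2 / 2) * Real.exp (-z ^ 2 / 2) := by
    rw [← Real.exp_add, ← Real.exp_add]
    congr 1
    ring
  linear_combination (√(2 * Real.pi))⁻¹ * f (z + b) * this

lemma gaussExp_one : gaussExp (fun _ => 1) = 1 := by simp [gaussExp]

lemma gaussExp_id : gaussExp (fun z => z) = 0 := by simp [gaussExp]

lemma gaussExp_sq : gaussExp (fun z => z ^ 2) = 1 := by
  have h3 := variance_of_integral_eq_zero (μ := gaussianReal 0 1) (X := fun x => x)
    (by fun_prop) (by simp)
  rw [variance_fun_id_gaussianReal] at h3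
  simpa [gaussExp] using h3.symm

lemma gaussExp_exp (b : ℝ) : gaussExp (fun z => Real.exp (b * z)) = Real.exp (b ^ 2 / 2) := by
  have := gaussExp_mul_exp (fun _ => 1) b
  simpa [gaussExp_one] using this

/-- The tilted law has mean `b`. This makes the proposed estimator consistent and its compensator
centred to leading order. -/
lemma gaussExp_sub_mul_exp (b : ℝ) : gaussExp (fun z => (z - b) * Real.exp (b * z)) = 0 := by
  have := gaussExp_mul_exp (fun z => z - b) b
  simpa [gaussExp_id] using this

/-- The tilted law keeps variance one. This gives the limiting variance of the numerator of the
proposed estimator's error. -/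
lemma gaussExp_sub_sq_mul_exp (b : ℝ) :
    gaussExp (fun z => (z - b) ^ 2 * Real.exp (b * z)) = Real.exp (b ^ 2 / 2) := by
  have := gaussExp_mul_exp (fun z => (z - b) ^ 2) b
  simpa [gaussExp_sq] using this

/-- The second moment `1 + b²` of the shifted normal; at `b = β` this is the limiting information of
the likelihood. -/
lemma gaussExp_sq_mul_exp (b : ℝ) :
    gaussExp (fun z => z ^ 2 * Real.exp (b * z)) = (1 + b ^ 2) * Real.exp (b ^ 2 / 2) := by
  rw [gaussExp_mul_exp (fun z => z ^ 2) b, mul_comm]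
  congr 1
  have h1 : ∀ z : ℝ, (z + b) ^ 2 = z ^ 2 + (2 * b * z + b ^ 2) := fun z => by ring
  have i2 : Integrable (fun z : ℝ => z ^ 2) (gaussianReal 0 1) :=
    (ExpBdd.id.pow 2).integrable (by fun_prop)
  have i1 : Integrable (fun z : ℝ => 2 * b * z) (gaussianReal 0 1) :=
    (ExpBdd.id.integrable (by fun_prop)).const_mul _
  have i3 : Integrable (fun z : ℝ => 2 * b * z + b ^ 2) (gaussianReal 0 1) :=
    i1.add (integrable_const _)
  have h2 := gaussExp_sq
  have h3 := gaussExp_id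
  unfold gaussExp at *
  simp_rw [h1]
  rw [integral_add i2 i3, integral_add i1 (integrable_const _), integral_const_mul, h2, h3]
  simp

/-! ### Mean square of the compensator. -/

section Compensator

variable {Ω : Type*} {V : ℕ → ℕ → Ω → ℝ} {h : ℝ → ℝ} {β C K ρ : ℝ}
  [m0 : MeasurableSpace Ω] {μ : Measure Ω} [IsProbabilityMeasure μ]

/-- Above the level `B` one has `x ≤ x (x / B) ^ (p - 1)`. High powers allow a maximum over time to
be replaced by a sum over time with little loss. -/
lemma le_add_pow_div {x B : ℝ} (hx : 0 ≤ x) (hB : 0 < B) {p : ℕ} (hp : 1 ≤ p) :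
    x ≤ B + x ^ p / B ^ (p - 1) := by
  rcases le_total x B with h | h
  · have : 0 ≤ x ^ p / B ^ (p - 1) := by positivity
    linarith
  · have h1 : x ≤ x ^ p / B ^ (p - 1) := by
      rw [le_div_iff₀ (by positivity)]
      obtain ⟨n, rfl⟩ : ∃ n, p = n + 1 := ⟨p - 1, by omega⟩
      rw [Nat.add_sub_cancel, pow_succ, mul_comm]
      exact mul_le_mul_of_nonneg_right (pow_le_pow_left₀ hB.le h n) hx
    linarith

/-- The covariates of a firm after its default sum to a difference of two partial sums. -/
lemma sum_mul_dead_sq_le (D : ℕ → ℕ → Ω → ℝ) (T i : ℕ) (hT : 1 ≤ T) (f : ℕ → ℝ) {B : ℝ}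
    (hB : 0 < B) {p : ℕ} (hp : 1 ≤ p) (ω : Ω) :
    (∑ t ∈ Finset.range T, f t * (1 - alive T D i t ω)) ^ 2 ≤
      4 * (B * (1 - alive T D i (T - 1) ω) +
        (∑ n ∈ Finset.range (T + 1), (∑ s ∈ Finset.range n, f s) ^ (2 * p)) / B ^ (p - 1)) := by
  set τ := exitTime T D i ω with hτ
  have hτT : τ ≤ T - 1 := Nat.sInf_le (Or.inr rfl)
  have hal : ∀ t, alive T D i t ω = if t ≤ τ then 1 else 0 := fun t => rfl
  have hS0 : 0 ≤ ∑ n ∈ Finset.range (T + 1), (∑ s ∈ Finset.range n, f s) ^ (2 * p) :=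
    Finset.sum_nonneg fun n _ => (even_two_mul p).pow_nonneg _
  have hB' : 0 < B ^ (p - 1) := by positivity
  -- If `τ = T - 1` the firm is alive in all periods and the sum vanishes. Otherwise the sum over
  -- its dead periods is the full partial sum minus the one up to `τ + 1`.
  rcases hτT.eq_or_lt with he | hlt
  · have h0 : ∑ t ∈ Finset.range T, f t * (1 - alive T D i t ω) = 0 := by
      refine Finset.sum_eq_zero fun t ht => ?_
      have := Finset.mem_range.1 ht
      rw [hal, if_pos (by omega), sub_self, mul_zero]
    rw [h0, hal, if_pos he.ge, sub_self, mul_zero, zero_add, zero_pow two_ne_zero]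
    exact mul_nonneg zero_le_four (div_nonneg hS0 hB'.le)
  · rw [hal, if_neg (by omega), sub_zero, mul_one]
    have hdiff : ∑ t ∈ Finset.range T, f t * (1 - alive T D i t ω) =
        ∑ s ∈ Finset.range T, f s - ∑ s ∈ Finset.range (τ + 1), f s := by
      rw [← Finset.sum_range_add_sum_Ico _ (show τ + 1 ≤ T by omega),
        ← Finset.sum_range_add_sum_Ico f (show τ + 1 ≤ T by omega), add_sub_cancel_left]
      rw [Finset.sum_eq_zero, zero_add]
      · refine Finset.sum_congr rfl fun t ht => ?_
        have := Finset.mem_Ico.1 ht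
        rw [hal, if_neg (by omega), sub_zero, mul_one]
      · intro t ht
        have := Finset.mem_range.1 ht
        rw [hal, if_pos (by omega), sub_self, mul_zero]
    -- The index `τ + 1` is random and depends on the covariates, so the bound must hold for all `n`
    -- at once.
    have hG : ∀ n ≤ T, (∑ s ∈ Finset.range n, f s) ^ 2 ≤
        B + (∑ n ∈ Finset.range (T + 1), (∑ s ∈ Finset.range n, f s) ^ (2 * p)) / B ^ (p - 1) := by
      intro n hn
      refine (le_add_pow_div (sq_nonneg _) hB hp).trans ?_
      refine (add_le_add_iff_left _).2 (div_le_div_of_nonneg_right ?_ hB'.le)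
      rw [← pow_mul]
      exact Finset.single_le_sum
        (f := fun n => (∑ s ∈ Finset.range n, f s) ^ (2 * p))
        (fun n _ => (even_two_mul p).pow_nonneg _) (Finset.mem_range.2 (by omega))
    rw [hdiff]
    have h1 := hG T le_rfl
    have h2 := hG (τ + 1) (by omega)
    nlinarith [sq_nonneg (∑ s ∈ Finset.range T, f s + ∑ s ∈ Finset.range (τ + 1), f s)]

lemma integrable_partial_sum_pow (hV : IsCovariateProcess μ V K ρ) {f : ℝ → ℝ} (hf : SmoothExp f)
    (i n p : ℕ) : Integrable (fun ω => (∑ s ∈ Finset.range n, f (V i s ω)) ^ (2 * p)) μ := by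
  have h1 : MemLp (fun ω => ∑ s ∈ Finset.range n, f (V i s ω)) ((2 * p : ℕ) : ENNReal) μ := by
    refine memLp_finsetSum _ fun s _ => ?_
    have h := hf.bdd.memLp hf.measurable (2 * p)
    rw [← (hV.marginal i s).map_eq] at h
    exact h.comp_of_map (hV.measurable i s).aemeasurable
  refine h1.integrable_norm_pow'.congr (ae_of_all _ fun ω => ?_)
  simp [pow_mul]

/-- Second moment of the contribution of the defaulted firms to a centred sum. -/
lemma exists_dead_sum_sq_le (hV : IsCovariateProcess μ V K ρ) (hρ : ρ ∈ Set.Ioo (0 : ℝ) 1)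
    (hh : IsCorrection h β C) {f : ℝ → ℝ} (hf : SmoothExp f) (hf0 : gaussExp f = 0) {p : ℕ}
    (hp : 1 ≤ p) :
    ∃ A : ℝ, 0 ≤ A ∧ ∀ (D : ℕ → ℕ → Ω → ℝ) (m T : ℕ) (γ Λ : ℝ), 0 < γ → γ ≤ 1 → 1 ≤ T → 0 < Λ →
      IsDefaultProcess μ V D h β (offset γ) m T →
      Integrable (fun ω => (∑ t ∈ Finset.range T, ∑ i ∈ Finset.range m,
        f (V i t ω) * (1 - alive T D i t ω)) ^ 2) μ ∧
      ∫ ω, (∑ t ∈ Finset.range T, ∑ i ∈ Finset.range m,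
        f (V i t ω) * (1 - alive T D i t ω)) ^ 2 ∂μ ≤
      A * ((m * T : ℝ) ^ 2 * (Λ * γ + 1 / Λ ^ (p - 1))) := by
  set q := gaussExp (probBound β C)
  have hq : 0 ≤ q := gaussExp_nonneg hh.probBound_nonneg
  set c := momentConst f p * (2 * K / (1 - ρ)) ^ p with hc
  have hc0 : 0 ≤ c := by
    have h1 := momentConst_nonneg f p
    have h2 := hV.one_le
    have h3 : 0 < 1 - ρ := sub_pos.2 hρ.2
    positivity
  refine ⟨4 * (q + 2 * c), by positivity, fun D m T γ Λ hγ hγ1 hT hΛ hDp => ?_⟩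
  have hT0 : (1 : ℝ) ≤ T := by exact_mod_cast hT
  -- The level is `B = Λ T`: squared partial sums are of order `T`, and exceeding `Λ T` costs
  -- `Λ^{-(p-1)}` in the moment bound. Below this level only the firms that default early count,
  -- with probability of order `γ T`.
  have hB : 0 < Λ * T := by positivity
  have hlt : T - 1 < T := by omega
  have hal := fun i t (ht : t < T) => measurable_alive (i := i) hV hDp.measurable ht
  have hali : ∀ i, Integrable (fun ω => 1 - alive T D i (T - 1) ω) μ := fun i =>
    (integrable_const 1).sub ((integrable_const (1 : ℝ)).mono' (hal i _ hlt).aestronglyMeasurable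
      (ae_of_all _ fun ω => abs_alive_le _ _ _ _ _))
  set F : ℕ → Ω → ℝ := fun i ω => 4 * (Λ * T * (1 - alive T D i (T - 1) ω) +
        (∑ n ∈ Finset.range (T + 1), (∑ s ∈ Finset.range n, f (V i s ω)) ^ (2 * p)) /
          (Λ * T) ^ (p - 1)) with hF
  have hpow := fun i n => integrable_partial_sum_pow hV hf i n p
  have hFi : ∀ i, Integrable (F i) μ := fun i =>
    (((hali i).const_mul _).add ((integrable_finsetSum _ fun n _ => hpow i n).div_const _)).const_mul 4
  have hFle : ∀ i < m, ∫ ω, F i ω ∂μ ≤ 4 * (q + 2 * c) * ((T : ℝ) ^ 2 * (Λ * γ + 1 / Λ ^ (p - 1))) := by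
    intro i hi
    have e1 := integral_dead_le hV hh hγ hγ1 hDp hi hlt
    have e2 : ∀ n ∈ Finset.range (T + 1), ∫ ω, (∑ s ∈ Finset.range n, f (V i s ω)) ^ (2 * p) ∂μ ≤
        c * (T : ℝ) ^ p := by
      intro n hn
      have hn' : (n : ℝ) ≤ T := by exact_mod_cast Nat.lt_succ_iff.1 (Finset.mem_range.1 hn)
      have h1 := hV.integral_sum_rect_le hρ hf.contDiff hf.bdd hf.bdd_deriv p hp {i} n
      have h2 : ∫ z, f z ∂(gaussianReal 0 1) = 0 := hf0
      simp only [Finset.sum_singleton, h2, sub_zero, Finset.card_singleton, Nat.cast_one, one_pow,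
        one_mul] at h1
      exact h1.trans (mul_le_mul_of_nonneg_left (pow_le_pow_left₀ (by positivity) hn' p) hc0)
    have e3 : ∫ ω, ∑ n ∈ Finset.range (T + 1), (∑ s ∈ Finset.range n, f (V i s ω)) ^ (2 * p) ∂μ ≤
        (T + 1) * (c * (T : ℝ) ^ p) := by
      rw [integral_finsetSum _ fun n _ => hpow i n]
      refine (Finset.sum_le_sum e2).trans (le_of_eq ?_)
      rw [Finset.sum_const, Finset.card_range, nsmul_eq_mul]
      push_cast
      ring
    rw [hF]
    simp only
    rw [integral_const_mul, integral_add ((hali i).const_mul _)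
      ((integrable_finsetSum _ fun n _ => hpow i n).div_const _), integral_const_mul,
      integral_div]
    -- The factor 2 comes from `T + 1 ≤ 2 T`.
    have e4 : (T + 1) * (c * (T : ℝ) ^ p) / (Λ * T) ^ (p - 1) ≤ 2 * c * (T ^ 2 * (1 / Λ ^ (p - 1))) := by
      obtain ⟨n, rfl⟩ : ∃ n, p = n + 1 := ⟨p - 1, by omega⟩
      rw [Nat.add_sub_cancel, div_le_iff₀ (by positivity), mul_pow]
      have : 2 * c * ((T : ℝ) ^ 2 * (1 / Λ ^ n)) * (Λ ^ n * T ^ n) = 2 * T * (c * T ^ (n + 1)) := by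
        field_simp
        ring
      rw [this]
      exact mul_le_mul_of_nonneg_right (by linarith) (by positivity)
    have e5 : Λ * T * ∫ ω, (1 - alive T D i (T - 1) ω) ∂μ ≤ Λ * T * (γ * T * q) :=
      mul_le_mul_of_nonneg_left e1 (by positivity)
    have e6 : (∫ ω, ∑ n ∈ Finset.range (T + 1), (∑ s ∈ Finset.range n, f (V i s ω)) ^ (2 * p) ∂μ) /
        (Λ * T) ^ (p - 1) ≤ 2 * c * (T ^ 2 * (1 / Λ ^ (p - 1))) :=
      (div_le_div_of_nonneg_right e3 (by positivity)).trans e4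
    have e7 : 0 ≤ q * ((T : ℝ) ^ 2 * (1 / Λ ^ (p - 1))) := by positivity
    have e8 : 0 ≤ c * ((T : ℝ) ^ 2 * (Λ * γ)) := by positivity
    nlinarith
  have hdom : ∀ ω, (∑ t ∈ Finset.range T, ∑ i ∈ Finset.range m,
        f (V i t ω) * (1 - alive T D i t ω)) ^ 2 ≤ m * ∑ i ∈ Finset.range m, F i ω := by
    intro ω
    rw [Finset.sum_comm]
    have h1 := sq_sum_le_card_mul_sum_sq (s := Finset.range m)
      (f := fun i => ∑ t ∈ Finset.range T, f (V i t ω) * (1 - alive T D i t ω))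
    rw [Finset.card_range] at h1
    refine h1.trans (mul_le_mul_of_nonneg_left (Finset.sum_le_sum fun i _ => ?_) (by positivity))
    exact sum_mul_dead_sq_le D T i hT (fun t => f (V i t ω)) hB hp ω
  have hint : Integrable (fun ω => (m : ℝ) * ∑ i ∈ Finset.range m, F i ω) μ :=
    (integrable_finsetSum _ fun i _ => hFi i).const_mul _
  have hfm := hf.measurable
  have hmeas : Measurable (fun ω => (∑ t ∈ Finset.range T, ∑ i ∈ Finset.range m,
        f (V i t ω) * (1 - alive T D i t ω)) ^ 2) := by
    refine (Finset.measurable_fun_sum _ fun t ht => Finset.measurable_fun_sum _ fun i _ => ?_).pow_const 2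
    have h2 := hal i t (Finset.mem_range.1 ht)
    have h3 := hV.measurable i t
    fun_prop
  refine ⟨hint.mono' hmeas.aestronglyMeasurable (ae_of_all _ fun ω => ?_), ?_⟩
  · rw [Real.norm_of_nonneg (sq_nonneg _)]
    exact hdom ω
  refine (integral_mono_of_nonneg (ae_of_all _ fun ω => sq_nonneg _) hint (ae_of_all _ hdom)).trans ?_
  rw [integral_const_mul, integral_finsetSum _ fun i _ => hFi i]
  refine (mul_le_mul_of_nonneg_left (Finset.sum_le_sum fun i hi =>
    hFle i (Finset.mem_range.1 hi)) (by positivity)).trans (le_of_eq ?_)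
  rw [Finset.sum_const, Finset.card_range, nsmul_eq_mul]
  ring

/-- The compensator of the numerator of the error of the proposed estimator. -/
noncomputable def compensator {Ω : Type*} (m T : ℕ) (V D : ℕ → ℕ → Ω → ℝ) (h : ℝ → ℝ) (β a : ℝ)
    (ω : Ω) : ℝ :=
  ∑ t ∈ Finset.range T, ∑ i ∈ Finset.range m, (V i t ω - β) * defaultProb T V D h β a i t ω

/-- The compensator is a link remainder, plus `γ` times the sum of `f = (v - β) e^{βv}` over all
firms and periods, minus `γ` times the part after defaults. As `f` is centred, the full sum has mean
square of order `m² T`, and partial sums of a single firm grow like a square root of time. The three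
parts give the three terms of the bound. -/
lemma exists_compensator_sq_le (hV : IsCovariateProcess μ V K ρ) (hρ : ρ ∈ Set.Ioo (0 : ℝ) 1)
    (hh : IsCorrection h β C) {p : ℕ} (hp : 1 ≤ p) :
    ∃ A : ℝ, 0 ≤ A ∧ ∀ (D : ℕ → ℕ → Ω → ℝ) (m T : ℕ) (γ Λ : ℝ), 0 < γ → γ ≤ 1 → 1 ≤ T → 0 < Λ →
      IsDefaultProcess μ V D h β (offset γ) m T →
      Integrable (fun ω => compensator m T V D h β (offset γ) ω ^ 2) μ ∧
      ∫ ω, compensator m T V D h β (offset γ) ω ^ 2 ∂μ ≤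
      A * (γ * m * T) * (γ * (γ * (γ * m * T)) + γ * m +
        (γ * m * T) * (Λ * γ + 1 / Λ ^ (p - 1))) := by
  have hsub : SmoothExp (fun v => v - β) := SmoothExp.id.sub_const β
  have hf : SmoothExp (fun v => (v - β) * Real.exp (β * v)) := hsub.mul (SmoothExp.exp β)
  set f : ℝ → ℝ := fun v => (v - β) * Real.exp (β * v) with hfdef
  have hf0 : gaussExp f = 0 := gaussExp_sub_mul_exp β
  obtain ⟨A₁, hA₁, h1⟩ := exists_remainder_sq_le hV hh hsub.bdd hsub.measurable
  obtain ⟨A₂, hA₂, h2⟩ := exists_dead_sum_sq_le hV hρ hh hf hf0 hp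
  set A₃ := momentConst f 1 * (2 * K / (1 - ρ))
  have hA₃ : 0 ≤ A₃ := by
    have h1 := momentConst_nonneg f 1
    have h2 := hV.one_le
    have h3 : 0 < 1 - ρ := sub_pos.2 hρ.2
    positivity
  refine ⟨3 * (A₁ + A₂ + A₃), by positivity, fun D m T γ Λ hγ hγ1 hT hΛ hDp => ?_⟩
  obtain ⟨i1, b1⟩ := h1 D m T γ hγ hγ1 hDp
  obtain ⟨i2, b2⟩ := h2 D m T γ Λ hγ hγ1 hT hΛ hDp
  have b3 := integral_centred_sum_sq_le hV hρ hf m T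
  have i3 : Integrable (fun ω => (∑ t ∈ Finset.range T, ∑ i ∈ Finset.range m,
      (f (V i t ω) - gaussExp f)) ^ 2) μ := by
    exact_mod_cast (memLp_centred_sum hV hf m T 2).integrable_sq
  simp only [hf0, sub_zero] at b3 i3
  set R : Ω → ℝ := fun ω => ∑ t ∈ Finset.range T, ∑ i ∈ Finset.range m, (V i t ω - β) *
        (defaultProb T V D h β (offset γ) i t ω -
          alive T D i t ω * (γ * Real.exp (β * V i t ω))) with hR
  set G : Ω → ℝ := fun ω => ∑ t ∈ Finset.range T, ∑ i ∈ Finset.range m,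
        f (V i t ω) * (1 - alive T D i t ω) with hG
  set X : Ω → ℝ := fun ω => ∑ t ∈ Finset.range T, ∑ i ∈ Finset.range m, f (V i t ω) with hX
  have hdec : ∀ ω, compensator m T V D h β (offset γ) ω = R ω + γ * X ω - γ * G ω := by
    intro ω
    simp only [compensator, hR, hX, hG, hfdef, Finset.mul_sum, ← Finset.sum_add_distrib,
      ← Finset.sum_sub_distrib]
    exact Finset.sum_congr rfl fun t _ => Finset.sum_congr rfl fun i _ => by ring
  have hdom : ∀ ω, compensator m T V D h β (offset γ) ω ^ 2 ≤
      3 * (R ω ^ 2 + γ ^ 2 * X ω ^ 2 + γ ^ 2 * G ω ^ 2) := by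
    intro ω
    rw [hdec]
    nlinarith [sq_nonneg (R ω - γ * X ω), sq_nonneg (R ω + γ * G ω), sq_nonneg (γ * X ω + γ * G ω)]
  have hint : Integrable (fun ω => 3 * (R ω ^ 2 + γ ^ 2 * X ω ^ 2 + γ ^ 2 * G ω ^ 2)) μ :=
    ((i1.add (i3.const_mul _)).add (i2.const_mul _)).const_mul 3
  have hmeas : Measurable (compensator m T V D h β (offset γ)) := by
    refine Finset.measurable_fun_sum _ fun t ht => Finset.measurable_fun_sum _ fun i _ => ?_
    have h1 := measurable_defaultProb (i := i) (β := β) hV hDp.measurable hh.continuous (offset γ)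
      (Finset.mem_range.1 ht)
    have h3 := hV.measurable i t
    fun_prop
  refine ⟨hint.mono' (hmeas.pow_const 2).aestronglyMeasurable (ae_of_all _ fun ω => ?_), ?_⟩
  · rw [Real.norm_of_nonneg (sq_nonneg _)]
    exact hdom ω
  refine (integral_mono_of_nonneg (ae_of_all _ fun ω => sq_nonneg _) hint (ae_of_all _ hdom)).trans ?_
  have i13 : Integrable (fun ω => R ω ^ 2 + γ ^ 2 * X ω ^ 2) μ := i1.add (i3.const_mul _)
  rw [integral_const_mul, integral_add i13 (i2.const_mul _), integral_add i1 (i3.const_mul _),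
    integral_const_mul, integral_const_mul]
  have c3 := mul_le_mul_of_nonneg_left b3 (sq_nonneg γ)
  have c2 := mul_le_mul_of_nonneg_left b2 (sq_nonneg γ)
  set y := Λ * γ + 1 / Λ ^ (p - 1)
  have hy : 0 ≤ y := by positivity
  set s := γ * m * T with hs
  have hs0 : 0 ≤ s := by positivity
  have r3 : γ ^ 2 * (A₃ * ((m : ℝ) ^ 2 * T)) = A₃ * (s * (γ * m)) := by rw [hs]; ring
  have r2 : γ ^ 2 * (A₂ * ((m * T : ℝ) ^ 2 * y)) = A₂ * (s * (s * y)) := by rw [hs]; ring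
  rw [r3] at c3
  rw [r2] at c2
  have k1 : 0 ≤ (A₂ + A₃) * (s * (γ * (γ * s))) := by positivity
  have k2 : 0 ≤ (A₁ + A₃) * (s * (s * y)) := by positivity
  have k3 : 0 ≤ (A₁ + A₂) * (s * (γ * m)) := by positivity
  nlinarith

end Compensator

/-! ### The asymptotic regime. -/

/-- Relations between the number `m` of firms, the number `T` of periods, and `γ ↓ 0`, under which
the estimators are analysed. -/
structure Regime (m T : ℝ → ℕ) : Prop where
  one_le_T : ∀ᶠ γ in 𝓝[>] (0 : ℝ), 1 ≤ T γ
  periods : Tendsto (fun γ => 1 / (T γ : ℝ)) (𝓝[>] 0) (𝓝 0)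
  exit : Tendsto (fun γ => γ * T γ) (𝓝[>] 0) (𝓝 0)
  size : Tendsto (fun γ => γ * m γ * T γ) (𝓝[>] 0) atTop
  rare : Tendsto (fun γ => γ * (γ * m γ * T γ)) (𝓝[>] 0) (𝓝 0)
  firms : Tendsto (fun γ => γ * m γ) (𝓝[>] 0) (𝓝 0)
  firms_log : Tendsto (fun γ => γ * m γ * offset γ ^ 2) (𝓝[>] 0) (𝓝 0)
  size_log : Tendsto (fun γ => offset γ ^ 2 / (γ * m γ * T γ)) (𝓝[>] 0) (𝓝 0)
  margin : ∃ (p : ℕ) (Λ : ℝ → ℝ), 1 ≤ p ∧ (∀ᶠ γ in 𝓝[>] (0 : ℝ), 0 < Λ γ) ∧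
    Tendsto (fun γ => (γ * m γ * T γ) * (Λ γ * γ + 1 / Λ γ ^ (p - 1))) (𝓝[>] 0) (𝓝 0)

lemma tendsto_offset : Tendsto offset (𝓝[>] 0) atTop := by
  have : offset = fun γ => - Real.log γ := by
    funext γ
    rw [offset, one_div, Real.log_inv]
  rw [this]
  exact tendsto_neg_atBot_atTop.comp Real.tendsto_log_nhdsGT_zero

lemma tendsto_rpow_zero {a : ℝ} (ha : 0 < a) :
    Tendsto (fun γ : ℝ => γ ^ a) (𝓝[>] 0) (𝓝 0) := by
  have h := (Real.continuousAt_rpow_const 0 a (Or.inr ha.le)).tendsto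
  rw [Real.zero_rpow ha.ne'] at h
  exact h.mono_left nhdsWithin_le_nhds

lemma tendsto_rpow_mul_offset_sq {a : ℝ} (ha : 0 < a) :
    Tendsto (fun γ : ℝ => γ ^ a * offset γ ^ 2) (𝓝[>] 0) (𝓝 0) := by
  have h := (tendsto_log_mul_rpow_nhdsGT_zero (half_pos ha)).pow 2
  rw [zero_pow two_ne_zero] at h
  refine h.congr' ?_
  filter_upwards [self_mem_nhdsWithin] with γ hγ
  rw [offset, one_div, Real.log_inv, neg_sq, mul_pow, ← Real.rpow_natCast (γ ^ (a / 2)),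
    ← Real.rpow_mul (le_of_lt hγ), mul_comm]
  norm_num

lemma tendsto_floor_rpow {d : ℝ} (hd : 0 < d) :
    Tendsto (fun γ : ℝ => (⌊γ ^ (-d)⌋₊ : ℝ) * γ ^ d) (𝓝[>] 0) (𝓝 1) := by
  have h1 : Tendsto (fun γ : ℝ => γ ^ (-d)) (𝓝[>] 0) atTop := by
    have h2 : Tendsto (fun γ : ℝ => γ ^ d) (𝓝[>] 0) (𝓝[>] 0) := by
      refine tendsto_nhdsWithin_iff.2 ⟨tendsto_rpow_zero hd, ?_⟩
      filter_upwards [self_mem_nhdsWithin] with γ hγ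
      exact Real.rpow_pos_of_pos hγ d
    refine (tendsto_inv_nhdsGT_zero.comp h2).congr' ?_
    filter_upwards [self_mem_nhdsWithin] with γ hγ
    rw [Real.rpow_neg (le_of_lt hγ)]
    rfl
  refine ((tendsto_nat_floor_div_atTop (R := ℝ)).comp h1).congr' ?_
  filter_upwards [self_mem_nhdsWithin] with γ hγ
  simp only [Function.comp]
  rw [Real.rpow_neg (le_of_lt hγ), div_inv_eq_mul]

section

variable {δ ζ : ℝ}

/-- This relates the normalisation `√(γ m T)` used throughout to the power `γ ^ (-(δ + ζ - 1) / 2)`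
of the assumption on uniform integrability. -/
lemma tendsto_size_div (hδ : 0 < δ) (hζ : 0 < ζ) :
    Tendsto (fun γ : ℝ => γ * numFirms δ γ * numPeriods ζ γ * γ ^ (δ + ζ - 1)) (𝓝[>] 0) (𝓝 1) := by
  have h := (tendsto_floor_rpow hδ).mul (tendsto_floor_rpow hζ)
  rw [one_mul] at h
  refine h.congr' ?_
  filter_upwards [self_mem_nhdsWithin] with γ hγ
  have hγ' : (0 : ℝ) < γ := hγ
  rw [Real.rpow_sub hγ', Real.rpow_add hγ', Real.rpow_one, numFirms, numPeriods]
  field_simp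

/-- Each convergence to zero amounts to a positive exponent of `γ`, possibly with a squared
logarithm: `firms` needs `δ < 1`, `exit` needs `ζ < 1`, `size` needs `δ + ζ > 1`, and `rare` needs
`δ + ζ < 2`. -/
lemma regime (hδ1 : δ < 1) (hζ : ζ ∈ Set.Ioo (0 : ℝ) 1) (hδζ : 1 < δ + ζ) :
    Regime (numFirms δ) (numPeriods ζ) := by
  have hδ : 0 < δ := by linarith [hζ.2]
  have hζ0 := hζ.1
  have hm := tendsto_floor_rpow hδ
  have hT := tendsto_floor_rpow hζ0
  have hs := tendsto_size_div hδ hζ0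
  have hTinv : Tendsto (fun γ => 1 / (numPeriods ζ γ : ℝ)) (𝓝[>] 0) (𝓝 0) := by
    have h := (hT.inv₀ one_ne_zero).mul (tendsto_rpow_zero hζ0)
    rw [mul_zero] at h
    refine h.congr' ?_
    filter_upwards [self_mem_nhdsWithin] with γ hγ
    have hγ' : (0 : ℝ) < γ := hγ
    have := Real.rpow_pos_of_pos hγ' ζ
    rw [numPeriods, mul_inv, one_div, inv_mul_cancel_right₀ this.ne']
  have key : ∀ (f : ℝ → ℝ) (e : ℝ), 0 < e → (∀ γ, 0 < γ → f γ =
      γ * numFirms δ γ * numPeriods ζ γ * γ ^ (δ + ζ - 1) * γ ^ e) →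
      Tendsto f (𝓝[>] 0) (𝓝 0) := by
    intro f e he hf
    have h := hs.mul (tendsto_rpow_zero he)
    rw [mul_zero] at h
    refine h.congr' ?_
    filter_upwards [self_mem_nhdsWithin] with γ hγ
    exact (hf γ hγ).symm
  have hsize_inv : Tendsto (fun γ : ℝ => (γ * numFirms δ γ * numPeriods ζ γ)⁻¹) (𝓝[>] 0) (𝓝 0) := by
    have h := (hs.inv₀ one_ne_zero).mul (tendsto_rpow_zero (show 0 < δ + ζ - 1 by linarith))
    rw [mul_zero] at h
    refine h.congr' ?_
    filter_upwards [self_mem_nhdsWithin] with γ hγ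
    have := Real.rpow_pos_of_pos (show (0 : ℝ) < γ from hγ) (δ + ζ - 1)
    rw [mul_inv, inv_mul_cancel_right₀ this.ne']
  have hspos : ∀ᶠ γ in 𝓝[>] (0 : ℝ), 0 < γ * numFirms δ γ * numPeriods ζ γ := by
    filter_upwards [self_mem_nhdsWithin, hs.eventually (lt_mem_nhds one_half_lt_one)] with γ hγ h
    have := Real.rpow_pos_of_pos (show (0 : ℝ) < γ from hγ) (δ + ζ - 1)
    exact pos_of_mul_pos_left (lt_trans (by norm_num) h) this.le
  have hfirms : Tendsto (fun γ => γ * numFirms δ γ) (𝓝[>] 0) (𝓝 0) := by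
    have h := hm.mul (tendsto_rpow_zero (sub_pos.2 hδ1))
    rw [mul_zero] at h
    refine h.congr' ?_
    filter_upwards [self_mem_nhdsWithin] with γ hγ
    rw [mul_assoc, ← Real.rpow_add hγ, add_sub_cancel, Real.rpow_one, mul_comm, numFirms]
  refine ⟨?_, hTinv, ?_, ?_, ?_, hfirms, ?_, ?_, ?_⟩
  · filter_upwards [hspos] with γ hγ
    by_contra h
    have : numPeriods ζ γ = 0 := by omega
    simp [this] at hγ
  · have h := hT.mul (tendsto_rpow_zero (sub_pos.2 hζ.2))
    rw [mul_zero] at h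
    refine h.congr' ?_
    filter_upwards [self_mem_nhdsWithin] with γ hγ
    rw [mul_assoc, ← Real.rpow_add hγ, add_sub_cancel, Real.rpow_one, mul_comm, numPeriods]
  · have h1 : Tendsto (fun γ : ℝ => (γ * numFirms δ γ * numPeriods ζ γ)⁻¹) (𝓝[>] 0) (𝓝[>] 0) := by
      refine tendsto_nhdsWithin_iff.2 ⟨hsize_inv, ?_⟩
      filter_upwards [hspos] with γ hγ
      exact inv_pos.2 hγ
    refine (tendsto_inv_nhdsGT_zero.comp h1).congr fun γ => ?_
    simp only [Function.comp, inv_inv]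
  · refine key _ (2 - δ - ζ) (by linarith [hζ.2]) fun γ hγ => ?_
    rw [mul_assoc _ (γ ^ (δ + ζ - 1)), ← Real.rpow_add hγ,
      show δ + ζ - 1 + (2 - δ - ζ) = 1 by ring, Real.rpow_one]
    ring
  · have h := hm.mul (tendsto_rpow_mul_offset_sq (sub_pos.2 hδ1))
    rw [mul_zero] at h
    refine h.congr' ?_
    filter_upwards [self_mem_nhdsWithin] with γ hγ
    rw [← mul_assoc, mul_assoc _ (γ ^ δ), ← Real.rpow_add hγ, add_sub_cancel, Real.rpow_one,
      mul_comm _ γ, numFirms]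
  · have h := (hs.inv₀ one_ne_zero).mul
      (tendsto_rpow_mul_offset_sq (show 0 < δ + ζ - 1 by linarith))
    rw [mul_zero] at h
    refine h.congr' ?_
    filter_upwards [self_mem_nhdsWithin] with γ hγ
    have := Real.rpow_pos_of_pos (show (0 : ℝ) < γ from hγ) (δ + ζ - 1)
    rw [mul_inv, ← mul_assoc, inv_mul_cancel_right₀ this.ne', div_eq_mul_inv, mul_comm]
  -- With `Λ = γ^{-η/2}` the first part of the margin is of order `γ^{η/2}`, and the second of order
  -- `γ^{nη/2 - (δ+ζ-1)}` for `p = n + 1`; `n` is taken large enough to make that exponent positive.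
  · set η : ℝ := 2 - δ - ζ with hη
    have hη0 : 0 < η := by rw [hη]; linarith [hζ.2]
    obtain ⟨n, hn⟩ := exists_nat_gt ((δ + ζ - 1) / (η / 2))
    rw [div_lt_iff₀ (half_pos hη0)] at hn
    refine ⟨n + 1, fun γ => γ ^ (-(η / 2)), by omega, ?_, ?_⟩
    · filter_upwards [self_mem_nhdsWithin] with γ hγ
      exact Real.rpow_pos_of_pos hγ _
    · have h1 : Tendsto (fun γ : ℝ => (γ * numFirms δ γ * numPeriods ζ γ) *
          (γ ^ (-(η / 2)) * γ)) (𝓝[>] 0) (𝓝 0) := by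
        refine key _ (η / 2) (half_pos hη0) fun γ hγ => ?_
        rw [mul_assoc _ (γ ^ (δ + ζ - 1)), ← Real.rpow_add hγ]
        congr 1
        rw [← Real.rpow_add_one hγ.ne']
        congr 1
        rw [hη]
        ring
      have h2 : Tendsto (fun γ : ℝ => (γ * numFirms δ γ * numPeriods ζ γ) *
          (1 / (γ ^ (-(η / 2))) ^ n)) (𝓝[>] 0) (𝓝 0) := by
        refine key _ (n * (η / 2) - (δ + ζ - 1)) (by linarith) fun γ hγ => ?_
        rw [mul_assoc _ (γ ^ (δ + ζ - 1)), ← Real.rpow_add hγ, add_sub_cancel]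
        congr 1
        rw [← Real.rpow_natCast, ← Real.rpow_mul hγ.le, one_div, ← Real.rpow_neg hγ.le]
        congr 1
        ring
      have h := h1.add h2
      rw [add_zero] at h
      refine h.congr fun γ => ?_
      rw [Nat.add_sub_cancel]
      ring

end

/-! ### Convergence in probability and uniform integrability. -/

section Probability

variable {Ω : Type*} [MeasurableSpace Ω] {μ : Measure Ω} [IsProbabilityMeasure μ]

/-- The event `P γ` has probability tending to one as `γ ↓ 0`. -/
def Whp (μ : Measure Ω) (P : ℝ → Ω → Prop) : Prop :=
  ∀ η : ℝ, 0 < η → ∀ᶠ γ in 𝓝[>] (0 : ℝ), μ.real {ω | ¬ P γ ω} ≤ η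

/-- No measurability is required of the sets, so exceptional events can be handled by implications
between their descriptions. -/
lemma real_le_of_ae_imp {A B : Set Ω} (h : ∀ᵐ ω ∂μ, ω ∈ A → ω ∈ B) : μ.real A ≤ μ.real B :=
  ENNReal.toReal_mono (measure_ne_top _ _) (measure_mono_ae h)

namespace Whp

variable {P Q : ℝ → Ω → Prop}

lemma mono (hP : Whp μ P) (h : ∀ᶠ γ in 𝓝[>] (0 : ℝ), ∀ᵐ ω ∂μ, P γ ω → Q γ ω) : Whp μ Q := by
  intro η hη
  filter_upwards [hP η hη, h] with γ h1 h2
  refine (real_le_of_ae_imp ?_).trans h1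
  filter_upwards [h2] with ω h3 h4 h5
  exact h4 (h3 h5)

lemma and (hP : Whp μ P) (hQ : Whp μ Q) : Whp μ (fun γ ω => P γ ω ∧ Q γ ω) := by
  intro η hη
  filter_upwards [hP (η / 2) (half_pos hη), hQ (η / 2) (half_pos hη)] with γ h1 h2
  refine (real_le_of_ae_imp (B := {ω | ¬ P γ ω} ∪ {ω | ¬ Q γ ω}) (ae_of_all _ fun ω h => ?_)).trans
    ((measureReal_union_le _ _).trans (by linarith))
  by_contra h3
  simp only [Set.mem_union, Set.mem_ofPred_eq, not_or, not_not] at h3 h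
  exact h h3

end Whp

lemma real_abs_gt_le {F : Ω → ℝ} (hF : Integrable F μ) {ε : ℝ} (hε : 0 < ε) :
    μ.real {ω | ¬ |F ω| ≤ ε} ≤ (∫ ω, |F ω| ∂μ) / ε := by
  have h := mul_meas_ge_le_integral_of_nonneg (μ := μ) (f := fun ω => |F ω|)
    (ae_of_all _ fun ω => abs_nonneg _) hF.abs ε
  rw [le_div_iff₀ hε, mul_comm]
  refine le_trans (mul_le_mul_of_nonneg_left (real_le_of_ae_imp (ae_of_all _ fun ω h => ?_)) hε.le) h
  exact (not_le.1 h).le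

/-- Convergence to zero in mean implies convergence to zero in probability. -/
lemma Whp.of_tendsto_integral_abs {F : ℝ → Ω → ℝ} (hi : ∀ᶠ γ in 𝓝[>] (0 : ℝ), Integrable (F γ) μ)
    (h : Tendsto (fun γ => ∫ ω, |F γ ω| ∂μ) (𝓝[>] 0) (𝓝 0)) {ε : ℝ} (hε : 0 < ε) :
    Whp μ (fun γ ω => |F γ ω| ≤ ε) := by
  intro η hη
  filter_upwards [hi, h.eventually (gt_mem_nhds (mul_pos hη hε))] with γ h1 h2
  exact (real_abs_gt_le h1 hε).trans ((div_le_iff₀ hε).2 h2.le)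

/-- A family bounded in mean times a family tending to zero in probability tends to zero in
probability. -/
lemma Whp.mul_small {F Z : ℝ → Ω → ℝ} {A : ℝ}
    (hi : ∀ᶠ γ in 𝓝[>] (0 : ℝ), Integrable (F γ) μ ∧ ∫ ω, |F γ ω| ∂μ ≤ A)
    (hZ : ∀ ε : ℝ, 0 < ε → Whp μ (fun γ ω => |Z γ ω| ≤ ε)) {ε : ℝ} (hε : 0 < ε) :
    Whp μ (fun γ ω => |F γ ω * Z γ ω| ≤ ε) := by
  intro η hη
  -- Markov's inequality at the level `B` leaves probability at most `η / 2` for a large first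
  -- factor.
  set B : ℝ := 2 * (|A| + 1) / η with hB
  have hB0 : 0 < B := by positivity
  filter_upwards [hi, hZ (ε / B) (by positivity) (η / 2) (half_pos hη)] with γ h1 h2
  have h3 : μ.real {ω | ¬ |F γ ω| ≤ B} ≤ η / 2 := by
    refine (real_abs_gt_le h1.1 hB0).trans ((div_le_iff₀ hB0).2 ?_)
    have : η / 2 * B = |A| + 1 := by rw [hB]; field_simp
    rw [this]
    linarith [h1.2, le_abs_self A]
  refine (real_le_of_ae_imp (B := {ω | ¬ |F γ ω| ≤ B} ∪ {ω | ¬ |Z γ ω| ≤ ε / B})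
    (ae_of_all _ fun ω h => ?_)).trans ((measureReal_union_le _ _).trans (by linarith))
  by_contra h4
  simp only [Set.mem_union, Set.mem_ofPred_eq, not_or, not_not] at h4 h
  refine h ?_
  rw [abs_mul]
  calc |F γ ω| * |Z γ ω| ≤ B * (ε / B) := mul_le_mul h4.1 h4.2 (abs_nonneg _) hB0.le
    _ = ε := by field_simp

/-- Uniform integrability as `γ ↓ 0`. -/
def EventuallyUI (μ : Measure Ω) (F : ℝ → Ω → ℝ) : Prop :=
  ∀ ε : ℝ, 0 < ε → ∃ d : ℝ, 0 < d ∧ ∀ᶠ γ in 𝓝[>] (0 : ℝ), Integrable (F γ) μ ∧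
    ∀ s, MeasurableSet s → μ.real s ≤ d → ∫ ω in s, |F γ ω| ∂μ ≤ ε

namespace EventuallyUI

variable {F G H : ℝ → Ω → ℝ}

/-- A term that vanishes in mean is eventually small over every set, so it does not affect uniform
integrability. -/
lemma of_le (hG : EventuallyUI μ G) {c : ℝ} (hc : 0 < c)
    (hH : ∀ᶠ γ in 𝓝[>] (0 : ℝ), Integrable (H γ) μ)
    (hH0 : Tendsto (fun γ => ∫ ω, |H γ ω| ∂μ) (𝓝[>] 0) (𝓝 0))
    (h : ∀ᶠ γ in 𝓝[>] (0 : ℝ), AEStronglyMeasurable (F γ) μ ∧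
      ∀ ω, |F γ ω| ≤ c * |G γ ω| + |H γ ω|) : EventuallyUI μ F := by
  intro ε hε
  obtain ⟨d, hd, hGd⟩ := hG (ε / (2 * c)) (by positivity)
  refine ⟨d, hd, ?_⟩
  filter_upwards [hGd, hH, hH0.eventually (gt_mem_nhds (half_pos hε)), h] with γ h1 h2 h3 h4
  have hint : Integrable (fun ω => c * |G γ ω| + |H γ ω|) μ := (h1.1.abs.const_mul c).add h2.abs
  refine ⟨hint.mono' h4.1 (ae_of_all _ h4.2), fun s hs hsd => ?_⟩
  calc ∫ ω in s, |F γ ω| ∂μ ≤ ∫ ω in s, (c * |G γ ω| + |H γ ω|) ∂μ :=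
        integral_mono_of_nonneg (ae_of_all _ fun ω => abs_nonneg _) hint.integrableOn
          (ae_of_all _ h4.2)
    _ = c * ∫ ω in s, |G γ ω| ∂μ + ∫ ω in s, |H γ ω| ∂μ := by
        rw [integral_add (h1.1.abs.const_mul c).integrableOn h2.abs.integrableOn,
          integral_const_mul]
    _ ≤ c * (ε / (2 * c)) + ∫ ω, |H γ ω| ∂μ :=
        add_le_add (mul_le_mul_of_nonneg_left (h1.2 s hs hsd) hc.le)
          (setIntegral_le_integral h2.abs (ae_of_all _ fun ω => abs_nonneg _))
    _ ≤ ε := by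
        have : c * (ε / (2 * c)) = ε / 2 := by field_simp
        linarith

/-- Cauchy–Schwarz against the indicator of `s` bounds the integral of `W²` over `s` by `√(E W⁴) √(μ
s)`. -/
lemma of_sq_bounded {W : ℝ → Ω → ℝ} {A : ℝ}
    (h : ∀ᶠ γ in 𝓝[>] (0 : ℝ), Measurable (W γ) ∧ Integrable (fun ω => W γ ω ^ 4) μ ∧
      ∫ ω, W γ ω ^ 4 ∂μ ≤ A) : EventuallyUI μ (fun γ ω => W γ ω ^ 2) := by
  intro ε hε
  refine ⟨(ε / (√|A| + 1)) ^ 2, by positivity, ?_⟩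
  filter_upwards [h] with γ ⟨hm, h4, hA⟩
  refine ⟨BernoulliStep.integrable_sq hm h4, fun s hs hsd => ?_⟩
  have h1 := integral_mul_le_sqrt_mul_sqrt (μ := μ) (f := fun ω => W γ ω ^ 2)
    (g := fun ω => s.indicator (fun _ => (1 : ℝ)) ω) (by fun_prop)
    (measurable_const.indicator hs).aestronglyMeasurable
    (h4.congr (ae_of_all _ fun ω => by simp only; ring))
    ((integrable_const (1 : ℝ)).mono' ((measurable_const.indicator hs).pow_const 2).aestronglyMeasurable
      (ae_of_all _ fun ω => by by_cases h : ω ∈ s <;> simp [h]))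
    (ae_of_all _ fun ω => sq_nonneg _) (ae_of_all _ fun ω => Set.indicator_nonneg (fun _ _ => zero_le_one) _)
  have e1 : ∫ ω, W γ ω ^ 2 * s.indicator (fun _ => (1 : ℝ)) ω ∂μ = ∫ ω in s, |W γ ω ^ 2| ∂μ := by
    rw [← integral_indicator hs]
    refine integral_congr_ae (ae_of_all _ fun ω => ?_)
    by_cases h : ω ∈ s <;> simp [h]
  have e2 : ∫ ω, (s.indicator (fun _ => (1 : ℝ)) ω) ^ 2 ∂μ = μ.real s := by
    rw [← integral_indicator_one hs]
    refine integral_congr_ae (ae_of_all _ fun ω => ?_)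
    by_cases h : ω ∈ s <;> simp [h]
  have e3 : ∫ ω, (W γ ω ^ 2) ^ 2 ∂μ ≤ |A| := by
    refine le_trans (le_of_eq ?_) (hA.trans (le_abs_self A))
    exact integral_congr_ae (ae_of_all _ fun ω => by simp only; ring)
  rw [e1, e2] at h1
  refine h1.trans ?_
  calc √(∫ ω, (W γ ω ^ 2) ^ 2 ∂μ) * √(μ.real s)
      ≤ √|A| * √((ε / (√|A| + 1)) ^ 2) :=
        mul_le_mul (Real.sqrt_le_sqrt e3) (Real.sqrt_le_sqrt hsd) (Real.sqrt_nonneg _)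
          (Real.sqrt_nonneg _)
    _ = √|A| * (ε / (√|A| + 1)) := by rw [Real.sqrt_sq (by positivity)]
    _ ≤ ε := by
        rw [mul_div_assoc', div_le_iff₀ (by positivity)]
        nlinarith [Real.sqrt_nonneg |A|]

end EventuallyUI

/-- Convergence of second moments along families that are asymptotically equal in probability. -/
lemma tendsto_integral_sq_of_whp {X W : ℝ → Ω → ℝ} {σ : ℝ}
    (hX : EventuallyUI μ (fun γ ω => X γ ω ^ 2)) (hW : EventuallyUI μ (fun γ ω => W γ ω ^ 2))
    (hXW : ∀ ε : ℝ, 0 < ε → Whp μ (fun γ ω => |X γ ω - W γ ω| ≤ ε))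
    (hσ : Tendsto (fun γ => ∫ ω, W γ ω ^ 2 ∂μ) (𝓝[>] 0) (𝓝 σ)) :
    Tendsto (fun γ => ∫ ω, X γ ω ^ 2 ∂μ) (𝓝[>] 0) (𝓝 σ) := by
  have hdiff : Tendsto (fun γ => ∫ ω, X γ ω ^ 2 ∂μ - ∫ ω, W γ ω ^ 2 ∂μ) (𝓝[>] 0) (𝓝 0) := by
    rw [Metric.tendsto_nhds]
    intro ε hε
    set B : ℝ := |σ| + 1
    have hB : 0 < B := by positivity
    -- Where `|X - W| ≤ κ ≤ 1`, the squares differ by at most `κ (2 + W²)`, which integrates to at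
    -- most `ε / 4`. Elsewhere each square contributes at most `ε / 4`.
    set κ : ℝ := min 1 (ε / (4 * (2 + B))) with hκ
    have hκ0 : 0 < κ := lt_min one_pos (by positivity)
    obtain ⟨d₁, hd₁, h1⟩ := hX (ε / 4) (by positivity)
    obtain ⟨d₂, hd₂, h2⟩ := hW (ε / 4) (by positivity)
    have hσB : ∀ᶠ γ in 𝓝[>] (0 : ℝ), ∫ ω, W γ ω ^ 2 ∂μ < B :=
      hσ.eventually (gt_mem_nhds (by linarith [le_abs_self σ]))
    filter_upwards [h1, h2, hσB, hXW κ hκ0 (min d₁ d₂) (lt_min hd₁ hd₂)] with γ ⟨hXi, hX1⟩ ⟨hWi, hW1⟩ hB1 hbad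
    rw [Real.dist_eq, sub_zero, ← integral_sub hXi hWi]
    -- A measurable hull of the same measure, since the exceptional event need not be measurable.
    set S := toMeasurable μ {ω | ¬ |X γ ω - W γ ω| ≤ κ} with hS
    have hSm : MeasurableSet S := measurableSet_toMeasurable _ _
    have hSr : μ.real S = μ.real {ω | ¬ |X γ ω - W γ ω| ≤ κ} := by
      simp only [hS, Measure.real, measure_toMeasurable]
    have hi : Integrable (fun ω => |X γ ω ^ 2 - W γ ω ^ 2|) μ := (hXi.sub hWi).abs
    have hon : ∫ ω in S, |X γ ω ^ 2 - W γ ω ^ 2| ∂μ ≤ ε / 4 + ε / 4 := by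
      calc ∫ ω in S, |X γ ω ^ 2 - W γ ω ^ 2| ∂μ
          ≤ ∫ ω in S, (|X γ ω ^ 2| + |W γ ω ^ 2|) ∂μ :=
            integral_mono_of_nonneg (ae_of_all _ fun ω => abs_nonneg _)
              (hXi.abs.add hWi.abs).integrableOn (ae_of_all _ fun ω => abs_sub _ _)
        _ = ∫ ω in S, |X γ ω ^ 2| ∂μ + ∫ ω in S, |W γ ω ^ 2| ∂μ :=
            integral_add hXi.abs.integrableOn hWi.abs.integrableOn
        _ ≤ _ := add_le_add (hX1 S hSm (by rw [hSr]; exact hbad.trans (min_le_left _ _)))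
            (hW1 S hSm (by rw [hSr]; exact hbad.trans (min_le_right _ _)))
    have hoff : ∫ ω in Sᶜ, |X γ ω ^ 2 - W γ ω ^ 2| ∂μ ≤ κ * (2 + B) := by
      calc ∫ ω in Sᶜ, |X γ ω ^ 2 - W γ ω ^ 2| ∂μ
          ≤ ∫ ω in Sᶜ, κ * (2 + W γ ω ^ 2) ∂μ := by
            refine setIntegral_mono_on hi.integrableOn
              (((integrable_const 2).add hWi).const_mul κ).integrableOn hSm.compl fun ω hω => ?_
            have h3 : |X γ ω - W γ ω| ≤ κ := by
              by_contra h
              exact hω (subset_toMeasurable _ _ h)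
            have h4 : X γ ω ^ 2 - W γ ω ^ 2 =
                (X γ ω - W γ ω) * ((X γ ω - W γ ω) + 2 * W γ ω) := by ring
            rw [h4, abs_mul]
            refine mul_le_mul h3 ?_ (abs_nonneg _) hκ0.le
            refine (abs_add_le _ _).trans ?_
            have h5 : |X γ ω - W γ ω| ≤ 1 := h3.trans (min_le_left _ _)
            have h6 : |2 * W γ ω| ≤ 1 + W γ ω ^ 2 := by
              rw [abs_le]
              constructor <;> nlinarith [sq_nonneg (W γ ω - 1), sq_nonneg (W γ ω + 1)]
            linarith
        _ ≤ ∫ ω, κ * (2 + W γ ω ^ 2) ∂μ :=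
            setIntegral_le_integral (((integrable_const 2).add hWi).const_mul κ)
              (ae_of_all _ fun ω => by simp only [Pi.zero_apply]; positivity)
        _ = κ * (2 + ∫ ω, W γ ω ^ 2 ∂μ) := by
            rw [integral_const_mul, integral_add (integrable_const 2) hWi]
            simp
        _ ≤ κ * (2 + B) := by
            exact mul_le_mul_of_nonneg_left (by linarith) hκ0.le
    have hκε : κ * (2 + B) ≤ ε / 4 := by
      have h5 : κ ≤ ε / (4 * (2 + B)) := min_le_right _ _
      calc κ * (2 + B) ≤ ε / (4 * (2 + B)) * (2 + B) := mul_le_mul_of_nonneg_right h5 (by positivity)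
        _ = ε / 4 := by field_simp
    calc |∫ ω, (X γ ω ^ 2 - W γ ω ^ 2) ∂μ| ≤ ∫ ω, |X γ ω ^ 2 - W γ ω ^ 2| ∂μ :=
          abs_integral_le_integral_abs
      _ = ∫ ω in S, |X γ ω ^ 2 - W γ ω ^ 2| ∂μ + ∫ ω in Sᶜ, |X γ ω ^ 2 - W γ ω ^ 2| ∂μ :=
          (integral_add_compl hSm hi).symm
      _ < ε := by linarith
  simpa using hdiff.add hσ

end Probability

/-! ### Pathwise bounds for the proposed estimator. -/

section FixedScaleEstimator

variable {Ω : Type*} {V D : ℕ → ℕ → Ω → ℝ} {h : ℝ → ℝ} {β C K ρ γ : ℝ} {m T : ℕ}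

/-- The sum of `f` over the covariates of the defaulting firms. -/
noncomputable def defaultSum (m T : ℕ) (V D : ℕ → ℕ → Ω → ℝ) (f : ℝ → ℝ) (ω : Ω) : ℝ :=
  ∑ t ∈ Finset.range T, ∑ i ∈ Finset.range m, f (V i t ω) * D i (t + 1) ω

lemma default_nonneg (hD : ∀ i t ω, D i t ω = 0 ∨ D i t ω = 1) (i t : ℕ) (ω : Ω) : 0 ≤ D i t ω := by
  rcases hD i t ω with h | h <;> simp [h]

lemma default_le_one (hD : ∀ i t ω, D i t ω = 0 ∨ D i t ω = 1) (i t : ℕ) (ω : Ω) : D i t ω ≤ 1 := by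
  rcases hD i t ω with h | h <;> simp [h]

lemma defaultSum_nonneg (hD : ∀ i t ω, D i t ω = 0 ∨ D i t ω = 1) {f : ℝ → ℝ} (hf : ∀ v, 0 ≤ f v)
    (ω : Ω) : 0 ≤ defaultSum m T V D f ω :=
  Finset.sum_nonneg fun _ _ => Finset.sum_nonneg fun _ _ =>
    mul_nonneg (hf _) (default_nonneg hD _ _ _)

lemma defaultSum_eq (f : ℝ → ℝ) (a : ℝ) (ω : Ω) :
    defaultSum m T V D f ω = fullMartingale m T V D h β a f ω +
      ∑ t ∈ Finset.range T, ∑ i ∈ Finset.range m, f (V i t ω) * defaultProb T V D h β a i t ω := by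
  simp only [defaultSum, fullMartingale, innovation, ← Finset.sum_add_distrib]
  refine Finset.sum_congr rfl fun t _ => Finset.sum_congr rfl fun i _ => ?_
  ring

lemma one_le_defaultSum_one (hD : ∀ i t ω, D i t ω = 0 ∨ D i t ω = 1) {ω : Ω}
    (hN : defaultSum m T V D (fun _ => 1) ω ≠ 0) : 1 ≤ defaultSum m T V D (fun _ => 1) ω := by
  have hnn : ∀ t, 0 ≤ ∑ i ∈ Finset.range m, 1 * D i (t + 1) ω := fun t =>
    Finset.sum_nonneg fun i _ => mul_nonneg zero_le_one (default_nonneg hD _ _ _)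
  obtain ⟨t, ht, h1⟩ := Finset.exists_ne_zero_of_sum_ne_zero hN
  obtain ⟨i, hi, h2⟩ := Finset.exists_ne_zero_of_sum_ne_zero h1
  have h3 : 1 * D i (t + 1) ω = 1 := by
    rcases hD i (t + 1) ω with h | h <;> simp_all
  calc (1 : ℝ) = 1 * D i (t + 1) ω := h3.symm
    _ ≤ ∑ i ∈ Finset.range m, 1 * D i (t + 1) ω :=
        Finset.single_le_sum (f := fun i => 1 * D i (t + 1) ω)
          (fun i _ => mul_nonneg zero_le_one (default_nonneg hD _ _ _)) hi
    _ ≤ _ := Finset.single_le_sum (f := fun t => ∑ i ∈ Finset.range m, 1 * D i (t + 1) ω)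
          (fun t _ => hnn t) ht

lemma proposedEstimator_sub (hs : γ * m * T ≠ 0) {ω : Ω}
    (hN : defaultSum m T V D (fun _ => 1) ω ≠ 0) :
    proposedEstimator V D m T γ ω - β =
      defaultSum m T V D (fun v => v - β) ω / defaultSum m T V D (fun _ => 1) ω := by
  have h1 : defaultSum m T V D (fun v => v - β) ω =
      (∑ t ∈ Finset.range T, ∑ i ∈ Finset.range m, V i t ω * D i (t + 1) ω) -
        β * defaultSum m T V D (fun _ => 1) ω := by
    simp only [defaultSum, Finset.mul_sum, ← Finset.sum_sub_distrib]
    refine Finset.sum_congr rfl fun t _ => Finset.sum_congr rfl fun i _ => ?_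
    ring
  have h2 : defaultAvg D m T γ ω = 1 / (γ * T * m) * defaultSum m T V D (fun _ => 1) ω := by
    simp [defaultAvg, defaultSum]
  have hs' : γ * T * m ≠ 0 := by
    intro h
    exact hs (by linarith)
  rw [proposedEstimator, h1, h2, covariateAvg]
  have := one_div_ne_zero hs'
  rw [mul_div_mul_left _ _ this, sub_div, mul_div_cancel_right₀ _ hN]

/-- Division by zero yields zero, which is the prescribed value when no firm defaults. -/
lemma proposedEstimator_eq_zero {ω : Ω} (hN : defaultSum m T V D (fun _ => 1) ω = 0) :
    proposedEstimator V D m T γ ω = 0 := by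
  have h2 : defaultAvg D m T γ ω = 1 / (γ * T * m) * defaultSum m T V D (fun _ => 1) ω := by
    simp [defaultAvg, defaultSum]
  rw [proposedEstimator, h2, hN, mul_zero, div_zero]

/-- Cauchy-Schwarz for double sums. -/
lemma sum_sum_mul_sq_le (f g : ℕ → ℕ → ℝ) :
    (∑ t ∈ Finset.range T, ∑ i ∈ Finset.range m, f i t * g i t) ^ 2 ≤
      (∑ t ∈ Finset.range T, ∑ i ∈ Finset.range m, f i t ^ 2) *
        ∑ t ∈ Finset.range T, ∑ i ∈ Finset.range m, g i t ^ 2 := by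
  have h := Finset.sum_mul_sq_le_sq_mul_sq (Finset.range T ×ˢ Finset.range m)
    (fun k => f k.2 k.1) (fun k => g k.2 k.1)
  simpa only [Finset.sum_product] using h

/-- The squared error of a mean is at most the mean of the squares over the defaults. Deviations up
to `L` contribute `L²`; larger ones are weighted by `e^{-4L} e^{4|v-β|} ≥ 1` and summed over all
firms and periods. The term `β²` covers the absence of defaults. The useful choice is `L = log
(1/γ)`, for which `e^{-4L} = γ⁴`. -/
lemma proposedEstimator_sub_sq_le (hD : ∀ i t ω, D i t ω = 0 ∨ D i t ω = 1)
    (hs : γ * m * T ≠ 0) (L : ℝ) (ω : Ω) :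
    (proposedEstimator V D m T γ ω - β) ^ 2 ≤ β ^ 2 + L ^ 2 + Real.exp (-4 * L) *
      ∑ t ∈ Finset.range T, ∑ i ∈ Finset.range m,
        (V i t ω - β) ^ 2 * Real.exp (4 * |V i t ω - β|) := by
  set S := ∑ t ∈ Finset.range T, ∑ i ∈ Finset.range m,
        (V i t ω - β) ^ 2 * Real.exp (4 * |V i t ω - β|) with hS
  have hS0 : 0 ≤ S := Finset.sum_nonneg fun _ _ => Finset.sum_nonneg fun _ _ => by positivity
  by_cases hN : defaultSum m T V D (fun _ => 1) ω = 0
  · rw [proposedEstimator_eq_zero hN]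
    have : 0 ≤ Real.exp (-4 * L) * S := by positivity
    nlinarith [sq_nonneg L]
  have hN1 := one_le_defaultSum_one hD hN
  set N := defaultSum m T V D (fun _ => 1) ω with hNdef
  have hN0 : 0 < N := by linarith
  have hcs := sum_sum_mul_sq_le (m := m) (T := T) (fun i t => D i (t + 1) ω)
    (fun i t => (V i t ω - β) * D i (t + 1) ω)
  have hDD : ∀ i t, D i t ω * D i t ω = D i t ω := fun i t => by
    rcases hD i t ω with h | h <;> simp [h]
  have e1 : ∀ i t, D i (t + 1) ω * ((V i t ω - β) * D i (t + 1) ω) = (V i t ω - β) * D i (t + 1) ω :=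
    fun i t => by rw [mul_left_comm, hDD]
  have e2 : ∀ i t, D i (t + 1) ω ^ 2 = 1 * D i (t + 1) ω := fun i t => by rw [sq, hDD, one_mul]
  have hpt : ∀ i t, ((V i t ω - β) * D i (t + 1) ω) ^ 2 ≤ L ^ 2 * (1 * D i (t + 1) ω) +
      Real.exp (-4 * L) * ((V i t ω - β) ^ 2 * Real.exp (4 * |V i t ω - β|)) := by
    intro i t
    have hd0 := default_nonneg hD i (t + 1) ω
    have hd1 := default_le_one hD i (t + 1) ω
    rw [mul_pow, e2]
    rcases le_or_gt |V i t ω - β| L with hle | hgt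
    · have : (V i t ω - β) ^ 2 ≤ L ^ 2 := sq_le_sq' (abs_le.1 hle).1 (abs_le.1 hle).2
      have h0 : 0 ≤ Real.exp (-4 * L) * ((V i t ω - β) ^ 2 * Real.exp (4 * |V i t ω - β|)) := by
        positivity
      nlinarith
    · have h1 : 1 ≤ Real.exp (-4 * L) * Real.exp (4 * |V i t ω - β|) := by
        rw [← Real.exp_add]
        exact Real.one_le_exp (by linarith)
      have h2 : (V i t ω - β) ^ 2 ≤
          Real.exp (-4 * L) * ((V i t ω - β) ^ 2 * Real.exp (4 * |V i t ω - β|)) := by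
        nlinarith [sq_nonneg (V i t ω - β)]
      nlinarith [sq_nonneg (V i t ω - β), mul_nonneg (sq_nonneg L) hd0]
  have hsum : ∑ t ∈ Finset.range T, ∑ i ∈ Finset.range m, ((V i t ω - β) * D i (t + 1) ω) ^ 2 ≤
      L ^ 2 * N + Real.exp (-4 * L) * S := by
    rw [hNdef, hS, defaultSum]
    simp only [Finset.mul_sum, ← Finset.sum_add_distrib]
    exact Finset.sum_le_sum fun t _ => Finset.sum_le_sum fun i _ => hpt i t
  simp only [e1, e2] at hcs
  rw [proposedEstimator_sub hs hN, div_pow, div_le_iff₀ (by positivity)]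
  have h3 : (defaultSum m T V D (fun v => v - β) ω) ^ 2 ≤ N * (L ^ 2 * N + Real.exp (-4 * L) * S) :=
    hcs.trans (mul_le_mul_of_nonneg_left hsum hN0.le)
  have h4 : 0 ≤ Real.exp (-4 * L) * S := by positivity
  have h5 : N * (Real.exp (-4 * L) * S) ≤ N ^ 2 * (Real.exp (-4 * L) * S) :=
    mul_le_mul_of_nonneg_right (by nlinarith) h4
  nlinarith [mul_nonneg (sq_nonneg β) (sq_nonneg N)]

/-- One default removes its firm from at most `T` periods. -/
lemma sum_sum_dead_le (hD : ∀ i t ω, D i t ω = 0 ∨ D i t ω = 1) (ω : Ω) :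
    ∑ t ∈ Finset.range T, ∑ i ∈ Finset.range m, (1 - alive T D i t ω) ≤
      T * defaultSum m T V D (fun _ => 1) ω := by
  have h1 : ∀ t ∈ Finset.range T, ∑ i ∈ Finset.range m, (1 - alive T D i t ω) ≤
      defaultSum m T V D (fun _ => 1) ω := by
    intro t ht
    rw [defaultSum, Finset.sum_comm]
    refine Finset.sum_le_sum fun i _ =>
      (one_sub_alive_le hD (Finset.mem_range.1 ht) ω).trans ?_
    simp only [one_mul]
    exact Finset.sum_le_sum_of_subset_of_nonneg
      (Finset.range_subset_range.2 (Finset.mem_range.1 ht).le)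
      fun s _ _ => default_nonneg hD _ _ _
  refine (Finset.sum_le_sum h1).trans (le_of_eq ?_)
  rw [Finset.sum_const, Finset.card_range, nsmul_eq_mul]

lemma sum_sum_dead_mul_sq_le (hD : ∀ i t ω, D i t ω = 0 ∨ D i t ω = 1) (f : ℕ → ℕ → ℝ) (ω : Ω) :
    (∑ t ∈ Finset.range T, ∑ i ∈ Finset.range m, (1 - alive T D i t ω) * f i t) ^ 2 ≤
      T * defaultSum m T V D (fun _ => 1) ω *
        ∑ t ∈ Finset.range T, ∑ i ∈ Finset.range m, f i t ^ 2 := by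
  refine (sum_sum_mul_sq_le (fun i t => 1 - alive T D i t ω) f).trans
    (mul_le_mul_of_nonneg_right ?_ (Finset.sum_nonneg fun _ _ => Finset.sum_nonneg fun _ _ =>
      sq_nonneg _))
  refine le_trans (le_of_eq ?_) (sum_sum_dead_le (V := V) hD ω)
  refine Finset.sum_congr rfl fun t _ => Finset.sum_congr rfl fun i _ => ?_
  rcases alive_mem T D i t ω with h | h <;> simp [h]

/-- If the covariates are typical, few defaults force a large negative fluctuation. -/
lemma fullMartingale_one_le (hD : ∀ i t ω, D i t ω = 0 ∨ D i t ω = 1) (hh : IsCorrection h β C)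
    (hγ : 0 < γ) {c Q : ℝ} (hc : 0 < c) {ω : Ω}
    (h1 : 7 / 8 * c * (m * T) ≤ ∑ t ∈ Finset.range T, ∑ i ∈ Finset.range m, Real.exp (β * V i t ω))
    (h2 : ∑ t ∈ Finset.range T, ∑ i ∈ Finset.range m, Real.exp (2 * β * V i t ω) ≤ Q * (m * T))
    (hT : γ * T * (c / 2 * Q) ≤ (c / 8) ^ 2) (hγQ : C * Q * γ ≤ c / 8)
    (hN : defaultSum m T V D (fun _ => 1) ω ≤ c / 2 * (γ * m * T)) :
    fullMartingale m T V D h β (offset γ) (fun _ => 1) ω ≤ -(c / 8 * (γ * m * T)) := by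
  set N := defaultSum m T V D (fun _ => 1) ω with hNdef
  set d := ∑ t ∈ Finset.range T, ∑ i ∈ Finset.range m,
    (1 - alive T D i t ω) * Real.exp (β * V i t ω) with hd
  set E2 := ∑ t ∈ Finset.range T, ∑ i ∈ Finset.range m, Real.exp (2 * β * V i t ω)
  set E1 := ∑ t ∈ Finset.range T, ∑ i ∈ Finset.range m, Real.exp (β * V i t ω)
  have hN0 : 0 ≤ N := defaultSum_nonneg hD (fun _ => zero_le_one) ω
  have hd2 : d ^ 2 ≤ T * N * E2 := by
    refine (sum_sum_dead_mul_sq_le (V := V) hD _ ω).trans (le_of_eq ?_)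
    congr 1
    refine Finset.sum_congr rfl fun t _ => Finset.sum_congr rfl fun i _ => ?_
    rw [← Real.exp_nat_mul]
    congr 1
    push_cast
    ring
  -- The assumption of few defaults itself limits the number of dead firm-periods, so no separate
  -- probability estimate for them is needed.
  have hγd : γ * d ≤ c / 8 * (γ * m * T) := by
    refine abs_le_of_sq_le_sq' ?_ (by positivity) |>.2
    calc (γ * d) ^ 2 = γ ^ 2 * d ^ 2 := by ring
      _ ≤ γ ^ 2 * (T * (c / 2 * (γ * m * T)) * (Q * (m * T))) := by
          refine mul_le_mul_of_nonneg_left (hd2.trans ?_) (by positivity)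
          have : 0 ≤ E2 := Finset.sum_nonneg fun _ _ => Finset.sum_nonneg fun _ _ =>
            (Real.exp_pos _).le
          gcongr
      _ = γ * T * (c / 2 * Q) * (γ * m * T) ^ 2 := by ring
      _ ≤ (c / 8) ^ 2 * (γ * m * T) ^ 2 := by gcongr
      _ = _ := by ring
  have hP : γ * E1 - γ * d - C * γ ^ 2 * E2 ≤
      ∑ t ∈ Finset.range T, ∑ i ∈ Finset.range m,
        1 * defaultProb T V D h β (offset γ) i t ω := by
    simp only [E1, E2, hd, Finset.mul_sum, ← Finset.sum_sub_distrib]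
    refine Finset.sum_le_sum fun t _ => Finset.sum_le_sum fun i _ => ?_
    have := (abs_le.1 (abs_defaultProb_sub_le (V := V) (D := D) (T := T) (i := i) (t := t)
      hh hγ ω)).1
    linarith
  have h3 := defaultSum_eq (m := m) (T := T) (V := V) (D := D) (h := h) (β := β) (fun _ => 1)
    (offset γ) ω
  have h4 : C * γ ^ 2 * E2 ≤ c / 8 * (γ * m * T) := by
    have := hh.nonneg
    calc C * γ ^ 2 * E2 ≤ C * γ ^ 2 * (Q * (m * T)) := by gcongr
      _ = C * Q * γ * (γ * m * T) := by ring
      _ ≤ _ := by gcongr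
  have h5 : 7 / 8 * c * (γ * m * T) ≤ γ * E1 := by
    calc 7 / 8 * c * (γ * m * T) = γ * (7 / 8 * c * (m * T)) := by ring
      _ ≤ _ := by gcongr
  -- In units of `c γ m T`, the number of defaults is at most `1/2` and the sum of the default
  -- probabilities at least `7/8 - 1/8 - 1/8`; the martingale is their difference.
  linarith

end FixedScaleEstimator

/-! ### Probability of few defaults. -/

section FewDefaults

variable {Ω : Type*} {V : ℕ → ℕ → Ω → ℝ} {h : ℝ → ℝ} {β C K ρ : ℝ}
  [m0 : MeasurableSpace Ω] {μ : Measure Ω} [IsProbabilityMeasure μ]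

lemma real_abs_gt_le_pow {F : Ω → ℝ} {n : ℕ} (hn : n ≠ 0)
    (hF : Integrable (fun ω => F ω ^ (2 * n)) μ) {ε : ℝ} (hε : 0 < ε) :
    μ.real {ω | ¬ |F ω| ≤ ε} ≤ (∫ ω, F ω ^ (2 * n) ∂μ) / ε ^ (2 * n) := by
  have h := real_abs_gt_le hF (pow_pos hε (2 * n))
  have hnn : ∀ x : ℝ, |x ^ (2 * n)| = x ^ (2 * n) := fun x =>
    abs_of_nonneg (by rw [pow_mul]; positivity)
  simp only [hnn] at h
  refine le_trans (real_le_of_ae_imp (B := {ω | ¬ F ω ^ (2 * n) ≤ ε ^ (2 * n)})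
    (ae_of_all _ fun ω (h1 : ¬ |F ω| ≤ ε) (h2 : F ω ^ (2 * n) ≤ ε ^ (2 * n)) => h1 ?_)) h
  rw [← hnn, abs_pow] at h2
  exact (pow_le_pow_iff_left₀ (abs_nonneg _) hε.le (by omega)).1 h2

lemma real_centred_sum_le (hV : IsCovariateProcess μ V K ρ) (hρ : ρ ∈ Set.Ioo (0 : ℝ) 1)
    {g : ℝ → ℝ} (hg : SmoothExp g) {m T : ℕ} (hm : 0 < m) (hT : 0 < T) {ε : ℝ} (hε : 0 < ε) :
    μ.real {ω | ¬ |∑ t ∈ Finset.range T, ∑ i ∈ Finset.range m, (g (V i t ω) - gaussExp g)| ≤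
      ε * (m * T)} ≤ momentConst g 1 * (2 * K / (1 - ρ)) / ε ^ 2 * (1 / T) := by
  have hm' : (0 : ℝ) < m := by exact_mod_cast hm
  have hT' : (0 : ℝ) < T := by exact_mod_cast hT
  have hi := (memLp_centred_sum hV hg m T 2).integrable_sq
  have h := real_abs_gt_le_pow (n := 1) one_ne_zero hi (show 0 < ε * (m * T) by positivity)
  refine h.trans ?_
  simp only [mul_one]
  rw [div_le_iff₀ (by positivity)]
  refine (integral_centred_sum_sq_le hV hρ hg m T).trans (le_of_eq ?_)
  field_simp

/-- It is unlikely that there are less than half as many defaults as expected. -/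
lemma exists_few_defaults_le (hV : IsCovariateProcess μ V K ρ) (hρ : ρ ∈ Set.Ioo (0 : ℝ) 1)
    (hh : IsCorrection h β C) :
    ∃ A κ : ℝ, 0 ≤ A ∧ 0 < κ ∧ ∀ (D : ℕ → ℕ → Ω → ℝ) (m T : ℕ) (γ : ℝ), 0 < γ → γ ≤ 1 →
      γ ≤ κ → γ * T ≤ κ → 1 ≤ γ * m * T → IsDefaultProcess μ V D h β (offset γ) m T →
      μ.real {ω | ¬ Real.exp (β ^ 2 / 2) / 2 * (γ * m * T) < defaultSum m T V D (fun _ => 1) ω} ≤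
        A * (1 / T + 1 / (γ * m * T) ^ 2) := by
  obtain ⟨A₁, hA₁, hM⟩ := exists_martingale_moments hV hh (ExpBdd.const 1) measurable_const
  set c := Real.exp (β ^ 2 / 2) with hc
  have hc0 : 0 < c := Real.exp_pos _
  set g₂ := gaussExp (fun z => Real.exp (2 * β * z)) with hg₂
  have hg₂0 : 0 < g₂ := by rw [hg₂, gaussExp_exp]; exact Real.exp_pos _
  have hK := hV.one_le
  have hρ' : 0 < 1 - ρ := sub_pos.2 hρ.2
  have hC := hh.nonneg
  set B₁ := momentConst (fun v => Real.exp (β * v)) 1 * (2 * K / (1 - ρ)) / (c / 8) ^ 2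
  set B₂ := momentConst (fun v => Real.exp (2 * β * v)) 1 * (2 * K / (1 - ρ)) / g₂ ^ 2
  have hB₁ : 0 ≤ B₁ := by
    have := momentConst_nonneg (fun v => Real.exp (β * v)) 1
    positivity
  have hB₂ : 0 ≤ B₂ := by
    have := momentConst_nonneg (fun v => Real.exp (2 * β * v)) 1
    positivity
  -- The martingale enters through its fourth moment, which gives `1 / (γ m T)²`. This probability
  -- is later multiplied by `γ m T log² (1/γ)`, for which a rate `1 / (γ m T)` would not suffice.
  -- The factor 4 is from `(1 + x)² ≤ 4 x²` for `x ≥ 1`.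
  set B₃ := A₁ * 4 / (c / 9) ^ 4
  have hB₃ : 0 ≤ B₃ := by positivity
  set Q := 2 * g₂ with hQ
  refine ⟨B₁ + B₂ + B₃, min ((c / 8) ^ 2 / (c / 2 * Q)) (c / 8 / (C * Q + 1)), by positivity,
    lt_min (by positivity) (by positivity), fun D m T γ hγ hγ1 hγκ hTκ hs hDp => ?_⟩
  have hm : 0 < m := by
    rcases Nat.eq_zero_or_pos m with h | h
    · simp [h] at hs; linarith
    · exact h
  have hT : 0 < T := by
    rcases Nat.eq_zero_or_pos T with h | h
    · simp [h] at hs; linarith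
    · exact h
  have hT' : (0 : ℝ) < T := by exact_mod_cast hT
  obtain ⟨hM4, hM4le, -, -⟩ := hM D m T γ hγ hγ1 hDp
  have p1 := real_centred_sum_le hV hρ (SmoothExp.exp β) hm hT (show 0 < c / 8 by positivity)
  have p2 := real_centred_sum_le hV hρ (SmoothExp.exp (2 * β)) hm hT hg₂0
  -- The level `c / 9` lies strictly below the `c / 8` of `fullMartingale_one_le`, so the two bounds
  -- are incompatible.
  have p3 := real_abs_gt_le_pow (n := 2) two_ne_zero hM4
    (show 0 < c / 9 * (γ * m * T) by positivity)
  have p3' : (∫ ω, fullMartingale m T V D h β (offset γ) (fun _ => 1) ω ^ (2 * 2) ∂μ) /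
      (c / 9 * (γ * m * T)) ^ (2 * 2) ≤ B₃ * (1 / (γ * m * T) ^ 2) := by
    rw [div_le_iff₀ (by positivity)]
    refine hM4le.trans ?_
    have e : B₃ * (1 / (γ * m * T) ^ 2) * (c / 9 * (γ * m * T)) ^ (2 * 2) =
        A₁ * (4 * (γ * m * T) ^ 2) := by
      have : γ * m * T ≠ 0 := by positivity
      simp only [B₃]
      generalize γ * m * T = s at *
      field_simp
      ring
    rw [e]
    refine mul_le_mul_of_nonneg_left ?_ hA₁
    nlinarith
  rw [gaussExp_exp] at p1
  have hsub : μ.real {ω | ¬ c / 2 * (γ * m * T) < defaultSum m T V D (fun _ => 1) ω} ≤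
      μ.real (({ω | ¬ |∑ t ∈ Finset.range T, ∑ i ∈ Finset.range m,
          (Real.exp (β * V i t ω) - c)| ≤ c / 8 * (m * T)} ∪
        {ω | ¬ |∑ t ∈ Finset.range T, ∑ i ∈ Finset.range m,
          (Real.exp (2 * β * V i t ω) - g₂)| ≤ g₂ * (m * T)}) ∪
        {ω | ¬ |fullMartingale m T V D h β (offset γ) (fun _ => 1) ω| ≤ c / 9 * (γ * m * T)}) := by
    refine real_le_of_ae_imp (ae_of_all _ fun ω hω => ?_)
    by_contra hcon
    simp only [Set.mem_union, Set.mem_ofPred_eq, not_or, not_not] at hcon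
    obtain ⟨⟨c1, c2⟩, c3⟩ := hcon
    simp only [Finset.sum_sub_distrib, Finset.sum_const, Finset.card_range, nsmul_eq_mul] at c1 c2
    refine absurd (abs_le.1 c3).1 (not_le.2 ?_)
    refine lt_of_le_of_lt (fullMartingale_one_le hDp.zero_or_one hh hγ hc0
      (Q := Q) ?_ ?_ ?_ ?_ (not_lt.1 hω)) ?_
    · linarith [(abs_le.1 c1).1]
    · linarith [(abs_le.1 c2).2]
    · exact (le_div_iff₀ (by positivity)).1 (hTκ.trans (min_le_left _ _))
    · have := (le_div_iff₀ (by positivity)).1 (hγκ.trans (min_le_right _ _))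
      linarith
    · nlinarith
  refine hsub.trans ((measureReal_union_le _ _).trans ((add_le_add_left
    (measureReal_union_le _ _) _).trans ((add_le_add (add_le_add p1 p2)
      (p3.trans p3')).trans ?_)))
  have h1 : 0 ≤ 1 / (T : ℝ) := by positivity
  have h2 : 0 ≤ 1 / (γ * m * T) ^ 2 := by positivity
  change B₁ * (1 / T) + B₂ * (1 / T) + B₃ * (1 / (γ * m * T) ^ 2) ≤ _
  nlinarith [mul_nonneg hB₁ h2, mul_nonneg hB₂ h2, mul_nonneg hB₃ h1]

end FewDefaults

/-! ### Limits under the asymptotic regime. -/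

section Asymptotics

variable {Ω : Type*} {V : ℕ → ℕ → Ω → ℝ} {h : ℝ → ℝ} {β C K ρ : ℝ}
  [m0 : MeasurableSpace Ω] {μ : Measure Ω} [IsProbabilityMeasure μ]
  {m T : ℝ → ℕ} {D : ℝ → ℕ → ℕ → Ω → ℝ}

lemma eventually_pos_le_one : ∀ᶠ γ in 𝓝[>] (0 : ℝ), 0 < γ ∧ γ ≤ 1 := by
  filter_upwards [Ioc_mem_nhdsGT (zero_lt_one' ℝ)] with γ hγ
  exact hγ

lemma tendsto_id_nhdsGT : Tendsto (fun γ : ℝ => γ) (𝓝[>] 0) (𝓝 0) :=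
  tendsto_id.mono_left nhdsWithin_le_nhds

lemma Regime.sqrt_exit (hR : Regime m T) : Tendsto (fun γ => √(γ * T γ)) (𝓝[>] 0) (𝓝 0) := by
  have h := hR.exit.sqrt
  rwa [Real.sqrt_zero] at h

lemma Regime.lln_rate (hR : Regime m T) :
    Tendsto (fun γ => √(1 / T γ) + √(γ * T γ)) (𝓝[>] 0) (𝓝 0) := by
  have h := hR.periods.sqrt.add hR.exit.sqrt
  rwa [Real.sqrt_zero, add_zero] at h

lemma Regime.size_inv (hR : Regime m T) :
    Tendsto (fun γ => 1 / (γ * m γ * T γ)) (𝓝[>] 0) (𝓝 0) := by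
  simpa only [one_div, Function.comp_def] using tendsto_inv_atTop_zero.comp hR.size

lemma pos_of_one_le_size {γ : ℝ} {m T : ℕ} (h : 1 ≤ γ * m * T) : 0 < (m : ℝ) ∧ 0 < (T : ℝ) := by
  rcases Nat.eq_zero_or_pos m with hm | hm
  · simp [hm] at h
    linarith
  rcases Nat.eq_zero_or_pos T with hT | hT
  · simp [hT] at h
    linarith
  exact ⟨by exact_mod_cast hm, by exact_mod_cast hT⟩

lemma measurable_fullMartingale (hV : IsCovariateProcess μ V K ρ) (hh : Continuous h)
    {m T : ℕ} {D : ℕ → ℕ → Ω → ℝ} (hD : ∀ i t, Measurable (D i t)) {a : ℝ} {w : ℝ → ℝ}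
    (hw : Measurable w) : Measurable (fullMartingale m T V D h β a w) := by
  unfold fullMartingale innovation
  refine Finset.measurable_fun_sum _ fun t ht => Finset.measurable_fun_sum _ fun i _ => ?_
  exact (hw.comp (hV.measurable i t)).mul ((hD i (t + 1)).sub
    (measurable_defaultProb hV hD hh a (Finset.mem_range.1 ht)))

/-- The normalised martingale has uniformly integrable squares and converging second moments. -/
lemma normalised_martingale (hV : IsCovariateProcess μ V K ρ) (hh : IsCorrection h β C)
    (hR : Regime m T)
    (hD : ∀ᶠ γ in 𝓝[>] (0 : ℝ), IsDefaultProcess μ V (D γ) h β (offset γ) (m γ) (T γ))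
    {w : ℝ → ℝ} (hw : ExpBdd w) (hwm : Measurable w) (κ : ℝ) :
    EventuallyUI μ (fun γ ω =>
      (κ * fullMartingale (m γ) (T γ) V (D γ) h β (offset γ) w ω / √(γ * m γ * T γ)) ^ 2) ∧
    Tendsto (fun γ => ∫ ω,
      (κ * fullMartingale (m γ) (T γ) V (D γ) h β (offset γ) w ω / √(γ * m γ * T γ)) ^ 2 ∂μ)
      (𝓝[>] 0) (𝓝 (κ ^ 2 * gaussExp (fun z => w z ^ 2 * Real.exp (β * z)))) := by
  obtain ⟨A, hA, hM⟩ := exists_martingale_moments hV hh hw hwm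
  constructor
  · refine EventuallyUI.of_sq_bounded (A := κ ^ 4 * (A * 4)) ?_
    filter_upwards [hD, eventually_pos_le_one, hR.size.eventually_ge_atTop 1] with γ hDp hγ hs
    have hγ0 := hγ.1
    obtain ⟨hm0, hT0⟩ := pos_of_one_le_size hs
    obtain ⟨h4, h4le, -, -⟩ := hM _ _ _ γ hγ.1 hγ.2 hDp
    have e : ∀ ω, (κ * fullMartingale (m γ) (T γ) V (D γ) h β (offset γ) w ω /
        √(γ * m γ * T γ)) ^ 4 = κ ^ 4 / (γ * m γ * T γ) ^ 2 *
          fullMartingale (m γ) (T γ) V (D γ) h β (offset γ) w ω ^ 4 := fun ω => by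
      have : √(γ * m γ * T γ) ^ 4 = (γ * m γ * T γ) ^ 2 := by
        rw [show 4 = 2 * 2 by rfl, pow_mul, Real.sq_sqrt (by linarith)]
      rw [div_pow, this]
      ring
    simp only [e]
    refine ⟨((measurable_fullMartingale hV hh.continuous hDp.measurable hwm).const_mul κ).div_const _,
      h4.const_mul _, ?_⟩
    rw [integral_const_mul]
    calc κ ^ 4 / (γ * m γ * T γ) ^ 2 *
          ∫ ω, fullMartingale (m γ) (T γ) V (D γ) h β (offset γ) w ω ^ 4 ∂μ
        ≤ κ ^ 4 / (γ * m γ * T γ) ^ 2 * (A * (4 * (γ * m γ * T γ) ^ 2)) := by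
          refine mul_le_mul_of_nonneg_left (h4le.trans (mul_le_mul_of_nonneg_left ?_ hA))
            (by positivity)
          nlinarith
      _ = κ ^ 4 * (A * 4) := by
          have : γ * m γ * T γ ≠ 0 := by linarith
          field_simp
  · set G := gaussExp (fun z => w z ^ 2 * Real.exp (β * z)) with hG
    rw [tendsto_iff_norm_sub_tendsto_zero]
    have hz : Tendsto (fun γ => κ ^ 2 * (A * (γ + √(γ * T γ)))) (𝓝[>] 0) (𝓝 0) := by
      have h := ((tendsto_id_nhdsGT.add hR.sqrt_exit).const_mul A).const_mul (κ ^ 2)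
      simpa using h
    refine squeeze_zero' (Eventually.of_forall fun _ => norm_nonneg _) ?_ hz
    filter_upwards [hD, eventually_pos_le_one, hR.size.eventually_ge_atTop 1] with γ hDp hγ hs
    have hγ0 := hγ.1
    obtain ⟨hm0, hT0⟩ := pos_of_one_le_size hs
    obtain ⟨-, -, -, h2⟩ := hM _ _ _ γ hγ.1 hγ.2 hDp
    have hs0 : 0 < γ * m γ * T γ := by linarith
    have e : ∀ ω, (κ * fullMartingale (m γ) (T γ) V (D γ) h β (offset γ) w ω /
        √(γ * m γ * T γ)) ^ 2 = κ ^ 2 / (γ * m γ * T γ) *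
          fullMartingale (m γ) (T γ) V (D γ) h β (offset γ) w ω ^ 2 := fun ω => by
      rw [div_pow, Real.sq_sqrt hs0.le]
      ring
    simp only [e]
    rw [integral_const_mul]
    set I := ∫ ω, fullMartingale (m γ) (T γ) V (D γ) h β (offset γ) w ω ^ 2 ∂μ
    have e2 : κ ^ 2 / (γ * m γ * T γ) * I - κ ^ 2 * G =
        κ ^ 2 / (γ * m γ * T γ) * (I - γ * m γ * T γ * G) := by
      field_simp
    rw [e2, Real.norm_eq_abs, abs_mul, abs_of_nonneg (by positivity)]
    refine (mul_le_mul_of_nonneg_left h2 (by positivity)).trans (le_of_eq ?_)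
    field_simp

lemma integrable_defaultSum (hV : IsCovariateProcess μ V K ρ) {m T : ℕ} {D : ℕ → ℕ → Ω → ℝ}
    {a : ℝ} (hDp : IsDefaultProcess μ V D h β a m T) {g : ℝ → ℝ} (hg : ExpBdd g)
    (hgm : Measurable g) : Integrable (defaultSum m T V D g) μ :=
  integrable_sum_sum (f := fun i t ω => g (V i t ω) * D i (t + 1) ω) fun _ _ _ _ =>
    integrable_comp_mul hV hg hgm (hDp.measurable _ _) (abs_default_le hDp.zero_or_one _ _)

/-- Law of large numbers for the covariates of the defaulting firms. -/
lemma whp_defaultSum (hV : IsCovariateProcess μ V K ρ) (hρ : ρ ∈ Set.Ioo (0 : ℝ) 1)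
    (hh : IsCorrection h β C) (hR : Regime m T)
    (hD : ∀ᶠ γ in 𝓝[>] (0 : ℝ), IsDefaultProcess μ V (D γ) h β (offset γ) (m γ) (T γ))
    {g : ℝ → ℝ} (hg : SmoothExp g) {ε : ℝ} (hε : 0 < ε) :
    Whp μ (fun γ ω => |defaultSum (m γ) (T γ) V (D γ) g ω / (γ * m γ * T γ) -
      gaussExp (fun z => g z * Real.exp (β * z))| ≤ ε) := by
  obtain ⟨A, hA, hL⟩ := exists_lln_default hV hρ hh hg
  refine Whp.of_tendsto_integral_abs ?_ ?_ hε
  · filter_upwards [hD] with γ hDp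
    exact ((integrable_defaultSum hV hDp hg.bdd hg.measurable).div_const _).sub (integrable_const _)
  -- Dividing the mean deviation in `exists_lln_default` by `γ m T` leaves exactly this rate.
  · have hz : Tendsto (fun γ => A * (√(1 / (γ * m γ * T γ)) +
        (γ + (√(1 / T γ) + √(γ * T γ))))) (𝓝[>] 0) (𝓝 0) := by
      have h := (hR.size_inv.sqrt.add (tendsto_id_nhdsGT.add hR.lln_rate)).const_mul A
      simpa using h
    refine squeeze_zero' (Eventually.of_forall fun _ => integral_nonneg fun _ => abs_nonneg _) ?_ hz
    filter_upwards [hD, eventually_pos_le_one, hR.size.eventually_ge_atTop 1] with γ hDp hγ hs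
    have hγ0 := hγ.1
    obtain ⟨hm0, hT0⟩ := pos_of_one_le_size hs
    have h1 := hL _ _ _ γ hγ.1 hγ.2 hDp
    have hs0 : 0 < γ * m γ * T γ := by linarith
    have e : ∀ ω, |defaultSum (m γ) (T γ) V (D γ) g ω / (γ * m γ * T γ) -
      gaussExp (fun z => g z * Real.exp (β * z))| = 1 / (γ * m γ * T γ) *
      |∑ t ∈ Finset.range (T γ), ∑ i ∈ Finset.range (m γ),
        (g (V i t ω) * D γ i (t + 1) ω - γ * gaussExp (fun z => g z * Real.exp (β * z)))| := by
      intro ω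
      rw [← abs_of_nonneg (show 0 ≤ 1 / (γ * m γ * T γ) by positivity), ← abs_mul]
      congr 1
      simp only [Finset.sum_sub_distrib, Finset.sum_const, Finset.card_range, nsmul_eq_mul]
      rw [defaultSum]
      field_simp
    simp only [e]
    rw [integral_const_mul]
    refine (mul_le_mul_of_nonneg_left h1 (by positivity)).trans (le_of_eq ?_)
    have h3 : 1 / (γ * m γ * T γ) * √(γ * m γ * T γ) = √(1 / (γ * m γ * T γ)) := by
      rw [one_div_mul_eq_div, Real.sqrt_div_self', Real.sqrt_div zero_le_one, Real.sqrt_one]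
    rw [← h3]
    generalize √(γ * m γ * T γ) = r
    field_simp

/-- Law of large numbers for the covariates of the surviving firms. -/
lemma whp_aliveSum (hV : IsCovariateProcess μ V K ρ) (hρ : ρ ∈ Set.Ioo (0 : ℝ) 1)
    (hh : IsCorrection h β C) (hR : Regime m T)
    (hD : ∀ᶠ γ in 𝓝[>] (0 : ℝ), IsDefaultProcess μ V (D γ) h β (offset γ) (m γ) (T γ))
    {g : ℝ → ℝ} (hg : SmoothExp g) {ε : ℝ} (hε : 0 < ε) :
    Whp μ (fun γ ω => |(∑ t ∈ Finset.range (T γ), ∑ i ∈ Finset.range (m γ),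
      g (V i t ω) * alive (T γ) (D γ) i t ω) / (m γ * T γ) - gaussExp g| ≤ ε) := by
  obtain ⟨A, hA, hL⟩ := exists_lln_alive hV hρ hh hg
  refine Whp.of_tendsto_integral_abs ?_ ?_ hε
  · filter_upwards [hD] with γ hDp
    exact ((integrable_sum_sum (f := fun i t ω => g (V i t ω) * alive (T γ) (D γ) i t ω)
      fun i _ t ht => integrable_comp_mul hV hg.bdd hg.measurable
        (measurable_alive hV hDp.measurable ht) (abs_alive_le _ _ _ _)).div_const _).sub
      (integrable_const _)
  · have hz : Tendsto (fun γ => A * (√(1 / T γ) + √(γ * T γ))) (𝓝[>] 0) (𝓝 0) := by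
      have h := hR.lln_rate.const_mul A
      simpa using h
    refine squeeze_zero' (Eventually.of_forall fun _ => integral_nonneg fun _ => abs_nonneg _) ?_ hz
    filter_upwards [hD, eventually_pos_le_one, hR.size.eventually_ge_atTop 1] with γ hDp hγ hs
    have hγ0 := hγ.1
    obtain ⟨hm0, hT0⟩ := pos_of_one_le_size hs
    have h1 := hL _ _ _ γ hγ.1 hγ.2 hDp
    have hs0 : 0 < (m γ * T γ : ℝ) := by positivity
    have e : ∀ ω, |(∑ t ∈ Finset.range (T γ), ∑ i ∈ Finset.range (m γ),
      g (V i t ω) * alive (T γ) (D γ) i t ω) / (m γ * T γ) - gaussExp g| = 1 / (m γ * T γ) *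
      |∑ t ∈ Finset.range (T γ), ∑ i ∈ Finset.range (m γ),
        (g (V i t ω) * alive (T γ) (D γ) i t ω - gaussExp g)| := by
      intro ω
      rw [← abs_of_nonneg (show 0 ≤ 1 / (m γ * T γ : ℝ) by positivity), ← abs_mul]
      congr 1
      simp only [Finset.sum_sub_distrib, Finset.sum_const, Finset.card_range, nsmul_eq_mul]
      rw [mul_sub, one_div_mul_eq_div, ← mul_assoc (T γ : ℝ), mul_comm (T γ : ℝ), ← mul_assoc,
        one_div_mul_cancel hs0.ne', one_mul]
    simp only [e]
    rw [integral_const_mul]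
    refine (mul_le_mul_of_nonneg_left h1 (by positivity)).trans (le_of_eq ?_)
    field_simp

/-- The normalised compensator vanishes in mean square. -/
lemma tendsto_compensator (hV : IsCovariateProcess μ V K ρ) (hρ : ρ ∈ Set.Ioo (0 : ℝ) 1)
    (hh : IsCorrection h β C) (hR : Regime m T)
    (hD : ∀ᶠ γ in 𝓝[>] (0 : ℝ), IsDefaultProcess μ V (D γ) h β (offset γ) (m γ) (T γ)) :
    (∀ᶠ γ in 𝓝[>] (0 : ℝ),
      Integrable (fun ω => compensator (m γ) (T γ) V (D γ) h β (offset γ) ω ^ 2) μ) ∧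
    Tendsto (fun γ => (∫ ω, compensator (m γ) (T γ) V (D γ) h β (offset γ) ω ^ 2 ∂μ) /
      (γ * m γ * T γ)) (𝓝[>] 0) (𝓝 0) := by
  obtain ⟨p, Λ, hp, hΛ, hrate⟩ := hR.margin
  obtain ⟨A, hA, hc⟩ := exists_compensator_sq_le hV hρ hh hp
  constructor
  · filter_upwards [hD, eventually_pos_le_one, hΛ, hR.one_le_T] with γ hDp hγ hΛ1 hT
    exact (hc _ _ _ γ (Λ γ) hγ.1 hγ.2 hT hΛ1 hDp).1
  · have hz : Tendsto (fun γ => A * (γ * (γ * (γ * m γ * T γ)) + γ * m γ +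
        (γ * m γ * T γ) * (Λ γ * γ + 1 / Λ γ ^ (p - 1)))) (𝓝[>] 0) (𝓝 0) := by
      have h := (((tendsto_id_nhdsGT.mul hR.rare).add hR.firms).add hrate).const_mul A
      simpa using h
    refine squeeze_zero' ?_ ?_ hz
    · filter_upwards [eventually_pos_le_one] with γ hγ
      have := hγ.1
      exact div_nonneg (integral_nonneg fun _ => sq_nonneg _) (by positivity)
    filter_upwards [hD, eventually_pos_le_one, hΛ, hR.one_le_T, hR.size.eventually_ge_atTop 1]
      with γ hDp hγ hΛ1 hT hs
    have := (hc _ _ _ γ (Λ γ) hγ.1 hγ.2 hT hΛ1 hDp).2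
    rw [div_le_iff₀ (by linarith)]
    linarith

end Asymptotics

/-! ### Mean squared error of the proposed estimator. -/

section ProposedEstimator

variable {Ω : Type*} {V : ℕ → ℕ → Ω → ℝ} {h : ℝ → ℝ} {β C K ρ : ℝ}
  [m0 : MeasurableSpace Ω] {μ : Measure Ω} [IsProbabilityMeasure μ]
  {m T : ℝ → ℕ} {D : ℝ → ℕ → ℕ → Ω → ℝ}

lemma measurable_proposedEstimator (hV : ∀ i t, Measurable (V i t)) {D : ℕ → ℕ → Ω → ℝ}
    (hD : ∀ i t, Measurable (D i t)) (m T : ℕ) (γ : ℝ) :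
    Measurable (proposedEstimator V D m T γ) := by
  refine Measurable.div ?_ ?_
  · exact (Finset.measurable_fun_sum _ fun t _ => Finset.measurable_fun_sum _ fun i _ =>
      (hV i t).mul (hD i (t + 1))).const_mul _
  · exact (Finset.measurable_fun_sum _ fun t _ => Finset.measurable_fun_sum _ fun i _ =>
      hD i (t + 1)).const_mul _

lemma measurable_defaultSum (hV : ∀ i t, Measurable (V i t)) {D : ℕ → ℕ → Ω → ℝ}
    (hD : ∀ i t, Measurable (D i t)) (m T : ℕ) {f : ℝ → ℝ} (hf : Measurable f) :
    Measurable (defaultSum m T V D f) :=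
  Finset.measurable_fun_sum _ fun t _ => Finset.measurable_fun_sum _ fun i _ =>
    (hf.comp (hV i t)).mul (hD i (t + 1))

/-- The weight that bounds the error of the estimator when it is large. -/
noncomputable def tailWeight (β v : ℝ) : ℝ := (v - β) ^ 2 * Real.exp (4 * |v - β|)

lemma expBdd_tailWeight (β : ℝ) : ExpBdd (tailWeight β) := by
  refine ExpBdd.mul (f := fun v => (v - β) ^ 2) (g := fun v => Real.exp (4 * |v - β|))
    ((ExpBdd.id.sub (ExpBdd.const β)).pow 2) ?_
  refine ⟨Real.exp (4 * |β|), 4, (Real.exp_pos _).le, by norm_num, fun v => ?_⟩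
  rw [abs_of_pos (Real.exp_pos _), ← Real.exp_add]
  exact Real.exp_le_exp.2 (by linarith [abs_sub v β])

lemma measurable_tailWeight (β : ℝ) : Measurable (tailWeight β) := by
  unfold tailWeight
  fun_prop

lemma integrable_sum_sum_comp (hV : IsCovariateProcess μ V K ρ) {f : ℝ → ℝ} (hf : ExpBdd f)
    (hfm : Measurable f) (m T : ℕ) :
    Integrable (fun ω => ∑ t ∈ Finset.range T, ∑ i ∈ Finset.range m, f (V i t ω)) μ :=
  integrable_sum_sum (f := fun i t ω => f (V i t ω)) fun i _ t _ => hV.integrable_comp hf hfm i t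

lemma integral_sum_sum_comp (hV : IsCovariateProcess μ V K ρ) {f : ℝ → ℝ} (hf : ExpBdd f)
    (hfm : Measurable f) (m T : ℕ) :
    ∫ ω, ∑ t ∈ Finset.range T, ∑ i ∈ Finset.range m, f (V i t ω) ∂μ = m * T * gaussExp f := by
  rw [integral_sum_sum (f := fun i t ω => f (V i t ω)) fun i _ t _ => hV.integrable_comp hf hfm i t]
  simp only [hV.integral_comp hfm, Finset.sum_const, Finset.card_range, nsmul_eq_mul]
  rw [gaussExp]
  ring

lemma integrable_proposedEstimator_sub_sq (hV : IsCovariateProcess μ V K ρ) {D : ℕ → ℕ → Ω → ℝ}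
    {m T : ℕ} {a γ : ℝ} (hDp : IsDefaultProcess μ V D h β a m T) (hs : γ * m * T ≠ 0) :
    Integrable (fun ω => (proposedEstimator V D m T γ ω - β) ^ 2) μ := by
  refine ((integrable_const (β ^ 2 + 0 ^ 2)).add ((integrable_sum_sum_comp hV
    (expBdd_tailWeight β) (measurable_tailWeight β) m T).const_mul (Real.exp (-4 * 0)))).mono'
    (((measurable_proposedEstimator hV.measurable hDp.measurable m T γ).sub_const β).pow_const
      2).aestronglyMeasurable (ae_of_all _ fun ω => ?_)
  rw [Real.norm_of_nonneg (sq_nonneg _)]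
  exact proposedEstimator_sub_sq_le hDp.zero_or_one hs 0 ω

/-- Upper bound for the squared normalised error that is not controlled by the martingale. -/
noncomputable def errorTail (m T : ℕ) (V D : ℕ → ℕ → Ω → ℝ) (h : ℝ → ℝ) (β γ : ℝ) (ω : Ω) : ℝ :=
  8 / Real.exp (β ^ 2 / 2) ^ 2 / (γ * m * T) * compensator m T V D h β (offset γ) ω ^ 2 +
    ({ω | ¬ Real.exp (β ^ 2 / 2) / 2 * (γ * m * T) < defaultSum m T V D (fun _ => 1) ω}.indicator
      (fun _ => γ * m * T * (β ^ 2 + offset γ ^ 2)) ω +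
    γ * m * T * γ ^ 4 * ∑ t ∈ Finset.range T, ∑ i ∈ Finset.range m, tailWeight β (V i t ω))

/-- With more than half of the expected defaults, the denominator of the error is at least `c γ m T
/ 2` and `(M + Y)² ≤ 2 M² + 2 Y²`, whence the factor 8. Otherwise the crude bound
`proposedEstimator_sub_sq_le` with `L = log (1/γ)` applies. -/
lemma normalised_error_sq_le {D : ℕ → ℕ → Ω → ℝ} (hD : ∀ i t ω, D i t ω = 0 ∨ D i t ω = 1)
    {m T : ℕ} {γ : ℝ} (hγ : 0 < γ) (hs : 0 < γ * m * T) (ω : Ω) :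
    (√(γ * m * T) * (proposedEstimator V D m T γ ω - β)) ^ 2 ≤
      8 * ((Real.exp (β ^ 2 / 2))⁻¹ * fullMartingale m T V D h β (offset γ) (fun v => v - β) ω /
        √(γ * m * T)) ^ 2 + errorTail m T V D h β γ ω := by
  set c := Real.exp (β ^ 2 / 2) with hc
  have hc0 : 0 < c := Real.exp_pos _
  set M := fullMartingale m T V D h β (offset γ) (fun v => v - β) ω
  set N := defaultSum m T V D (fun _ => 1) ω with hN
  have hS0 : 0 ≤ ∑ t ∈ Finset.range T, ∑ i ∈ Finset.range m, tailWeight β (V i t ω) :=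
    Finset.sum_nonneg fun _ _ => Finset.sum_nonneg fun _ _ => by unfold tailWeight; positivity
  rw [mul_pow, Real.sq_sqrt hs.le, div_pow, Real.sq_sqrt hs.le, errorTail, ← hc]
  by_cases hG : c / 2 * (γ * m * T) < N
  · have hNpos : 0 < N := lt_trans (by positivity) hG
    rw [Set.indicator_of_notMem (by simpa using hG), proposedEstimator_sub hs.ne' hNpos.ne',
      defaultSum_eq (h := h) (β := β) _ (offset γ)]
    change γ * m * T * ((M + compensator m T V D h β (offset γ) ω) / N) ^ 2 ≤ _
    set Y := compensator m T V D h β (offset γ) ω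
    have h0 : 0 ≤ γ * m * T * γ ^ 4 *
      ∑ t ∈ Finset.range T, ∑ i ∈ Finset.range m, tailWeight β (V i t ω) := by positivity
    generalize γ * m * T = s at *
    have h1 : (c / 2 * s) ^ 2 ≤ N ^ 2 := by gcongr
    have h2 : s * ((M + Y) / N) ^ 2 ≤ s * (2 * (M ^ 2 + Y ^ 2) / (c / 2 * s) ^ 2) := by
      rw [div_pow]
      refine mul_le_mul_of_nonneg_left ?_ hs.le
      exact div_le_div₀ (by positivity) (by nlinarith [sq_nonneg (M - Y)]) (by positivity) h1
    have h3 : s * (2 * (M ^ 2 + Y ^ 2) / (c / 2 * s) ^ 2) =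
        8 * ((c⁻¹ * M) ^ 2 / s) + 8 / c ^ 2 / s * Y ^ 2 := by
      field_simp
      ring
    linarith
  · rw [Set.indicator_of_mem (by simpa using hG)]
    have h1 := proposedEstimator_sub_sq_le (β := β) (V := V) hD hs.ne' (offset γ) ω
    have h2 : Real.exp (-4 * offset γ) = γ ^ 4 := by
      rw [offset, one_div, Real.log_inv, show -4 * -Real.log γ = (4 : ℕ) * Real.log γ by
        push_cast; ring, Real.exp_nat_mul, Real.exp_log hγ]
    rw [h2] at h1
    have h3 := mul_le_mul_of_nonneg_left h1 hs.le
    have h4 : 0 ≤ 8 * ((c⁻¹ * M) ^ 2 / (γ * m * T)) := by positivity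
    have h5 : 0 ≤ 8 / c ^ 2 / (γ * m * T) * compensator m T V D h β (offset γ) ω ^ 2 := by positivity
    simp only [tailWeight] at h4 h5 ⊢
    linarith

lemma integral_errorTail {D : ℕ → ℕ → Ω → ℝ} (hV : IsCovariateProcess μ V K ρ)
    {m T : ℕ} {γ : ℝ} (hD : ∀ i t, Measurable (D i t))
    (hc : Integrable (fun ω => compensator m T V D h β (offset γ) ω ^ 2) μ) :
    Integrable (errorTail m T V D h β γ) μ ∧
    ∫ ω, errorTail m T V D h β γ ω ∂μ = 8 / Real.exp (β ^ 2 / 2) ^ 2 *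
      ((∫ ω, compensator m T V D h β (offset γ) ω ^ 2 ∂μ) / (γ * m * T)) +
    (γ * m * T * (β ^ 2 + offset γ ^ 2) * μ.real {ω | ¬ Real.exp (β ^ 2 / 2) / 2 * (γ * m * T) <
      defaultSum m T V D (fun _ => 1) ω} +
    γ * (γ * (γ * m * T)) ^ 2 * gaussExp (tailWeight β)) := by
  have hms : MeasurableSet {ω | ¬ Real.exp (β ^ 2 / 2) / 2 * (γ * m * T) <
      defaultSum m T V D (fun _ => 1) ω} :=
    (measurableSet_lt measurable_const
      (measurable_defaultSum hV.measurable hD m T measurable_const)).compl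
  have i1 := hc.const_mul (8 / Real.exp (β ^ 2 / 2) ^ 2 / (γ * m * T))
  have i2 := (integrable_const (μ := μ) (γ * m * T * (β ^ 2 + offset γ ^ 2))).indicator hms
  have i3 := (integrable_sum_sum_comp hV (expBdd_tailWeight β) (measurable_tailWeight β) m T).const_mul
    (γ * m * T * γ ^ 4)
  have i4 : Integrable (fun ω => {ω | ¬ Real.exp (β ^ 2 / 2) / 2 * (γ * m * T) <
      defaultSum m T V D (fun _ => 1) ω}.indicator
      (fun _ => γ * m * T * (β ^ 2 + offset γ ^ 2)) ω +
    γ * m * T * γ ^ 4 * ∑ t ∈ Finset.range T, ∑ i ∈ Finset.range m, tailWeight β (V i t ω)) μ :=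
    i2.add i3
  refine ⟨i1.add i4, ?_⟩
  simp only [errorTail]
  rw [integral_add i1 i4, integral_add i2 i3, integral_const_mul, integral_const_mul,
    integral_indicator_const _ hms, integral_sum_sum_comp hV (expBdd_tailWeight β)
    (measurable_tailWeight β), smul_eq_mul]
  ring

/-- With `s = γ m T`, the event of few defaults costs `s (β² + log² (1/γ)) (1/T + 1/s²)`, that is,
`(β² + log² (1/γ)) (γ m + 1/s)`; the tail sum costs `s γ⁴ m T = γ (γ s)²`. Both vanish in the
regime, as does the normalised compensator. -/
lemma tendsto_integral_errorTail (hV : IsCovariateProcess μ V K ρ) (hρ : ρ ∈ Set.Ioo (0 : ℝ) 1)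
    (hh : IsCorrection h β C) (hR : Regime m T)
    (hD : ∀ᶠ γ in 𝓝[>] (0 : ℝ), IsDefaultProcess μ V (D γ) h β (offset γ) (m γ) (T γ)) :
    (∀ᶠ γ in 𝓝[>] (0 : ℝ), Integrable (errorTail (m γ) (T γ) V (D γ) h β γ) μ) ∧
    Tendsto (fun γ => ∫ ω, |errorTail (m γ) (T γ) V (D γ) h β γ ω| ∂μ) (𝓝[>] 0) (𝓝 0) := by
  obtain ⟨hci, hct⟩ := tendsto_compensator hV hρ hh hR hD
  obtain ⟨A, κ, hA, hκ, hfew⟩ := exists_few_defaults_le hV hρ hh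
  constructor
  · filter_upwards [hD, hci] with γ hDp hc
    exact (integral_errorTail hV hDp.measurable hc).1
  have hz1 : Tendsto (fun γ => A * (β ^ 2 * (γ * m γ + 1 / (γ * m γ * T γ)) +
      (γ * m γ * offset γ ^ 2 + offset γ ^ 2 / (γ * m γ * T γ)))) (𝓝[>] 0) (𝓝 0) := by
    have h := (((hR.firms.add hR.size_inv).const_mul (β ^ 2)).add
      (hR.firms_log.add hR.size_log)).const_mul A
    simpa using h
  have hz2 : Tendsto (fun γ => γ * (γ * (γ * m γ * T γ)) ^ 2 * gaussExp (tailWeight β))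
      (𝓝[>] 0) (𝓝 0) := by
    have h := (tendsto_id_nhdsGT.mul (hR.rare.pow 2)).mul_const (gaussExp (tailWeight β))
    simpa using h
  have hz := (hct.const_mul (8 / Real.exp (β ^ 2 / 2) ^ 2)).add (hz1.add hz2)
  rw [mul_zero, add_zero, add_zero] at hz
  refine squeeze_zero' (Eventually.of_forall fun _ => integral_nonneg fun _ => abs_nonneg _) ?_ hz
  have hκ1 : ∀ᶠ γ in 𝓝[>] (0 : ℝ), γ < κ := tendsto_id_nhdsGT.eventually (gt_mem_nhds hκ)
  filter_upwards [hD, eventually_pos_le_one, hR.size.eventually_ge_atTop 1, hci, hκ1,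
    hR.exit.eventually (gt_mem_nhds hκ)] with γ hDp hγ hs hc hγκ hTκ
  have hγ0 := hγ.1
  obtain ⟨hm0, hT0⟩ := pos_of_one_le_size hs
  have habs : ∀ ω, |errorTail (m γ) (T γ) V (D γ) h β γ ω| = errorTail (m γ) (T γ) V (D γ) h β γ ω := by
    intro ω
    refine abs_of_nonneg ?_
    have h1 : 0 ≤ ∑ t ∈ Finset.range (T γ), ∑ i ∈ Finset.range (m γ), tailWeight β (V i t ω) :=
      Finset.sum_nonneg fun _ _ => Finset.sum_nonneg fun _ _ => by unfold tailWeight; positivity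
    have h2 : 0 ≤ {ω | ¬ Real.exp (β ^ 2 / 2) / 2 * (γ * m γ * T γ) <
      defaultSum (m γ) (T γ) V (D γ) (fun _ => 1) ω}.indicator
      (fun _ => γ * m γ * T γ * (β ^ 2 + offset γ ^ 2)) ω :=
      Set.indicator_nonneg (fun _ _ => by positivity) _
    unfold errorTail
    positivity
  simp only [habs]
  rw [(integral_errorTail hV hDp.measurable hc).2]
  have hP := hfew _ _ _ γ hγ.1 hγ.2 hγκ.le hTκ.le hs hDp
  have h1 : γ * m γ * T γ * (β ^ 2 + offset γ ^ 2) *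
      μ.real {ω | ¬ Real.exp (β ^ 2 / 2) / 2 * (γ * m γ * T γ) <
      defaultSum (m γ) (T γ) V (D γ) (fun _ => 1) ω} ≤
      A * (β ^ 2 * (γ * m γ + 1 / (γ * m γ * T γ)) +
      (γ * m γ * offset γ ^ 2 + offset γ ^ 2 / (γ * m γ * T γ))) := by
    refine (mul_le_mul_of_nonneg_left hP (by positivity)).trans (le_of_eq ?_)
    field_simp
  linarith

/-- The mean squared error of the proposed estimator. -/
theorem tendsto_proposedEstimator (hV : IsCovariateProcess μ V K ρ) (hρ : ρ ∈ Set.Ioo (0 : ℝ) 1)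
    (hh : IsCorrection h β C) (hR : Regime m T)
    (hD : ∀ᶠ γ in 𝓝[>] (0 : ℝ), IsDefaultProcess μ V (D γ) h β (offset γ) (m γ) (T γ)) :
    Tendsto (fun γ => ∫ ω, (√(γ * m γ * T γ) *
      (proposedEstimator V (D γ) (m γ) (T γ) γ ω - β)) ^ 2 ∂μ)
      (𝓝[>] 0) (𝓝 (Real.exp (β ^ 2 / 2))⁻¹) := by
  set c := Real.exp (β ^ 2 / 2) with hc
  have hc0 : 0 < c := Real.exp_pos _
  have hsub : SmoothExp (fun v => v - β) := SmoothExp.id.sub_const β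
  -- The approximating family is `c⁻¹ M / √(γ m T)`; its second moment tends to `c⁻² c = c⁻¹`.
  obtain ⟨hWui, hWlim⟩ := normalised_martingale hV hh hR hD hsub.bdd hsub.measurable c⁻¹
  obtain ⟨hTi, hT0⟩ := tendsto_integral_errorTail hV hρ hh hR hD
  obtain ⟨hci, hct⟩ := tendsto_compensator hV hρ hh hR hD
  rw [gaussExp_sub_sq_mul_exp, ← hc, sq, mul_assoc, inv_mul_cancel₀ hc0.ne', mul_one] at hWlim
  refine tendsto_integral_sq_of_whp ?_ hWui ?_ hWlim
  · refine hWui.of_le (show (0 : ℝ) < 8 by norm_num) hTi hT0 ?_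
    filter_upwards [hD, eventually_pos_le_one, hR.size.eventually_ge_atTop 1] with γ hDp hγ hs
    refine ⟨(((measurable_proposedEstimator hV.measurable hDp.measurable _ _ γ).sub_const
      β).const_mul _ |>.pow_const 2).aestronglyMeasurable, fun ω => ?_⟩
    rw [abs_of_nonneg (sq_nonneg _), abs_of_nonneg (sq_nonneg _)]
    exact (normalised_error_sq_le hDp.zero_or_one hγ.1 (by linarith) ω).trans
      (add_le_add_right (le_abs_self _) _)
  · intro ε hε
    obtain ⟨A, hA, hM⟩ := exists_martingale_moments hV hh hsub.bdd hsub.measurable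
    have hN : ∀ η : ℝ, 0 < η → Whp μ (fun γ ω => |defaultSum (m γ) (T γ) V (D γ) (fun _ => 1) ω /
        (γ * m γ * T γ) - c| ≤ η) := by
      intro η hη
      have := whp_defaultSum hV hρ hh hR hD (SmoothExp.const 1) hη
      simpa only [one_mul, gaussExp_exp, ← hc] using this
    have hcomp : ∀ η : ℝ, 0 < η → Whp μ (fun γ ω =>
        |compensator (m γ) (T γ) V (D γ) h β (offset γ) ω ^ 2 / (γ * m γ * T γ)| ≤ η) := by
      intro η hη
      refine Whp.of_tendsto_integral_abs (hci.mono fun γ h => h.div_const _) ?_ hη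
      refine hct.congr' ?_
      filter_upwards [hR.size.eventually_ge_atTop 1] with γ hs
      rw [← integral_div]
      refine integral_congr_ae (ae_of_all _ fun ω => ?_)
      exact (abs_of_nonneg (div_nonneg (sq_nonneg _) (by linarith))).symm
    have hinv : ∀ η : ℝ, 0 < η → Whp μ (fun γ ω =>
        |(γ * m γ * T γ) / defaultSum (m γ) (T γ) V (D γ) (fun _ => 1) ω - c⁻¹| ≤ η) := by
      intro η hη
      -- The first bound keeps the normalised count `x` above `c / 2`; then `|1/x - 1/c| = |x - c| /
      -- (c x)` is at most `η` by the second.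
      refine (hN (min (c / 2) (η * (c ^ 2 / 2))) (by positivity)).mono ?_
      filter_upwards [hR.size.eventually_ge_atTop 1] with γ hs
      refine ae_of_all _ fun ω h1 => ?_
      set N := defaultSum (m γ) (T γ) V (D γ) (fun _ => 1) ω
      have h2 := h1.trans (min_le_left _ _)
      have h3 := h1.trans (min_le_right _ _)
      have hs0 : 0 < γ * m γ * T γ := by linarith
      generalize γ * m γ * T γ = s at *
      set x := N / s with hx
      have hxc : c / 2 ≤ x := by linarith [(abs_le.1 h2).1]
      have e : s / N - c⁻¹ = (c - x) * (1 / (c * x)) := by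
        have : s / N = x⁻¹ := by rw [hx, inv_div]
        have hx0 : x ≠ 0 := by linarith
        rw [this]
        field_simp
      have hx0 : 0 < x := by linarith
      rw [e, abs_mul, abs_sub_comm, abs_of_nonneg (show 0 ≤ 1 / (c * x) by positivity), mul_one_div,
        div_le_iff₀ (by positivity)]
      refine h3.trans (mul_le_mul_of_nonneg_left ?_ hη.le)
      nlinarith
    have hMb : ∀ᶠ γ in 𝓝[>] (0 : ℝ),
        Integrable (fun ω => fullMartingale (m γ) (T γ) V (D γ) h β (offset γ) (fun v => v - β) ω /
          √(γ * m γ * T γ)) μ ∧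
        ∫ ω, |fullMartingale (m γ) (T γ) V (D γ) h β (offset γ) (fun v => v - β) ω /
          √(γ * m γ * T γ)| ∂μ ≤ √A := by
      filter_upwards [hD, eventually_pos_le_one, hR.size.eventually_ge_atTop 1] with γ hDp hγ hs
      obtain ⟨h4, -, h2, -⟩ := hM _ _ _ γ hγ.1 hγ.2 hDp
      have hs0 : 0 < γ * m γ * T γ := by linarith
      have hm := measurable_fullMartingale (m := m γ) (T := T γ) (β := β) (a := offset γ) hV
        hh.continuous hDp.measurable hsub.measurable
      have h2i := BernoulliStep.integrable_sq hm h4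
      refine ⟨(((memLp_two_iff_integrable_sq hm.aestronglyMeasurable).2 h2i).integrable
        one_le_two).div_const _, ?_⟩
      refine (integral_abs_le_sqrt (hm.div_const _).aestronglyMeasurable ?_).trans
        (Real.sqrt_le_sqrt ?_)
      · simp only [div_pow]
        exact h2i.div_const _
      · simp only [div_pow]
        rw [integral_div, Real.sq_sqrt hs0.le, div_le_iff₀ hs0]
        exact h2
    have hprod := Whp.mul_small hMb hinv (half_pos hε)
    refine ((hprod.and (hN (c / 2) (half_pos hc0))).and
      (hcomp ((ε * c / 4) ^ 2) (by positivity))).mono ?_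
    filter_upwards [hR.size.eventually_ge_atTop 1] with γ hs
    refine ae_of_all _ fun ω ⟨⟨h1, h2⟩, h3⟩ => ?_
    have hs0 : 0 < γ * m γ * T γ := by linarith
    have hNx : c / 2 * (γ * m γ * T γ) ≤ defaultSum (m γ) (T γ) V (D γ) (fun _ => 1) ω := by
      rw [← le_div_iff₀ hs0]
      linarith [(abs_le.1 h2).1]
    have hN0 : 0 < defaultSum (m γ) (T γ) V (D γ) (fun _ => 1) ω := lt_of_lt_of_le (by positivity) hNx
    rw [proposedEstimator_sub hs0.ne' hN0.ne', defaultSum_eq (h := h) (β := β) _ (offset γ)]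
    set M := fullMartingale (m γ) (T γ) V (D γ) h β (offset γ) (fun v => v - β) ω
    change |√(γ * m γ * T γ) * ((M + compensator (m γ) (T γ) V (D γ) h β (offset γ) ω) / _) - _| ≤ _
    set Y := compensator (m γ) (T γ) V (D γ) h β (offset γ) ω
    set N := defaultSum (m γ) (T γ) V (D γ) (fun _ => 1) ω
    generalize γ * m γ * T γ = s at *
    have hr : √s ^ 2 = s := Real.sq_sqrt hs0.le
    have hr0 : 0 < √s := Real.sqrt_pos.2 hs0
    -- The first product is a family bounded in mean times one tending to zero in probability. In
    -- the second the compensator vanishes after normalisation while `s / N` stays bounded.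
    have e : √s * ((M + Y) / N) - c⁻¹ * M / √s = M / √s * (s / N - c⁻¹) + Y / √s * (s / N) := by
      have key : ∀ r : ℝ, r ≠ 0 → r * ((M + Y) / N) - c⁻¹ * M / r =
          M / r * (r ^ 2 / N - c⁻¹) + Y / r * (r ^ 2 / N) := by
        intro r hr
        field_simp
        ring
      have := key (√s) hr0.ne'
      rwa [hr] at this
    have hY : |Y / √s| ≤ ε * c / 4 := by
      refine abs_le_of_sq_le_sq ?_ (by positivity)
      rw [div_pow, hr]
      exact (le_abs_self _).trans h3
    have hsN : s / N ≤ 2 / c := by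
      rw [div_le_div_iff₀ hN0 hc0]
      linarith
    rw [e]
    refine (abs_add_le _ _).trans ?_
    have h5 : |Y / √s * (s / N)| ≤ ε / 2 := by
      rw [abs_mul, abs_of_pos (div_pos hs0 hN0)]
      calc |Y / √s| * (s / N) ≤ ε * c / 4 * (2 / c) :=
            mul_le_mul hY hsN (by positivity) (by positivity)
        _ = ε / 2 := by field_simp; norm_num
    linarith

end ProposedEstimator

/-! ### Bounds for the link function. -/

section Link

variable {h : ℝ → ℝ} {β C : ℝ}

namespace IsCorrection

/-- For `y ≤ 0` the correction is at most `C`; for `y ≥ 0` the bound `q ≤ 1 ≤ e^y` is enough. -/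
lemma link_le (hh : IsCorrection h β C) (y : ℝ) : link h y ≤ (1 + C) * Real.exp y := by
  have hC := hh.nonneg
  rcases le_total y 0 with hy | hy
  · have h1 := (abs_le.1 (hh.bound y)).2
    have h2 : Real.exp y ≤ 1 := Real.exp_le_one_iff.2 hy
    have h3 : 1 + h y ≤ 1 + C := by nlinarith
    rw [link, mul_comm]
    exact mul_le_mul_of_nonneg_right h3 (Real.exp_pos y).le
  · have h1 := Real.one_le_exp hy
    have h2 := (hh.prob y).2
    nlinarith

lemma half_exp_le_link (hh : IsCorrection h β C) {y : ℝ} (hy : Real.exp y ≤ 1 / (2 * (C + 1))) :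
    Real.exp y / 2 ≤ link h y := by
  have hC := hh.nonneg
  rw [le_div_iff₀ (by positivity)] at hy
  have h1 := (abs_le.1 (hh.bound y)).1
  have h2 := Real.exp_pos y
  have h3 : 1 / 2 ≤ 1 + h y := by nlinarith
  rw [link]
  nlinarith

/-- Logarithms of the default and survival probabilities. -/
lemma log_link (hh : IsCorrection h β C) {y : ℝ} (hy : Real.exp y ≤ 1 / (4 * (C + 1))) :
    0 < link h y ∧ 0 < 1 - link h y ∧ |Real.log (link h y) - y| ≤ 2 * C * Real.exp y ∧
      |Real.log (1 - link h y) + Real.exp y| ≤ (C + 4) * Real.exp y ^ 2 := by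
  have hC := hh.nonneg
  have hy2 : Real.exp y ≤ 1 / (2 * (C + 1)) := hy.trans (by gcongr; norm_num)
  rw [le_div_iff₀ (by positivity)] at hy
  have h1 := abs_le.1 (hh.bound y)
  have hE := Real.exp_pos y
  set E := Real.exp y
  -- The threshold yields `|h| ≤ 1/4` and `q ≤ 5/16`, a range where the elementary bounds for the
  -- logarithm give the stated constants.
  have hCE : C * E ≤ 1 / 4 := by nlinarith
  have hE4 : E ≤ 1 / 4 := by nlinarith
  have hq : link h y = E * (1 + h y) := rfl
  have hpos : 0 < 1 + h y := by linarith
  have hq0 : 0 < link h y := by rw [hq]; positivity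
  have hqle : link h y ≤ 5 / 4 * E := by rw [hq]; nlinarith
  have hq1 : link h y ≤ 5 / 16 := by linarith
  have h1q : 0 < 1 - link h y := by linarith
  have hqE : |link h y - E| ≤ C * E ^ 2 := hh.abs_link_sub_le y
  refine ⟨hq0, h1q, ?_, ?_⟩
  · rw [hq, Real.log_mul hE.ne' hpos.ne', Real.log_exp, add_sub_cancel_left, abs_le]
    have l1 := Real.one_sub_inv_le_log_of_pos hpos
    have l2 := Real.log_le_sub_one_of_pos hpos
    have l3 : (1 + h y)⁻¹ ≤ 1 + 2 * C * E := by
      rw [inv_le_iff_one_le_mul₀ hpos]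
      have : 0 ≤ C * E := by positivity
      nlinarith
    have : 0 ≤ C * E := by positivity
    constructor <;> nlinarith
  · have l1 := Real.one_sub_inv_le_log_of_pos h1q
    have l2 := Real.log_le_sub_one_of_pos h1q
    have l3 : (1 - link h y)⁻¹ ≤ 1 + link h y + 2 * link h y ^ 2 := by
      rw [inv_le_iff_one_le_mul₀ h1q]
      nlinarith [sq_nonneg (link h y), mul_nonneg hq0.le (sq_nonneg (link h y))]
    have l4 : link h y ^ 2 ≤ 25 / 16 * E ^ 2 := by nlinarith
    rw [abs_le] at hqE ⊢
    constructor <;> nlinarith [sq_nonneg E]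

end IsCorrection

end Link

/-! ### The likelihood of a fixed sample. -/

section SampleLikelihood

variable {ι : Type*} [DecidableEq ι] {h : ℝ → ℝ} {β C a b : ℝ} {A B : Finset ι} {v : ι → ℝ}

/-- The likelihood of `b` for observations `v` over the set `A`, of which those in `B` default. -/
noncomputable def sampleLikelihood (h : ℝ → ℝ) (A B : Finset ι) (v : ι → ℝ) (a b : ℝ) : ℝ :=
  (∏ k ∈ A \ B, (1 - link h (b * v k - a))) * ∏ k ∈ B, link h (b * v k - a)

lemma exp_mul_sub (b x a : ℝ) : Real.exp (b * x - a) = Real.exp (-a) * Real.exp (b * x) := by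
  rw [← Real.exp_add]
  congr 1
  ring

/-- Upper bound from the defaults with a covariate of the wrong sign. -/
lemma sampleLikelihood_le_of_subset (hh : IsCorrection h β C) (ha : 0 ≤ a) {B' : Finset ι}
    (hB' : B' ⊆ B) (hv : ∀ k ∈ B', b * v k ≤ -|b|) :
    sampleLikelihood h A B v a b ≤ Real.exp (B'.card * (Real.log (1 + C) - |b|)) := by
  have hC := hh.nonneg
  have h1 : ∏ k ∈ A \ B, (1 - link h (b * v k - a)) ≤ 1 :=
    Finset.prod_le_one (fun k _ => sub_nonneg.2 (hh.prob _).2)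
      (fun k _ => sub_le_self _ (hh.prob _).1)
  have h2 : ∏ k ∈ B, link h (b * v k - a) ≤ ∏ k ∈ B', link h (b * v k - a) := by
    rw [← Finset.prod_sdiff hB']
    exact mul_le_of_le_one_left (Finset.prod_nonneg fun k _ => (hh.prob _).1)
      (Finset.prod_le_one (fun k _ => (hh.prob _).1) (fun k _ => (hh.prob _).2))
  have h3 : ∏ k ∈ B', link h (b * v k - a) ≤ ∏ k ∈ B', Real.exp (Real.log (1 + C) - |b|) := by
    refine Finset.prod_le_prod (fun k _ => (hh.prob _).1) fun k hk => (hh.link_le _).trans ?_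
    rw [sub_eq_add_neg (Real.log _), Real.exp_add, Real.exp_log (by positivity)]
    refine mul_le_mul_of_nonneg_left (Real.exp_le_exp.2 ?_) (by positivity)
    linarith [hv k hk]
  rw [Finset.prod_const, ← Real.exp_nat_mul] at h3
  rw [sampleLikelihood]
  exact (mul_le_of_le_one_left (Finset.prod_nonneg fun k _ => (hh.prob _).1) h1).trans (h2.trans h3)

/-- Upper bound from the survivals with a covariate of the wrong sign. -/
lemma sampleLikelihood_le_of_survivors (hh : IsCorrection h β C)
    (ha : Real.exp (-(a / 2)) ≤ 1 / (2 * (C + 1))) {A' : Finset ι} (hA' : A' ⊆ A \ B) {v₀ : ℝ}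
    (hv : ∀ k ∈ A', v₀ * |b| ≤ b * v k ∧ b * v k ≤ a / 2) :
    sampleLikelihood h A B v a b ≤ Real.exp (B.card * (Real.log (1 + C) - a) +
      |b| * ∑ k ∈ B, |v k| - Real.exp (-a) * A'.card * (Real.exp (v₀ * |b|) / 2)) := by
  have hC := hh.nonneg
  have h1 : ∏ k ∈ A \ B, (1 - link h (b * v k - a)) ≤
      ∏ k ∈ A', Real.exp (-(Real.exp (-a) * (Real.exp (v₀ * |b|) / 2))) := by
    rw [← Finset.prod_sdiff hA']
    refine (mul_le_of_le_one_left (Finset.prod_nonneg fun k _ => sub_nonneg.2 (hh.prob _).2)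
      (Finset.prod_le_one (fun k _ => sub_nonneg.2 (hh.prob _).2)
        (fun k _ => sub_le_self _ (hh.prob _).1))).trans ?_
    refine Finset.prod_le_prod (fun k _ => sub_nonneg.2 (hh.prob _).2) fun k hk => ?_
    have h2 := (hv k hk).2
    have h3 : Real.exp (b * v k - a) / 2 ≤ link h (b * v k - a) :=
      hh.half_exp_le_link ((Real.exp_le_exp.2 (by linarith)).trans ha)
    have h4 : Real.exp (-a) * (Real.exp (v₀ * |b|) / 2) ≤ link h (b * v k - a) := by
      refine le_trans ?_ h3
      rw [exp_mul_sub, mul_div_assoc]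
      have := Real.exp_le_exp.2 (hv k hk).1
      gcongr
    refine le_trans ?_ (Real.one_sub_le_exp_neg _)
    linarith
  have h5 : ∏ k ∈ B, link h (b * v k - a) ≤
      ∏ k ∈ B, Real.exp ((Real.log (1 + C) - a) + |b| * |v k|) := by
    refine Finset.prod_le_prod (fun k _ => (hh.prob _).1) fun k _ => (hh.link_le _).trans ?_
    rw [show Real.log (1 + C) - a + |b| * |v k| = Real.log (1 + C) + (|b| * |v k| - a) by ring,
      Real.exp_add, Real.exp_log (by positivity)]
    refine mul_le_mul_of_nonneg_left (Real.exp_le_exp.2 ?_) (by positivity)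
    rw [← abs_mul]
    linarith [le_abs_self (b * v k)]
  rw [Finset.prod_const, ← Real.exp_nat_mul] at h1
  rw [← Real.exp_sum, Finset.sum_add_distrib, Finset.sum_const, nsmul_eq_mul, ← Finset.mul_sum] at h5
  rw [sampleLikelihood]
  refine (mul_le_mul h1 h5 (Finset.prod_nonneg fun k _ => (hh.prob _).1)
    (Real.exp_pos _).le).trans (le_of_eq ?_)
  rw [← Real.exp_add]
  congr 1
  ring

/-- The leading order of the logarithm of the likelihood, without its constant term. -/
noncomputable def logLik (A B : Finset ι) (v : ι → ℝ) (γ b : ℝ) : ℝ :=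
  b * ∑ k ∈ B, v k - γ * ∑ k ∈ A, Real.exp (b * v k)

/-- For `|b| ≤ b₀` every `γ e^{bv}` is at most `η`, so `log_link` applies to each factor: defaults
contribute `b v - a` and survivors `-γ e^{bv}`. Extending the exponential sum from survivors to all
of `A` costs at most `η`. The total `(C + 4) η² + 2 C η + η` is within the bound as `η ≤ 1`. -/
lemma abs_log_sampleLikelihood_sub_le (hh : IsCorrection h β C) (hBA : B ⊆ A) {b₀ η γ : ℝ}
    (hγ : γ = Real.exp (-a)) (hη : 0 ≤ η) (hηC : η ≤ 1 / (4 * (C + 1)))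
    (h2 : γ ^ 2 * ∑ k ∈ A, Real.exp (b₀ * |v k|) ^ 2 ≤ η ^ 2)
    (h1 : γ * ∑ k ∈ B, Real.exp (b₀ * |v k|) ≤ η) (hb : |b| ≤ b₀) :
    0 < sampleLikelihood h A B v a b ∧
    |Real.log (sampleLikelihood h A B v a b) - (logLik A B v γ b - a * B.card)| ≤
      (3 * C + 5) * η := by
  have hC := hh.nonneg
  have hγ0 : 0 < γ := hγ ▸ Real.exp_pos _
  have hE : ∀ k, Real.exp (b * v k - a) = γ * Real.exp (b * v k) := fun k => by
    rw [exp_mul_sub, hγ]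
  have hEle : ∀ k, Real.exp (b * v k) ≤ Real.exp (b₀ * |v k|) := fun k => by
    refine Real.exp_le_exp.2 ((le_abs_self _).trans ?_)
    rw [abs_mul]
    gcongr
  -- A single summand is bounded by the whole sum of squares in `h2`.
  have hsmall : ∀ k ∈ A, Real.exp (b * v k - a) ≤ 1 / (4 * (C + 1)) := by
    intro k hk
    refine le_trans ?_ hηC
    refine abs_le_of_sq_le_sq' (le_trans ?_ h2) hη |>.2
    rw [hE, mul_pow]
    refine mul_le_mul_of_nonneg_left ?_ (by positivity)
    refine le_trans ?_ (Finset.single_le_sum (f := fun k => Real.exp (b₀ * |v k|) ^ 2)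
      (fun k _ => sq_nonneg _) hk)
    have := hEle k
    gcongr
  have hlog := fun k (hk : k ∈ A) => hh.log_link (hsmall k hk)
  have hp1 : ∀ k ∈ A \ B, 1 - link h (b * v k - a) ≠ 0 := fun k hk =>
    (hlog k (Finset.mem_sdiff.1 hk).1).2.1.ne'
  have hp2 : ∀ k ∈ B, link h (b * v k - a) ≠ 0 := fun k hk => (hlog k (hBA hk)).1.ne'
  refine ⟨mul_pos (Finset.prod_pos fun k hk => (hlog k (Finset.mem_sdiff.1 hk).1).2.1)
    (Finset.prod_pos fun k hk => (hlog k (hBA hk)).1), ?_⟩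
  rw [sampleLikelihood, Real.log_mul (Finset.prod_ne_zero_iff.2 hp1) (Finset.prod_ne_zero_iff.2 hp2),
    Real.log_prod hp1, Real.log_prod hp2]
  have hsd : ∑ k ∈ A, Real.exp (b * v k) =
      ∑ k ∈ A \ B, Real.exp (b * v k) + ∑ k ∈ B, Real.exp (b * v k) :=
    (Finset.sum_sdiff hBA).symm
  have e : ∑ k ∈ A \ B, Real.log (1 - link h (b * v k - a)) +
      ∑ k ∈ B, Real.log (link h (b * v k - a)) - (logLik A B v γ b - a * B.card) =
      ∑ k ∈ A \ B, (Real.log (1 - link h (b * v k - a)) + Real.exp (b * v k - a)) +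
      (∑ k ∈ B, (Real.log (link h (b * v k - a)) - (b * v k - a)) +
        γ * ∑ k ∈ B, Real.exp (b * v k)) := by
    rw [logLik, hsd]
    simp only [hE, Finset.sum_add_distrib, Finset.sum_sub_distrib, Finset.sum_const, nsmul_eq_mul,
      ← Finset.mul_sum]
    ring
  rw [e]
  have b1 : |∑ k ∈ A \ B, (Real.log (1 - link h (b * v k - a)) + Real.exp (b * v k - a))| ≤
      (C + 4) * η ^ 2 := by
    refine (Finset.abs_sum_le_sum_abs _ _).trans ?_
    calc ∑ k ∈ A \ B, |Real.log (1 - link h (b * v k - a)) + Real.exp (b * v k - a)|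
        ≤ ∑ k ∈ A \ B, (C + 4) * (γ ^ 2 * Real.exp (b₀ * |v k|) ^ 2) := by
          refine Finset.sum_le_sum fun k hk =>
            (hlog k (Finset.mem_sdiff.1 hk).1).2.2.2.trans ?_
          rw [hE, mul_pow]
          have := hEle k
          gcongr
      _ ≤ ∑ k ∈ A, (C + 4) * (γ ^ 2 * Real.exp (b₀ * |v k|) ^ 2) :=
          Finset.sum_le_sum_of_subset_of_nonneg Finset.sdiff_subset fun k _ _ => by positivity
      _ ≤ (C + 4) * η ^ 2 := by
          rw [← Finset.mul_sum, ← Finset.mul_sum]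
          gcongr
  have b2 : |∑ k ∈ B, (Real.log (link h (b * v k - a)) - (b * v k - a))| ≤ 2 * C * η := by
    refine (Finset.abs_sum_le_sum_abs _ _).trans ?_
    calc ∑ k ∈ B, |Real.log (link h (b * v k - a)) - (b * v k - a)|
        ≤ ∑ k ∈ B, 2 * C * (γ * Real.exp (b₀ * |v k|)) := by
          refine Finset.sum_le_sum fun k hk => (hlog k (hBA hk)).2.2.1.trans ?_
          rw [hE]
          have := hEle k
          gcongr
      _ ≤ 2 * C * η := by
          rw [← Finset.mul_sum, ← Finset.mul_sum]
          gcongr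
  have b3 : |γ * ∑ k ∈ B, Real.exp (b * v k)| ≤ η := by
    rw [abs_of_nonneg (mul_nonneg hγ0.le (Finset.sum_nonneg fun k _ => (Real.exp_pos _).le))]
    refine le_trans (mul_le_mul_of_nonneg_left (Finset.sum_le_sum fun k _ => hEle k) hγ0.le) h1
  have hη1 : η ≤ 1 := hηC.trans (by rw [div_le_iff₀ (by positivity)]; linarith)
  refine (abs_add_le _ _).trans ((add_le_add b1 ((abs_add_le _ _).trans (add_le_add b2 b3))).trans ?_)
  nlinarith [mul_nonneg hη (sub_nonneg.2 hη1)]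

end SampleLikelihood

/-! ### Location of the maximiser of the likelihood. -/

section Maximiser

variable {ι : Type*} [DecidableEq ι] {h : ℝ → ℝ} {β C a b : ℝ} {A B : Finset ι} {v : ι → ℝ}

/-- Properties of a sample that exclude maximisers of the likelihood far from the true value. -/
structure TypicalSample (A B : Finset ι) (v : ι → ℝ) (β γ s k p r v₀ b₀ η : ℝ) : Prop where
  subset : B ⊆ A
  card_default_le : (B.card : ℝ) ≤ k * s
  sum_abs_le : ∑ i ∈ B, |v i| ≤ k * s
  sum_exp_le : γ * ∑ i ∈ A, Real.exp (β * v i) ≤ k * s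
  wrong_sign : ∀ σ : ℝ, |σ| = 1 → p * s ≤ (B.filter (fun i => σ * v i ≤ -1)).card
  survivors : ∀ σ : ℝ, |σ| = 1 →
    r * s ≤ γ * ((A \ B).filter (fun i => v₀ ≤ σ * v i ∧ σ * v i ≤ 2 * v₀)).card
  sq_le : γ ^ 2 * ∑ i ∈ A, Real.exp (b₀ * |v i|) ^ 2 ≤ η ^ 2
  default_le : γ * ∑ i ∈ B, Real.exp (b₀ * |v i|) ≤ η

/-- The slope beyond which the defaults with a covariate of the wrong sign decide. -/
noncomputable def farSlope (β C k p : ℝ) : ℝ := ((|β| + 1) * k + 1 + k + 1) / p + Real.log (1 + C)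

variable {γ s k p r v₀ b₀ η : ℝ}

lemma exists_abs_eq_one (b : ℝ) : ∃ σ : ℝ, |σ| = 1 ∧ b = |b| * σ := by
  rcases le_total 0 b with hb | hb
  · exact ⟨1, abs_one, by rw [abs_of_nonneg hb, mul_one]⟩
  · exact ⟨-1, by rw [abs_neg, abs_one], by rw [abs_of_nonpos hb]; ring⟩

/-- The approximation by `logLik` holds only for bounded slopes, so large slopes are excluded by
comparison with the value at `β`. Two obstructions are available: defaults that a large slope makes
very unlikely, and survivors that it makes too likely to default. -/
lemma TypicalSample.lt_of_far (hS : TypicalSample A B v β γ s k p r v₀ b₀ η)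
    (hh : IsCorrection h β C) (ha : 1 ≤ a) (hγ : γ = Real.exp (-a)) (hs : 1 ≤ s) (hk : 0 ≤ k)
    (hp : 0 < p) (haC : Real.exp (-(a / 2)) ≤ 1 / (2 * (C + 1))) (hη : 0 ≤ η)
    (hηC : η ≤ 1 / (4 * (C + 1))) (hη1 : (3 * C + 5) * η ≤ 1) (hβ : |β| ≤ b₀)
    (hv₀ : v₀ * farSlope β C k p = 1 / 4) (hv₀0 : 0 ≤ v₀)
    (hb₀ : ∀ x, b₀ ≤ x → k * Real.log (1 + C) + k * x + ((|β| + 1) * k + 1) <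
      r * (Real.exp (v₀ * x) / 2)) (hb : b₀ ≤ |b|) :
    sampleLikelihood h A B v a b < sampleLikelihood h A B v a β := by
  have hC := hh.nonneg
  have hl : 0 ≤ Real.log (1 + C) := Real.log_nonneg (by linarith)
  obtain ⟨hpos, hlog⟩ := abs_log_sampleLikelihood_sub_le hh hS.subset hγ hη hηC hS.sq_le
    hS.default_le hβ
  set c₁ := (|β| + 1) * k + 1 with hc₁
  have hc₁0 : 0 ≤ c₁ := by positivity
  -- In `c₁` the summand `|β| k` comes from the linear term, `k` from the exponential sum, and `1`
  -- from the approximation error.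
  have hlow : -(c₁ * s) - a * B.card ≤ Real.log (sampleLikelihood h A B v a β) := by
    have h1 := (abs_le.1 hlog).1
    have h2 : -(|β| * (k * s)) ≤ β * ∑ i ∈ B, v i := by
      have h3 : |β * ∑ i ∈ B, v i| ≤ |β| * (k * s) := by
        rw [abs_mul]
        exact mul_le_mul_of_nonneg_left ((Finset.abs_sum_le_sum_abs _ _).trans hS.sum_abs_le)
          (abs_nonneg _)
      exact (abs_le.1 h3).1
    have h4 := hS.sum_exp_le
    rw [logLik] at h1
    nlinarith
  rw [← Real.exp_log hpos]
  obtain ⟨σ, hσ, hbσ⟩ := exists_abs_eq_one b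
  -- Below the threshold the term `a B.card` cancels on both sides and survivors with covariate in
  -- `[v₀, 2 v₀]` give an exponential in `|b|`; `v₀ = 1 / (4 farSlope)` ensures `b v ≤ a / 2` for
  -- them. Above it, wrong-sign defaults give a loss linear in `|b|` that also outweighs `a B.card`.
  rcases le_or_gt |b| (farSlope β C k p * a) with hle | hgt
  · refine lt_of_le_of_lt (sampleLikelihood_le_of_survivors hh haC
      (A' := (A \ B).filter (fun i => v₀ ≤ σ * v i ∧ σ * v i ≤ 2 * v₀))
      (Finset.filter_subset _ _) (v₀ := v₀) fun i hi => ?_)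
      (Real.exp_lt_exp.2 (lt_of_lt_of_le ?_ hlow))
    · obtain ⟨-, h1, h2⟩ := Finset.mem_filter.1 hi
      have e : b * v i = |b| * (σ * v i) := by
        conv_lhs => rw [hbσ]
        ring
      rw [e]
      have hb0 := abs_nonneg b
      constructor
      · nlinarith
      · calc |b| * (σ * v i) ≤ |b| * (2 * v₀) := mul_le_mul_of_nonneg_left h2 hb0
          _ ≤ farSlope β C k p * a * (2 * v₀) := mul_le_mul_of_nonneg_right hle (by positivity)
          _ = 2 * (v₀ * farSlope β C k p) * a := by ring
          _ = a / 2 := by rw [hv₀]; ring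
    · have h1 := hb₀ |b| hb
      have h2 := hS.survivors σ hσ
      have h3 := hS.card_default_le
      have h4 := hS.sum_abs_le
      rw [← hγ]
      set n : ℝ := (((A \ B).filter (fun i => v₀ ≤ σ * v i ∧ σ * v i ≤ 2 * v₀)).card : ℝ)
      have h5 : r * s * (Real.exp (v₀ * |b|) / 2) ≤ γ * n * (Real.exp (v₀ * |b|) / 2) :=
        mul_le_mul_of_nonneg_right h2 (by positivity)
      have h6 : (B.card : ℝ) * Real.log (1 + C) ≤ k * s * Real.log (1 + C) :=
        mul_le_mul_of_nonneg_right h3 hl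
      have h7 : |b| * ∑ i ∈ B, |v i| ≤ |b| * (k * s) := mul_le_mul_of_nonneg_left h4 (abs_nonneg _)
      have h8 : s * (k * Real.log (1 + C) + k * |b| + c₁) < s * (r * (Real.exp (v₀ * |b|) / 2)) :=
        mul_lt_mul_of_pos_left h1 (by linarith)
      linarith
  · refine lt_of_le_of_lt (sampleLikelihood_le_of_subset hh (by linarith)
      (B' := B.filter (fun i => σ * v i ≤ -1)) (Finset.filter_subset _ _) fun i hi => ?_)
      (Real.exp_lt_exp.2 (lt_of_lt_of_le ?_ hlow))
    · have h1 := (Finset.mem_filter.1 hi).2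
      have e : b * v i = |b| * (σ * v i) := by
        conv_lhs => rw [hbσ]
        ring
      rw [e]
      nlinarith [abs_nonneg b]
    · have h1 := hS.wrong_sign σ hσ
      have h3 := hS.card_default_le
      set n : ℝ := ((B.filter (fun i => σ * v i ≤ -1)).card : ℝ)
      have h4 : (c₁ + k + 1) / p * a ≤ |b| - Real.log (1 + C) := by
        rw [farSlope, ← hc₁, add_mul] at hgt
        nlinarith
      have h5 : (c₁ + k + 1) * a ≤ p * (|b| - Real.log (1 + C)) := by
        calc (c₁ + k + 1) * a = p * ((c₁ + k + 1) / p * a) := by field_simp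
          _ ≤ _ := mul_le_mul_of_nonneg_left h4 hp.le
      have h6 : 0 ≤ |b| - Real.log (1 + C) := le_trans (by positivity) h4
      have h7 : p * s * (|b| - Real.log (1 + C)) ≤ n * (|b| - Real.log (1 + C)) :=
        mul_le_mul_of_nonneg_right h1 h6
      have h8 : a * B.card ≤ a * (k * s) := mul_le_mul_of_nonneg_left h3 (by linarith)
      have h9 : s * ((c₁ + k + 1) * a) ≤ s * (p * (|b| - Real.log (1 + C))) :=
        mul_le_mul_of_nonneg_left h5 (by linarith)
      have h10 : s * (c₁ + k * a) < s * ((c₁ + k + 1) * a) :=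
        mul_lt_mul_of_pos_left (by nlinarith) (by linarith)
      linarith

/-- The score at the true value. -/
noncomputable def score (A B : Finset ι) (v : ι → ℝ) (γ β : ℝ) : ℝ :=
  ∑ i ∈ B, v i - γ * ∑ i ∈ A, v i * Real.exp (β * v i)

lemma abs_exp_sub_quadratic_le (y : ℝ) :
    |Real.exp y - 1 - y - y ^ 2 / 2| ≤ |y| ^ 3 * Real.exp |y| := by
  have h := Complex.norm_exp_sub_sum_le_norm_mul_exp (y : ℂ) 3
  have e : Complex.exp y - ∑ m ∈ Finset.range 3, (y : ℂ) ^ m / (m.factorial : ℂ) =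
      ((Real.exp y - 1 - y - y ^ 2 / 2 : ℝ) : ℂ) := by
    simp [Finset.sum_range_succ]
    ring
  rwa [e, Complex.norm_real, Complex.norm_real, Real.norm_eq_abs, Real.norm_eq_abs] at h

/-- Second-order Taylor expansion of `e^{uv}` in each summand; `|u| ≤ 1` bounds the remainder by
`|u|³ |v|³ e^{|v|}`, whose sum does not depend on `u`. -/
lemma abs_logLik_sub_le (hγ : 0 ≤ γ) {I J u : ℝ} (hu : |u| ≤ 1)
    (hI : γ * ∑ i ∈ A, v i ^ 2 * Real.exp (β * v i) = I)
    (hJ : γ * ∑ i ∈ A, |v i| ^ 3 * Real.exp |v i| * Real.exp (β * v i) ≤ J) :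
    |logLik A B v γ (β + u) - logLik A B v γ β - (u * score A B v γ β - u ^ 2 / 2 * I)| ≤
      |u| ^ 3 * J := by
  have e : logLik A B v γ (β + u) - logLik A B v γ β - (u * score A B v γ β - u ^ 2 / 2 * I) =
      -(γ * ∑ i ∈ A, Real.exp (β * v i) *
        (Real.exp (u * v i) - 1 - u * v i - (u * v i) ^ 2 / 2)) := by
    rw [← hI, logLik, logLik, score]
    have e1 : ∑ i ∈ A, Real.exp (β * v i) *
        (Real.exp (u * v i) - 1 - u * v i - (u * v i) ^ 2 / 2) =
        ∑ i ∈ A, Real.exp ((β + u) * v i) - ∑ i ∈ A, Real.exp (β * v i) -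
          u * ∑ i ∈ A, v i * Real.exp (β * v i) -
          u ^ 2 / 2 * ∑ i ∈ A, v i ^ 2 * Real.exp (β * v i) := by
      simp only [Finset.mul_sum, ← Finset.sum_sub_distrib]
      refine Finset.sum_congr rfl fun i _ => ?_
      rw [add_mul, Real.exp_add]
      ring
    rw [e1]
    ring
  rw [e, abs_neg, abs_mul, abs_of_nonneg hγ]
  refine le_trans ?_ (mul_le_mul_of_nonneg_left hJ (by positivity))
  rw [mul_left_comm]
  refine mul_le_mul_of_nonneg_left ((Finset.abs_sum_le_sum_abs _ _).trans ?_) hγ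
  rw [Finset.mul_sum]
  refine Finset.sum_le_sum fun i _ => ?_
  rw [abs_mul, abs_of_pos (Real.exp_pos _)]
  have h1 := abs_exp_sub_quadratic_le (u * v i)
  have h2 : |u * v i| ^ 3 * Real.exp |u * v i| ≤ |u| ^ 3 * (|v i| ^ 3 * Real.exp |v i|) := by
    rw [abs_mul, mul_pow, mul_assoc]
    have : |u| * |v i| ≤ |v i| := mul_le_of_le_one_left (abs_nonneg _) hu
    gcongr
  calc Real.exp (β * v i) * |Real.exp (u * v i) - 1 - u * v i - (u * v i) ^ 2 / 2|
      ≤ Real.exp (β * v i) * (|u| ^ 3 * (|v i| ^ 3 * Real.exp |v i|)) :=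
        mul_le_mul_of_nonneg_left (h1.trans h2) (Real.exp_pos _).le
    _ = _ := by ring

/-- Linear minus a sum of exponentials. The likelihood itself need not be log-concave; concavity of
its leading order confines maximisers to the window of the quadratic approximation. -/
lemma logLik_concave (hγ : 0 ≤ γ) {t : ℝ} (ht0 : 0 ≤ t) (ht1 : t ≤ 1) (x y : ℝ) :
    t * logLik A B v γ x + (1 - t) * logLik A B v γ y ≤ logLik A B v γ (t * x + (1 - t) * y) := by
  have h1 : ∑ i ∈ A, Real.exp ((t * x + (1 - t) * y) * v i) ≤
      t * ∑ i ∈ A, Real.exp (x * v i) + (1 - t) * ∑ i ∈ A, Real.exp (y * v i) := by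
    rw [Finset.mul_sum, Finset.mul_sum, ← Finset.sum_add_distrib]
    refine Finset.sum_le_sum fun i _ => ?_
    have := convexOn_exp.2 (Set.mem_univ (x * v i)) (Set.mem_univ (y * v i)) ht0
      (sub_nonneg.2 ht1) (by ring)
    simp only [smul_eq_mul] at this
    refine le_trans (le_of_eq ?_) this
    congr 1
    ring
  have h2 := mul_le_mul_of_nonneg_left h1 hγ
  simp only [logLik]
  linarith

/-- Approximate maximisers of approximately quadratic functions. -/
lemma sq_sub_le_of_quadratic {Φ : ℝ → ℝ} {c x₀ R θ κ x : ℝ} (hR : 0 < R) (hc : 0 < c)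
    (hκ : 0 ≤ κ) (hx₀ : |x₀| ≤ R / 4)
    (hquad : ∀ x, |x| ≤ R → |Φ x - (c * x * x₀ - c / 2 * x ^ 2)| ≤ θ)
    (hconc : ∀ t, 0 ≤ t → t ≤ 1 → t * Φ x ≤ Φ (t * x)) (hθR : θ + 2 * κ < c / 8 * R ^ 2)
    (hΦx : -(2 * κ) ≤ Φ x) (hd : Φ x₀ - Φ x ≤ 2 * κ) :
    c / 2 * (x - x₀) ^ 2 ≤ 2 * θ + 2 * κ := by
  have hxR : |x| ≤ R := by
    -- If `|x| > R`, the point is shrunk radially to distance `R`. There the quadratic gives `Φ ≤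
    -- -(c/4) R² + θ < -2κ`, while `hconc` and `hΦx` force `Φ ≥ -2κ`.
    by_contra hcon
    push Not at hcon
    have hx0 : 0 < |x| := hR.trans hcon
    have ht0 : 0 < R / |x| := by positivity
    have ht1 : R / |x| ≤ 1 := by rw [div_le_one hx0]; exact hcon.le
    have hc1 := hconc _ ht0.le ht1
    have htx : |R / |x| * x| = R := by
      rw [abs_mul, abs_of_pos ht0]
      field_simp
    generalize R / |x| = t at ht0 ht1 hc1 htx
    have q := (abs_le.1 (hquad (t * x) htx.le)).2
    have hsq : (t * x) ^ 2 = R ^ 2 := by rw [← sq_abs, htx]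
    have hlin : c * (t * x) * x₀ ≤ c * R * (R / 4) := by
      calc c * (t * x) * x₀ ≤ |c * (t * x) * x₀| := le_abs_self _
        _ = c * |t * x| * |x₀| := by rw [abs_mul, abs_mul, abs_of_pos hc]
        _ ≤ c * R * (R / 4) := by rw [htx]; gcongr
    rw [hsq] at q
    have q2 : Φ (t * x) ≤ -(c / 4 * R ^ 2) + θ := by linarith
    have q3 : Φ (t * x) < -(2 * κ) := by
      have : 0 < c * R ^ 2 := by positivity
      linarith
    have q4 : -(2 * κ) ≤ t * Φ x := by
      rcases le_or_gt 0 (Φ x) with hp | hn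
      · have := mul_nonneg ht0.le hp
        linarith
      · have := mul_le_mul_of_nonpos_right ht1 hn.le
        linarith
    linarith
  -- Completing the square: the quadratic model has maximum `c x₀² / 2` at `x₀` and falls short of
  -- it by `c (x - x₀)² / 2` at `x`.
  have q1 := (abs_le.1 (hquad x₀ (by linarith))).1
  have q2 := (abs_le.1 (hquad x hxR)).2
  linarith

/-- A maximiser of the likelihood is close to the maximiser of its quadratic approximation. -/
lemma TypicalSample.abs_maximiser_sub_le (hS : TypicalSample A B v β γ s k p r v₀ b₀ η)
    (hh : IsCorrection h β C) (hγ : γ = Real.exp (-a)) (hη : 0 ≤ η)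
    (hηC : η ≤ 1 / (4 * (C + 1))) (hβ : |β| + 1 ≤ b₀) {R c J ε₁ ε : ℝ} (hR : 0 < R) (hc : 0 < c)
    (hRs : R ≤ √s) (hJ0 : 0 ≤ J)
    (hU : |score A B v γ β| ≤ c * R / 4 * √s)
    (hI : |γ * ∑ i ∈ A, v i ^ 2 * Real.exp (β * v i) - c * s| ≤ ε₁ * s)
    (hJ : γ * ∑ i ∈ A, |v i| ^ 3 * Real.exp |v i| * Real.exp (β * v i) ≤ J * s)
    (hε : 0 ≤ ε)
    (hθ : R ^ 2 * ε₁ / 2 + R ^ 3 * J / √s + 2 * ((3 * C + 5) * η) ≤ c / 4 * ε ^ 2)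
    (hθR : R ^ 2 * ε₁ / 2 + R ^ 3 * J / √s + 2 * ((3 * C + 5) * η) < c / 8 * R ^ 2)
    {b : ℝ} (hb : |b| ≤ b₀)
    (h1 : sampleLikelihood h A B v a β ≤ sampleLikelihood h A B v a b)
    (h2 : sampleLikelihood h A B v a (β + score A B v γ β / (c * s)) ≤
      sampleLikelihood h A B v a b) :
    |√s * (b - β) - score A B v γ β / (√s * c)| ≤ ε := by
  have hC := hh.nonneg
  have hγ0 : 0 < γ := hγ ▸ Real.exp_pos _
  have hr0 : 0 < √s := hR.trans_le hRs
  have hs0 : 0 < s := Real.sqrt_pos.1 hr0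
  have hr2 : √s ^ 2 = s := Real.sq_sqrt hs0.le
  set g := √s with hg
  set U := score A B v γ β with hUdef
  set I := γ * ∑ i ∈ A, v i ^ 2 * Real.exp (β * v i) with hIdef
  set κ := (3 * C + 5) * η with hκ
  have hκ0 : 0 ≤ κ := by positivity
  -- Local coordinate `x = √s (b - β)`, in which the curvature is approximately `c` and the model is
  -- maximal at `x₀`.
  set Φ : ℝ → ℝ := fun x => logLik A B v γ (β + x / g) - logLik A B v γ β with hΦ
  set x₀ := U / (g * c) with hx₀
  have hx₀R : |x₀| ≤ R / 4 := by
    rw [hx₀, abs_div, abs_of_pos (mul_pos hr0 hc), div_le_iff₀ (mul_pos hr0 hc)]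
    linarith
  have hquad : ∀ x, |x| ≤ R → |Φ x - (c * x * x₀ - c / 2 * x ^ 2)| ≤ R ^ 2 * ε₁ / 2 + R ^ 3 * J / g := by
    intro x hx
    have hx1 : |x / g| ≤ 1 := by
      rw [abs_div, abs_of_pos hr0, div_le_one hr0]
      exact hx.trans hRs
    have t1 := abs_logLik_sub_le (B := B) hγ0.le hx1 hIdef.symm hJ
    have e : c * x * x₀ = x / g * U := by
      rw [hx₀]
      field_simp
    have t2 : |(x / g) ^ 2 / 2 * I - c / 2 * x ^ 2| ≤ R ^ 2 * ε₁ / 2 := by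
      have e2 : (x / g) ^ 2 / 2 * I - c / 2 * x ^ 2 = x ^ 2 / (2 * s) * (I - c * s) := by
        rw [div_pow, hr2]
        field_simp
      have hxR : x ^ 2 ≤ R ^ 2 := sq_le_sq' (abs_le.1 hx).1 (abs_le.1 hx).2
      have hε₁ : 0 ≤ ε₁ := nonneg_of_mul_nonneg_left ((abs_nonneg _).trans hI) hs0
      rw [e2, abs_mul, abs_of_nonneg (by positivity)]
      calc x ^ 2 / (2 * s) * |I - c * s| ≤ R ^ 2 / (2 * s) * (ε₁ * s) := by gcongr
        _ = R ^ 2 * ε₁ / 2 := by field_simp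
    have t3 : |x / g| ^ 3 * (J * s) ≤ R ^ 3 * J / g := by
      rw [abs_div, abs_of_pos hr0, div_pow, ← hr2]
      calc |x| ^ 3 / g ^ 3 * (J * g ^ 2) ≤ R ^ 3 / g ^ 3 * (J * g ^ 2) := by gcongr
        _ = R ^ 3 * J / g := by field_simp
    have t4 := abs_add_le (Φ x - (x / g * U - (x / g) ^ 2 / 2 * I))
      (-((x / g) ^ 2 / 2 * I - c / 2 * x ^ 2))
    rw [abs_neg] at t4
    have e3 : Φ x - (c * x * x₀ - c / 2 * x ^ 2) = Φ x - (x / g * U - (x / g) ^ 2 / 2 * I) +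
      -((x / g) ^ 2 / 2 * I - c / 2 * x ^ 2) := by rw [e]; ring
    rw [e3]
    linarith
  set θ := R ^ 2 * ε₁ / 2 + R ^ 3 * J / g with hθdef
  have hlog : ∀ b', |b'| ≤ b₀ → 0 < sampleLikelihood h A B v a b' ∧
      |Real.log (sampleLikelihood h A B v a b') - (logLik A B v γ b' - a * B.card)| ≤ κ :=
    fun b' hb' => abs_log_sampleLikelihood_sub_le hh hS.subset hγ hη hηC hS.sq_le hS.default_le hb'
  have hβ0 : |β| ≤ b₀ := by linarith
  have hb₀ : ∀ x, |x| ≤ R → |β + x / g| ≤ b₀ := fun x hx => by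
    refine (abs_add_le _ _).trans (le_trans (add_le_add_right ?_ _) hβ)
    rw [abs_div, abs_of_pos hr0, div_le_one hr0]
    exact hx.trans hRs
  -- An inequality between exact likelihoods passes to `logLik` with loss `2κ`; the constant `a *
  -- B.card` cancels.
  have hcmp : ∀ b', |b'| ≤ b₀ → sampleLikelihood h A B v a b' ≤ sampleLikelihood h A B v a b →
      logLik A B v γ b' - logLik A B v γ b ≤ 2 * κ := by
    intro b' hb' hle
    have l1 := Real.log_le_log (hlog b' hb').1 hle
    have l2 := abs_le.1 (hlog b' hb').2
    have l3 := abs_le.1 (hlog b hb).2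
    linarith [l2.1, l3.2]
  set x := g * (b - β) with hx
  have hbx : β + x / g = b := by
    rw [hx]
    field_simp
    ring
  have hΦx : -(2 * κ) ≤ Φ x := by
    have := hcmp β hβ0 h1
    simp only [hΦ, hbx]
    linarith
  have hconc : ∀ t, 0 ≤ t → t ≤ 1 → t * Φ x ≤ Φ (t * x) := by
    intro t ht0 ht1
    have hcc := logLik_concave (A := A) (B := B) (v := v) hγ0.le ht0 ht1 b β
    have e1 : t * b + (1 - t) * β = β + t * x / g := by
      rw [← hbx]
      ring
    rw [e1] at hcc
    simp only [hΦ, hbx]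
    linarith
  have e₀ : β + U / (c * s) = β + x₀ / g := by
    rw [hx₀, ← hr2]
    field_simp
  rw [e₀] at h2
  have hd := hcmp _ (hb₀ x₀ (by linarith)) h2
  have hd' : Φ x₀ - Φ x ≤ 2 * κ := by
    simp only [hΦ, hbx]
    linarith
  have q3 := sq_sub_le_of_quadratic hR hc hκ0 hx₀R hquad hconc hθR hΦx hd'
  refine abs_le_of_sq_le_sq ?_ hε
  have hεε : c / 2 * (x - x₀) ^ 2 ≤ c / 2 * ε ^ 2 := by linarith
  exact le_of_mul_le_mul_left hεε (by positivity)

end Maximiser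

/-! ### Smooth cut-offs, so that counts are accessible to the laws of large numbers. -/

section Bump

lemma ExpBdd.of_bounded {g : ℝ → ℝ} {B : ℝ} (h : ∀ v, |g v| ≤ B) : ExpBdd g :=
  (ExpBdd.const B).mono fun v => (h v).trans (le_abs_self B)

/-- Smooth lower bounds for indicators of intervals. -/
lemma exists_bump {σ x y : ℝ} (hσ : |σ| = 1) (hxy : x < y) :
    ∃ φ : ℝ → ℝ, SmoothExp φ ∧ (∀ v, 0 ≤ φ v) ∧ (∀ v, φ v ≤ 1) ∧
      (∀ v, φ v ≠ 0 → x ≤ σ * v ∧ σ * v ≤ y) ∧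
      ∀ b, 0 < gaussExp (fun z => φ z * Real.exp (b * z)) := by
  have hσ2 : σ * σ = 1 := by rw [← abs_mul_abs_self, hσ, one_mul]
  let f : ContDiffBump (σ * ((x + y) / 2)) :=
    ⟨(y - x) / 4, (y - x) / 2, by linarith, by linarith⟩
  have hf : ContDiff ℝ 1 (f : ℝ → ℝ) := f.contDiff
  obtain ⟨B, hB⟩ := (hf.continuous_deriv le_rfl).bounded_above_of_compact_support
    f.hasCompactSupport.deriv
  refine ⟨f, ⟨hf, ExpBdd.of_bounded (B := 1) fun v => ?_, ExpBdd.of_bounded (B := B) hB⟩,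
    fun v => f.nonneg, fun v => f.le_one, fun v hv => ?_, fun b => ?_⟩
  · rw [abs_of_nonneg f.nonneg]
    exact f.le_one
  · have h1 : v ∈ Metric.ball (σ * ((x + y) / 2)) ((y - x) / 2) := by
      rw [← f.support_eq]
      exact hv
    rw [Metric.mem_ball, Real.dist_eq] at h1
    have h2 : |σ * v - (x + y) / 2| < (y - x) / 2 := by
      have : σ * v - (x + y) / 2 = σ * (v - σ * ((x + y) / 2)) := by
        rw [mul_sub, ← mul_assoc, hσ2, one_mul]
      rw [this, abs_mul, hσ, one_mul]
      exact h1
    have h3 := abs_lt.1 h2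
    constructor <;> linarith
  · have : (gaussianReal 0 1).IsOpenPosMeasure :=
      (gaussianReal_absolutelyContinuous' 0 one_ne_zero).isOpenPosMeasure
    refine Continuous.integral_pos_of_hasCompactSupport_nonneg_nonzero
      (x := σ * ((x + y) / 2)) (by fun_prop) f.hasCompactSupport.mul_right
      (fun z => mul_nonneg f.nonneg (Real.exp_pos _).le) ?_
    rw [f.one_of_mem_closedBall (Metric.mem_closedBall_self f.rIn_pos.le), one_mul]
    exact (Real.exp_pos _).ne'

end Bump

/-! ### The sample of living and defaulting firms. -/

section Samples

variable {Ω : Type*} {V D : ℕ → ℕ → Ω → ℝ} {h : ℝ → ℝ} {β C K ρ a : ℝ} {m T : ℕ}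

/-- The pairs `(t, i)` such that firm `i` is alive at time `t`. -/
noncomputable def aliveSet (m T : ℕ) (D : ℕ → ℕ → Ω → ℝ) (ω : Ω) : Finset (ℕ × ℕ) :=
  (Finset.range T ×ˢ Finset.range m).filter fun k => k.1 ≤ exitTime T D k.2 ω

/-- The pairs `(t, i)` such that firm `i` defaults in `(t, t + 1]`. -/
noncomputable def defaultSet (m T : ℕ) (D : ℕ → ℕ → Ω → ℝ) (ω : Ω) : Finset (ℕ × ℕ) :=
  (aliveSet m T D ω).filter fun k => D k.2 (k.1 + 1) ω = 1

/-- The covariate of firm `i` at time `t`, indexed by the pair `(t, i)`. -/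
def sampleCov (V : ℕ → ℕ → Ω → ℝ) (ω : Ω) (k : ℕ × ℕ) : ℝ := V k.2 k.1 ω

/-- The condition `1 ≤ T` makes every `t ≤ exitTime` a period below `T`; for `T = 0` truncated
subtraction would leave the period `0` in the product. -/
lemma likelihood_eq (hT : 1 ≤ T) (b a : ℝ) (ω : Ω) :
    likelihood h V D m T b a ω =
      sampleLikelihood h (aliveSet m T D ω) (defaultSet m T D ω) (sampleCov V ω) a b := by
  rw [sampleLikelihood, defaultSet, ← Finset.filter_not, mul_comm, ← Finset.prod_ite, aliveSet,
    Finset.prod_filter, Finset.prod_product_right, likelihood]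
  refine Finset.prod_congr rfl fun i _ => ?_
  rw [← Finset.prod_filter]
  refine Finset.prod_congr ?_ fun t _ => rfl
  ext t
  have : exitTime T D i ω ≤ T - 1 := Nat.sInf_le (Or.inr rfl)
  simp only [Finset.mem_range, Finset.mem_filter]
  omega

lemma sum_aliveSet (f : ℝ → ℝ) (ω : Ω) :
    ∑ k ∈ aliveSet m T D ω, f (sampleCov V ω k) =
      ∑ t ∈ Finset.range T, ∑ i ∈ Finset.range m, f (V i t ω) * alive T D i t ω := by
  rw [aliveSet, Finset.sum_filter, Finset.sum_product]
  refine Finset.sum_congr rfl fun t _ => Finset.sum_congr rfl fun i _ => ?_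
  simp only [alive, sampleCov]
  split_ifs <;> simp

variable [m0 : MeasurableSpace Ω] {μ : Measure Ω} [IsProbabilityMeasure μ]

/-- The conditional default probability of a firm that is gone is zero, so a second default has
expectation zero and is a null event. -/
lemma ae_default_mul_dead (hV : IsCovariateProcess μ V K ρ)
    (hDp : IsDefaultProcess μ V D h β a m T) {i t : ℕ} (hi : i < m) (ht : t < T) :
    ∀ᵐ ω ∂μ, D i (t + 1) ω * alive T D i t ω = D i (t + 1) ω := by
  have hle := history_le hV.measurable hDp.measurable m t
  have hd : Integrable (D i (t + 1)) μ := by simpa using hDp.integrable_prod {i} (t + 1)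
  have ham : Measurable[history m V D t] (fun ω => 1 - alive T D i t ω) :=
    Measurable.sub measurable_const
      (Measurable.ite (measurableSet_alive hi ht) measurable_const measurable_const)
  have hfi : Integrable (fun ω => (1 - alive T D i t ω) * D i (t + 1) ω) μ := by
    refine hd.norm.mono' ((ham.mono hle le_rfl).mul (hDp.measurable _ _)).aestronglyMeasurable
      (ae_of_all _ fun ω => ?_)
    rcases alive_mem T D i t ω with h | h <;> simp [h]
  have h0 := integral_mul_eq_of_condExp hle hd (hDp.condProb i hi t ht) ham hfi
  have h1 : ∫ ω, (1 - alive T D i t ω) *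
      (if t ≤ exitTime T D i ω then link h (β * V i t ω - a) else 0) ∂μ = 0 := by
    rw [← integral_zero Ω ℝ (μ := μ)]
    refine integral_congr_ae (ae_of_all _ fun ω => ?_)
    simp only [alive]
    split_ifs <;> simp
  rw [h1, integral_eq_zero_iff_of_nonneg (fun ω => mul_nonneg
    (sub_nonneg.2 (alive_le_one _ _ _ _ _)) (default_nonneg hDp.zero_or_one _ _ _)) hfi] at h0
  filter_upwards [h0] with ω h2
  have h2 : (1 - alive T D i t ω) * D i (t + 1) ω = 0 := h2
  linarith

/-- `defaultSet` records defaults of living firms only, and almost surely there are no others. The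
null set does not depend on `f`. -/
lemma ae_sum_defaultSet (hV : IsCovariateProcess μ V K ρ)
    (hDp : IsDefaultProcess μ V D h β a m T) :
    ∀ᵐ ω ∂μ, ∀ f : ℝ → ℝ,
      ∑ k ∈ defaultSet m T D ω, f (sampleCov V ω k) = defaultSum m T V D f ω := by
  have h1 : ∀ᵐ ω ∂μ, ∀ t ∈ Finset.range T, ∀ i ∈ Finset.range m,
      D i (t + 1) ω * alive T D i t ω = D i (t + 1) ω :=
    (Finset.eventually_all _).2 fun t ht => (Finset.eventually_all _).2 fun i hi =>
      ae_default_mul_dead hV hDp (Finset.mem_range.1 hi) (Finset.mem_range.1 ht)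
  filter_upwards [h1] with ω h2 f
  rw [defaultSet, aliveSet, Finset.filter_filter, Finset.sum_filter, Finset.sum_product]
  refine Finset.sum_congr rfl fun t ht => Finset.sum_congr rfl fun i hi => ?_
  rw [← h2 t ht i hi]
  simp only [alive, sampleCov]
  rcases hDp.zero_or_one i (t + 1) ω with h | h <;> by_cases h3 : t ≤ exitTime T D i ω <;>
    simp [h, h3]

end Samples

/-! ### Existence of a maximiser. -/

section Existence

variable {ι : Type*} [DecidableEq ι] {h : ℝ → ℝ} {β C a b : ℝ} {A B : Finset ι} {v : ι → ℝ}
  {γ s k p r v₀ b₀ η : ℝ}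

lemma continuous_sampleLikelihood (hh : Continuous h) :
    Continuous (sampleLikelihood h A B v a) := by
  unfold sampleLikelihood link
  fun_prop

/-- Needed because `IsMLE` prescribes nothing unless a maximiser exists. The maximum over a compact
interval is global, as values outside are below the one at `β`. -/
lemma exists_isMaxOn_of_far (hh : Continuous h) (hβ : |β| ≤ b₀)
    (hfar : ∀ b, b₀ ≤ |b| → sampleLikelihood h A B v a b < sampleLikelihood h A B v a β) :
    ∃ b, IsMaxOn (sampleLikelihood h A B v a) Set.univ b := by
  obtain ⟨b, hb, hmax⟩ := isCompact_Icc.exists_isMaxOn (s := Set.Icc (-b₀) b₀)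
    ⟨β, abs_le.1 hβ⟩ (continuous_sampleLikelihood (A := A) (B := B) (v := v) (a := a) hh).continuousOn
  refine ⟨b, fun x _ => ?_⟩
  rcases le_or_gt |x| b₀ with hx | hx
  · exact hmax (abs_le.1 hx)
  · exact (hfar x hx.le).le.trans (hmax (abs_le.1 hβ))

end Existence

/-! ### Samples are typical with high probability. -/

section TypicalSamples

variable {Ω : Type*} {V : ℕ → ℕ → Ω → ℝ} {h : ℝ → ℝ} {β C K ρ : ℝ}
  [m0 : MeasurableSpace Ω] {μ : Measure Ω} [IsProbabilityMeasure μ]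
  {m T : ℝ → ℕ} {D : ℝ → ℕ → ℕ → Ω → ℝ}

lemma whp_sum_aliveSet (hV : IsCovariateProcess μ V K ρ) (hρ : ρ ∈ Set.Ioo (0 : ℝ) 1)
    (hh : IsCorrection h β C) (hR : Regime m T)
    (hD : ∀ᶠ γ in 𝓝[>] (0 : ℝ), IsDefaultProcess μ V (D γ) h β (offset γ) (m γ) (T γ))
    {g : ℝ → ℝ} (hg : SmoothExp g) {ε : ℝ} (hε : 0 < ε) :
    Whp μ (fun γ ω => |γ * ∑ k ∈ aliveSet (m γ) (T γ) (D γ) ω, g (sampleCov V ω k) -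
      gaussExp g * (γ * m γ * T γ)| ≤ ε * (γ * m γ * T γ)) := by
  refine (whp_aliveSum hV hρ hh hR hD hg hε).mono ?_
  filter_upwards [hR.size.eventually_ge_atTop 1, eventually_pos_le_one] with γ hs hγ
  have hγ0 := hγ.1
  obtain ⟨hm0, hT0⟩ := pos_of_one_le_size hs
  refine ae_of_all _ fun ω h1 => ?_
  rw [sum_aliveSet]
  set S := ∑ t ∈ Finset.range (T γ), ∑ i ∈ Finset.range (m γ), g (V i t ω) * alive (T γ) (D γ) i t ω
  have e : γ * S - gaussExp g * (γ * m γ * T γ) = (S / (m γ * T γ) - gaussExp g) * (γ * m γ * T γ) := by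
    field_simp
  rw [e, abs_mul, abs_of_pos (show 0 < γ * m γ * T γ by positivity)]
  gcongr

lemma whp_sum_defaultSet (hV : IsCovariateProcess μ V K ρ) (hρ : ρ ∈ Set.Ioo (0 : ℝ) 1)
    (hh : IsCorrection h β C) (hR : Regime m T)
    (hD : ∀ᶠ γ in 𝓝[>] (0 : ℝ), IsDefaultProcess μ V (D γ) h β (offset γ) (m γ) (T γ))
    {g : ℝ → ℝ} (hg : SmoothExp g) {ε : ℝ} (hε : 0 < ε) :
    Whp μ (fun γ ω => |∑ k ∈ defaultSet (m γ) (T γ) (D γ) ω, g (sampleCov V ω k) -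
      gaussExp (fun z => g z * Real.exp (β * z)) * (γ * m γ * T γ)| ≤ ε * (γ * m γ * T γ)) := by
  refine (whp_defaultSum hV hρ hh hR hD hg hε).mono ?_
  filter_upwards [hR.size.eventually_ge_atTop 1, hD] with γ hs hDp
  filter_upwards [ae_sum_defaultSet hV hDp] with ω hae h1
  rw [hae]
  have hs0 : 0 < γ * m γ * T γ := by linarith
  generalize γ * m γ * T γ = s at *
  set S := defaultSum (m γ) (T γ) V (D γ) g ω
  have e : S - gaussExp (fun z => g z * Real.exp (β * z)) * s =
      (S / s - gaussExp (fun z => g z * Real.exp (β * z))) * s := by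
    field_simp
  rw [e, abs_mul, abs_of_pos hs0]
  gcongr

/-- A first-moment bound: the mean is at most a constant times `γ² m T = γ (γ m T)`, which vanishes
by `rare`. -/
lemma whp_sq_sum_le (hV : IsCovariateProcess μ V K ρ) (hR : Regime m T) (b₀ : ℝ) {η : ℝ}
    (hη : 0 < η) :
    Whp μ (fun γ ω => γ ^ 2 * ∑ k ∈ aliveSet (m γ) (T γ) (D γ) ω,
      Real.exp (b₀ * |sampleCov V ω k|) ^ 2 ≤ η) := by
  have hb : ExpBdd fun v => Real.exp (b₀ * |v|) ^ 2 := (ExpBdd.exp_abs b₀).pow 2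
  have hm : Measurable fun v : ℝ => Real.exp (b₀ * |v|) ^ 2 := by fun_prop
  have h := Whp.of_tendsto_integral_abs (μ := μ) (F := fun γ ω => γ ^ 2 *
    ∑ t ∈ Finset.range (T γ), ∑ i ∈ Finset.range (m γ), Real.exp (b₀ * |V i t ω|) ^ 2)
    (Eventually.of_forall fun γ => (integrable_sum_sum_comp hV hb hm (m γ) (T γ)).const_mul _) ?_ hη
  · refine h.mono (Eventually.of_forall fun γ => ae_of_all _ fun ω h1 => ?_)
    refine le_trans (mul_le_mul_of_nonneg_left ?_ (sq_nonneg γ)) ((le_abs_self _).trans h1)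
    rw [sum_aliveSet (V := V) (fun v => Real.exp (b₀ * |v|) ^ 2)]
    exact Finset.sum_le_sum fun t _ => Finset.sum_le_sum fun i _ =>
      mul_le_of_le_one_right (sq_nonneg _) (alive_le_one _ _ _ _ _)
  · have hz := hR.rare.mul_const (gaussExp fun v => Real.exp (b₀ * |v|) ^ 2)
    rw [zero_mul] at hz
    refine hz.congr fun γ => ?_
    have habs : ∀ ω, |γ ^ 2 * ∑ t ∈ Finset.range (T γ), ∑ i ∈ Finset.range (m γ),
        Real.exp (b₀ * |V i t ω|) ^ 2| = γ ^ 2 * ∑ t ∈ Finset.range (T γ),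
        ∑ i ∈ Finset.range (m γ), Real.exp (b₀ * |V i t ω|) ^ 2 := fun ω =>
      abs_of_nonneg (mul_nonneg (sq_nonneg _) (Finset.sum_nonneg fun _ _ =>
        Finset.sum_nonneg fun _ _ => sq_nonneg _))
    simp only [habs]
    rw [integral_const_mul, integral_sum_sum_comp hV hb hm]
    ring

lemma abs_eq_one_cases {σ : ℝ} (hσ : |σ| = 1) : σ = 1 ∨ σ = -1 := eq_or_eq_neg_of_abs_eq hσ

/-- Samples are typical with high probability. -/
lemma exists_whp_typicalSample (hV : IsCovariateProcess μ V K ρ) (hρ : ρ ∈ Set.Ioo (0 : ℝ) 1)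
    (hh : IsCorrection h β C) (hR : Regime m T)
    (hD : ∀ᶠ γ in 𝓝[>] (0 : ℝ), IsDefaultProcess μ V (D γ) h β (offset γ) (m γ) (T γ)) :
    ∃ k p : ℝ, 0 ≤ k ∧ 0 < p ∧ ∀ v₀ : ℝ, 0 < v₀ → ∃ r : ℝ, 0 < r ∧ ∀ b₀ η : ℝ, 0 ≤ b₀ → 0 < η →
      Whp μ (fun γ ω => TypicalSample (aliveSet (m γ) (T γ) (D γ) ω)
        (defaultSet (m γ) (T γ) (D γ) ω) (sampleCov V ω) β γ (γ * m γ * T γ) k p r v₀ b₀ η) := by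
  have hsq : SmoothExp (fun v => 1 + v ^ 2) := (SmoothExp.const 1).add (SmoothExp.id.pow 2)
  set G₁ := gaussExp (fun z => (1 + z ^ 2) * Real.exp (β * z)) with hG₁
  have hG₁0 : 0 ≤ G₁ := gaussExp_nonneg fun z => by positivity
  set G₂ := gaussExp (fun z => Real.exp (β * z)) with hG₂
  have hG₂0 : 0 ≤ G₂ := gaussExp_nonneg fun z => (Real.exp_pos _).le
  have e1 := whp_sum_defaultSet hV hρ hh hR hD hsq one_pos
  have e2 := whp_sum_aliveSet hV hρ hh hR hD (SmoothExp.exp β) one_pos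
  -- A smooth function below the indicator of a wrong-sign interval, one for each sign of the slope;
  -- its tilted mean is a positive lower bound for the proportion of such defaults.
  obtain ⟨φ₁, hφ₁, hφ₁0, hφ₁1, hφ₁s, hφ₁p⟩ :=
    exists_bump (σ := 1) abs_one (show (-2 : ℝ) < -1 by norm_num)
  obtain ⟨φ₂, hφ₂, hφ₂0, hφ₂1, hφ₂s, hφ₂p⟩ :=
    exists_bump (σ := -1) (by rw [abs_neg, abs_one]) (show (-2 : ℝ) < -1 by norm_num)
  set P₁ := gaussExp (fun z => φ₁ z * Real.exp (β * z))
  set P₂ := gaussExp (fun z => φ₂ z * Real.exp (β * z))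
  have hP₁ : 0 < P₁ := hφ₁p β
  have hP₂ : 0 < P₂ := hφ₂p β
  have e3 := whp_sum_defaultSet hV hρ hh hR hD hφ₁ (half_pos hP₁)
  have e4 := whp_sum_defaultSet hV hρ hh hR hD hφ₂ (half_pos hP₂)
  have hk : 0 ≤ G₁ + G₂ + 1 := by positivity
  -- The order of quantifiers matters: `v₀` will be computed from `k` and `p` through `farSlope`,
  -- then `r` depends on `v₀`, and `b₀` will be chosen after `r`.
  refine ⟨G₁ + G₂ + 1, min (P₁ / 2) (P₂ / 2), hk, by positivity, fun v₀ hv₀ => ?_⟩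
  obtain ⟨χ₁, hχ₁, hχ₁0, hχ₁1, hχ₁s, hχ₁p⟩ :=
    exists_bump (σ := 1) abs_one (show v₀ < 2 * v₀ by linarith)
  obtain ⟨χ₂, hχ₂, hχ₂0, hχ₂1, hχ₂s, hχ₂p⟩ :=
    exists_bump (σ := -1) (by rw [abs_neg, abs_one]) (show v₀ < 2 * v₀ by linarith)
  set Q₁ := gaussExp χ₁
  set Q₂ := gaussExp χ₂
  have hQ₁ : 0 < Q₁ := by simpa using hχ₁p 0
  have hQ₂ : 0 < Q₂ := by simpa using hχ₂p 0
  have e5 := whp_sum_aliveSet hV hρ hh hR hD hχ₁ (half_pos hQ₁)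
  have e6 := whp_sum_aliveSet hV hρ hh hR hD hχ₂ (half_pos hQ₂)
  have hr : 0 < min (Q₁ / 4) (Q₂ / 4) := by positivity
  refine ⟨min (Q₁ / 4) (Q₂ / 4), hr, fun b₀ η hb₀ hη => ?_⟩
  have e7 := whp_sq_sum_le (D := D) hV hR b₀ (show 0 < η ^ 2 by positivity)
  -- A smooth majorant of `e^{b₀|v|}`, which is not differentiable at the origin.
  have hexp : SmoothExp (fun v => Real.exp (b₀ * v) + Real.exp (-b₀ * v)) :=
    (SmoothExp.exp b₀).add (SmoothExp.exp (-b₀))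
  set G₃ := gaussExp (fun z => (Real.exp (b₀ * z) + Real.exp (-b₀ * z)) * Real.exp (β * z)) with hG₃
  have e8 := whp_sum_defaultSet hV hρ hh hR hD hexp one_pos
  have hz1 : ∀ᶠ γ in 𝓝[>] (0 : ℝ), γ * (γ * m γ * T γ) * (G₃ + 1) < η := by
    have hz := hR.rare.mul_const (G₃ + 1)
    rw [zero_mul] at hz
    exact hz.eventually (gt_mem_nhds hη)
  have hz2 : ∀ᶠ γ in 𝓝[>] (0 : ℝ), γ * (G₁ + G₂ + 1) < min (Q₁ / 4) (Q₂ / 4) := by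
    have hz := tendsto_id_nhdsGT.mul_const (G₁ + G₂ + 1)
    rw [zero_mul] at hz
    exact hz.eventually (gt_mem_nhds hr)
  refine ((((((((e1.and e2).and e3).and e4).and e5).and e6).and e7).and e8)).mono ?_
  filter_upwards [hR.size.eventually_ge_atTop 1, eventually_pos_le_one, hz1, hz2] with γ hs hγ hz1 hz2
  refine ae_of_all _ fun ω ⟨⟨⟨⟨⟨⟨⟨w1, w2⟩, w3⟩, w4⟩, w5⟩, w6⟩, w7⟩, w8⟩ => ?_
  have hγ0 := hγ.1
  set A := aliveSet (m γ) (T γ) (D γ) ω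
  set B := defaultSet (m γ) (T γ) (D γ) ω with hB
  set v := sampleCov V ω
  generalize γ * m γ * T γ = s at *
  have hs0 : 0 < s := by linarith
  have w1' := (abs_le.1 w1).2
  have w8' := (abs_le.1 w8).2
  have hBA : B ⊆ A := Finset.filter_subset _ _
  have hcount : ∀ (S : Finset (ℕ × ℕ)) (φ : ℝ → ℝ) (q : ℕ × ℕ → Prop) [DecidablePred q],
      (∀ x, 0 ≤ φ x) → (∀ x, φ x ≤ 1) → (∀ i, φ (v i) ≠ 0 → q i) →
      ∑ i ∈ S, φ (v i) ≤ ((S.filter q).card : ℝ) := by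
    intro S φ q _ h0 h1 h2
    rw [Finset.card_filter]
    push_cast
    refine Finset.sum_le_sum fun i _ => ?_
    split_ifs with hi
    · exact h1 _
    · exact (not_not.1 fun hne => hi (h2 i hne)).le
  have hk1 : (G₁ + 1) * s ≤ (G₁ + G₂ + 1) * s := by
    have := mul_nonneg hG₂0 hs0.le
    linarith
  have hcard : (B.card : ℝ) ≤ (G₁ + G₂ + 1) * s := by
    have : (B.card : ℝ) ≤ ∑ i ∈ B, (1 + v i ^ 2) := by
      rw [Finset.cast_card]
      exact Finset.sum_le_sum fun i _ => by nlinarith [sq_nonneg (v i)]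
    linarith
  -- Living firms in the window account for at least `Q/2 · s`; removing those that default costs `γ
  -- B.card`, which is of smaller order, so `Q/4 · s` remains.
  have hsurv : ∀ (σ Q : ℝ) (χ : ℝ → ℝ), min (Q₁ / 4) (Q₂ / 4) ≤ Q / 4 → (∀ x, 0 ≤ χ x) →
      (∀ x, χ x ≤ 1) → (∀ x, χ x ≠ 0 → v₀ ≤ σ * x ∧ σ * x ≤ 2 * v₀) →
      |γ * ∑ i ∈ A, χ (v i) - Q * s| ≤ Q / 2 * s →
      min (Q₁ / 4) (Q₂ / 4) * s ≤
        γ * ((A \ B).filter (fun i => v₀ ≤ σ * v i ∧ σ * v i ≤ 2 * v₀)).card := by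
    intro σ Q χ hQ h0 h1 h2 h3
    have c1 := hcount A χ (fun i => v₀ ≤ σ * v i ∧ σ * v i ≤ 2 * v₀) h0 h1 fun i hi => h2 _ hi
    have c2 : ((A.filter (fun i => v₀ ≤ σ * v i ∧ σ * v i ≤ 2 * v₀)).card : ℝ) ≤
        ((A \ B).filter (fun i => v₀ ≤ σ * v i ∧ σ * v i ≤ 2 * v₀)).card + B.card := by
      rw [← Finset.sdiff_union_of_subset hBA, Finset.filter_union]
      rw [Finset.sdiff_union_of_subset hBA]
      exact_mod_cast (Finset.card_union_le _ _).trans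
        (Nat.add_le_add_left (Finset.card_le_card (Finset.filter_subset _ _)) _)
    have c3 := (abs_le.1 h3).1
    have c4 := mul_le_mul_of_nonneg_left (c1.trans c2) hγ0.le
    have c5 := mul_le_mul_of_nonneg_left hcard hγ0.le
    have c6 := mul_le_mul_of_nonneg_right hz2.le hs0.le
    have c7 := mul_le_mul_of_nonneg_right hQ hs0.le
    linarith
  refine ⟨hBA, hcard, ?_, ?_, ?_, ?_, w7, ?_⟩
  · have : ∑ i ∈ B, |v i| ≤ ∑ i ∈ B, (1 + v i ^ 2) := Finset.sum_le_sum fun i _ => by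
      rw [← sq_abs (v i)]
      nlinarith [sq_nonneg (|v i| - 1), abs_nonneg (v i)]
    linarith
  · have := (abs_le.1 w2).2
    have := mul_nonneg hG₁0 hs0.le
    linarith
  · intro σ hσ
    rcases abs_eq_one_cases hσ with rfl | rfl
    · have c1 := hcount B φ₁ (fun i => 1 * v i ≤ -1) hφ₁0 hφ₁1 fun i hi => (hφ₁s _ hi).2
      have c2 := (abs_le.1 w3).1
      have c3 := mul_le_mul_of_nonneg_right (min_le_left (P₁ / 2) (P₂ / 2)) hs0.le
      linarith
    · have c1 := hcount B φ₂ (fun i => -1 * v i ≤ -1) hφ₂0 hφ₂1 fun i hi => (hφ₂s _ hi).2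
      have c2 := (abs_le.1 w4).1
      have c3 := mul_le_mul_of_nonneg_right (min_le_right (P₁ / 2) (P₂ / 2)) hs0.le
      linarith
  · intro σ hσ
    rcases abs_eq_one_cases hσ with rfl | rfl
    · exact hsurv 1 Q₁ χ₁ (min_le_left _ _) hχ₁0 hχ₁1 hχ₁s w5
    · exact hsurv (-1) Q₂ χ₂ (min_le_right _ _) hχ₂0 hχ₂1 hχ₂s w6
  · have c1 : ∑ i ∈ B, Real.exp (b₀ * |v i|) ≤
        ∑ i ∈ B, (Real.exp (b₀ * v i) + Real.exp (-b₀ * v i)) := Finset.sum_le_sum fun i _ => by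
      rcases abs_cases (v i) with ⟨h1, -⟩ | ⟨h1, -⟩
      · rw [h1]
        linarith [Real.exp_pos (-b₀ * v i)]
      · rw [h1, mul_neg, ← neg_mul]
        linarith [Real.exp_pos (b₀ * v i)]
    have c2 := mul_le_mul_of_nonneg_left (c1.trans (by linarith : _ ≤ (G₃ + 1) * s)) hγ0.le
    linarith

end TypicalSamples

/-- The quadratic lower bound for the exponential already beats a linear function. -/
lemma exists_forall_linear_lt_exp {k c r v₀ : ℝ} (hk : 0 ≤ k) (hc : 0 ≤ c) (hr : 0 < r)
    (hv₀ : 0 < v₀) (x₀ : ℝ) :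
    ∃ b₀ : ℝ, x₀ ≤ b₀ ∧ 0 ≤ b₀ ∧ ∀ x, b₀ ≤ x → c + k * x < r * (Real.exp (v₀ * x) / 2) := by
  refine ⟨max x₀ (4 * (c + k) / (r * v₀ ^ 2) + 1), le_max_left _ _,
    le_trans (by positivity) (le_max_right _ _), fun x hx => ?_⟩
  have h1 : 4 * (c + k) / (r * v₀ ^ 2) + 1 ≤ x := (le_max_right _ _).trans hx
  have h0 : 0 ≤ 4 * (c + k) / (r * v₀ ^ 2) := by positivity
  have hx1 : 1 ≤ x := by linarith
  have h2 : 4 * (c + k) / (r * v₀ ^ 2) < x := by linarith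
  rw [div_lt_iff₀ (by positivity)] at h2
  have h3 := Real.quadratic_le_exp_of_nonneg (show 0 ≤ v₀ * x by positivity)
  have h4 : 0 ≤ v₀ * x := by positivity
  have h5 : (v₀ * x) ^ 2 / 2 ≤ Real.exp (v₀ * x) := by linarith
  have h6 : r * ((v₀ * x) ^ 2 / 2 / 2) ≤ r * (Real.exp (v₀ * x) / 2) := by gcongr
  have h7 : x * (4 * (c + k)) < x * (x * (r * v₀ ^ 2)) := mul_lt_mul_of_pos_left h2 (by linarith)
  nlinarith

/-! ### Asymptotic linearity of the maximum likelihood estimator. -/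

section MaximumLikelihood

variable {Ω : Type*} {V : ℕ → ℕ → Ω → ℝ} {h : ℝ → ℝ} {β C K ρ : ℝ}
  [m0 : MeasurableSpace Ω] {μ : Measure Ω} [IsProbabilityMeasure μ]
  {m T : ℝ → ℕ} {D : ℝ → ℕ → ℕ → Ω → ℝ}

/-- The error made in replacing the default probabilities in the score by their leading order. -/
noncomputable def scoreRemainder (m T : ℕ) (V D : ℕ → ℕ → Ω → ℝ) (h : ℝ → ℝ) (β γ : ℝ) (ω : Ω) : ℝ :=
  ∑ t ∈ Finset.range T, ∑ i ∈ Finset.range m, V i t ω *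
    (defaultProb T V D h β (offset γ) i t ω - alive T D i t ω * (γ * Real.exp (β * V i t ω)))

/-- The sum subtracted in the score is the leading order of the compensator of the sum of `V` over
defaults, so the score is a martingale up to the correction `h`. -/
lemma ae_score_eq (hV : IsCovariateProcess μ V K ρ) {m T : ℕ} {D : ℕ → ℕ → Ω → ℝ} {γ : ℝ}
    (hDp : IsDefaultProcess μ V D h β (offset γ) m T) :
    ∀ᵐ ω ∂μ, score (aliveSet m T D ω) (defaultSet m T D ω) (sampleCov V ω) γ β =
      fullMartingale m T V D h β (offset γ) (fun v => v) ω + scoreRemainder m T V D h β γ ω := by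
  filter_upwards [ae_sum_defaultSet hV hDp] with ω hω
  have h1 := sum_aliveSet (m := m) (T := T) (V := V) (D := D) (fun v => v * Real.exp (β * v)) ω
  rw [score, hω (fun v => v), h1, defaultSum_eq (h := h) (β := β) _ (offset γ), scoreRemainder,
    add_sub_assoc]
  congr 1
  simp only [Finset.mul_sum, ← Finset.sum_sub_distrib]
  refine Finset.sum_congr rfl fun t _ => Finset.sum_congr rfl fun i _ => ?_
  ring

/-- With `s = γ m T`, the mean square is at most of order `(γ s)² = s · γ · (γ s)`, which is `o(s)`
by `rare`. -/
lemma whp_scoreRemainder (hV : IsCovariateProcess μ V K ρ) (hh : IsCorrection h β C)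
    (hR : Regime m T)
    (hD : ∀ᶠ γ in 𝓝[>] (0 : ℝ), IsDefaultProcess μ V (D γ) h β (offset γ) (m γ) (T γ))
    {ν : ℝ} (hν : 0 < ν) :
    Whp μ (fun γ ω => |scoreRemainder (m γ) (T γ) V (D γ) h β γ ω| ≤ ν * √(γ * m γ * T γ)) := by
  obtain ⟨A, hA, hrem⟩ := exists_remainder_sq_le (μ := μ) hV hh ExpBdd.id measurable_id
  have h1 : Whp μ (fun γ ω =>
      |scoreRemainder (m γ) (T γ) V (D γ) h β γ ω ^ 2 / (γ * m γ * T γ)| ≤ ν ^ 2) := by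
    refine Whp.of_tendsto_integral_abs ?_ ?_ (by positivity)
    · filter_upwards [hD, eventually_pos_le_one] with γ hDp hγ
      exact (hrem _ _ _ γ hγ.1 hγ.2 hDp).1.div_const _
    · have hz : Tendsto (fun γ => A * (γ * (γ * (γ * m γ * T γ)))) (𝓝[>] 0) (𝓝 0) := by
        have h := (tendsto_id_nhdsGT.mul hR.rare).const_mul A
        simpa using h
      refine squeeze_zero' (Eventually.of_forall fun _ => integral_nonneg fun _ => abs_nonneg _) ?_ hz
      filter_upwards [hD, eventually_pos_le_one, hR.size.eventually_ge_atTop 1] with γ hDp hγ hs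
      have hs0 : 0 < γ * m γ * T γ := by linarith
      have h2 := (hrem _ _ _ γ hγ.1 hγ.2 hDp).2
      have habs : ∀ ω, |scoreRemainder (m γ) (T γ) V (D γ) h β γ ω ^ 2 / (γ * m γ * T γ)| =
          scoreRemainder (m γ) (T γ) V (D γ) h β γ ω ^ 2 / (γ * m γ * T γ) := fun ω =>
        abs_of_nonneg (by positivity)
      simp only [habs]
      rw [integral_div, div_le_iff₀ hs0]
      refine h2.trans (le_of_eq ?_)
      ring
  refine h1.mono ?_
  filter_upwards [hR.size.eventually_ge_atTop 1] with γ hs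
  refine ae_of_all _ fun ω h2 => ?_
  have hs0 : 0 < γ * m γ * T γ := by linarith
  refine abs_le_of_sq_le_sq ?_ (by positivity)
  rw [mul_pow, Real.sq_sqrt hs0.le]
  exact (div_le_iff₀ hs0).1 ((le_abs_self _).trans h2)

/-- The information of the limit experiment, per expected default of a firm with covariate zero. -/
noncomputable def information (β : ℝ) : ℝ := (1 + β ^ 2) * Real.exp (β ^ 2 / 2)

lemma information_pos (β : ℝ) : 0 < information β := by
  unfold information
  positivity

/-- The maximum likelihood estimator is asymptotically linear. -/
lemma whp_maximumLikelihood (hV : IsCovariateProcess μ V K ρ) (hρ : ρ ∈ Set.Ioo (0 : ℝ) 1)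
    (hh : IsCorrection h β C) (hR : Regime m T)
    (hD : ∀ᶠ γ in 𝓝[>] (0 : ℝ), IsDefaultProcess μ V (D γ) h β (offset γ) (m γ) (T γ))
    {βM : ℝ → Ω → ℝ}
    (hM : ∀ᶠ γ in 𝓝[>] (0 : ℝ), IsMLE μ h V (D γ) (m γ) (T γ) (offset γ) (βM γ))
    {ε : ℝ} (hε : 0 < ε) :
    Whp μ (fun γ ω => |√(γ * m γ * T γ) * (βM γ ω - β) -
      (information β)⁻¹ * fullMartingale (m γ) (T γ) V (D γ) h β (offset γ) (fun v => v) ω /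
        √(γ * m γ * T γ)| ≤ ε) := by
  intro η₀ hη₀
  have hC := hh.nonneg
  set c := information β with hc
  have hc0 : 0 < c := information_pos β
  obtain ⟨A, hA, hmart⟩ := exists_martingale_moments (μ := μ) hV hh ExpBdd.id measurable_id
  -- The radius of the local window: by Chebyshev the martingale part of the score exceeds `(c R /
  -- 8) √(γ m T)` with probability at most `η₀ / 2`.
  set R := 8 / c * √(2 * A / η₀ + 1) with hRdef
  have hR0 : 0 < R := by positivity
  have hRA : A ≤ η₀ / 2 * (c * R / 8) ^ 2 := by
    have : c * R / 8 = √(2 * A / η₀ + 1) := by rw [hRdef]; field_simp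
    rw [this, Real.sq_sqrt (by positivity)]
    have : η₀ / 2 * (2 * A / η₀ + 1) = A + η₀ / 2 := by field_simp
    linarith
  have hJs : SmoothExp (fun v => (1 + v ^ 4) * (Real.exp (1 * v) + Real.exp (-1 * v)) *
      Real.exp (β * v)) :=
    (((SmoothExp.const 1).add (SmoothExp.id.pow 4)).mul
      ((SmoothExp.exp 1).add (SmoothExp.exp (-1)))).mul (SmoothExp.exp β)
  have hIs : SmoothExp (fun v => v ^ 2 * Real.exp (β * v)) :=
    (SmoothExp.id.pow 2).mul (SmoothExp.exp β)
  set J := gaussExp (fun v => (1 + v ^ 4) * (Real.exp (1 * v) + Real.exp (-1 * v)) *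
      Real.exp (β * v)) + 1 with hJdef
  have hJ0 : 0 ≤ J := add_nonneg (gaussExp_nonneg fun v => by positivity) zero_le_one
  -- Total error budget for the quadratic approximation. It is shared in thirds by the fluctuation
  -- of the information (`ε₁`), the cubic remainder, and the replacement of the likelihood by
  -- `logLik` (`η`).
  set τ := min (c / 4 * (ε / 2) ^ 2) (c / 16 * R ^ 2) with hτ
  have hτ0 : 0 < τ := by positivity
  have hτ1 : τ ≤ c / 4 * (ε / 2) ^ 2 := min_le_left _ _
  have hτ2 : τ < c / 8 * R ^ 2 := by
    have : 0 < c * R ^ 2 := by positivity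
    exact lt_of_le_of_lt (min_le_right _ _) (by linarith)
  set ε₁ := 2 * τ / (3 * R ^ 2) with hε₁
  have hε₁0 : 0 < ε₁ := by positivity
  have hε₁R : R ^ 2 * ε₁ / 2 = τ / 3 := by rw [hε₁]; field_simp
  set η := min (τ / (6 * (3 * C + 5))) (min (1 / (4 * (C + 1))) (1 / (3 * C + 5))) with hη
  have hη0 : 0 < η := by positivity
  have hη1 : 2 * ((3 * C + 5) * η) ≤ τ / 3 := by
    have : η ≤ τ / (6 * (3 * C + 5)) := min_le_left _ _
    rw [le_div_iff₀ (by positivity)] at this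
    linarith
  have hη2 : η ≤ 1 / (4 * (C + 1)) := (min_le_right _ _).trans (min_le_left _ _)
  have hη3 : (3 * C + 5) * η ≤ 1 := by
    have : η ≤ 1 / (3 * C + 5) := (min_le_right _ _).trans (min_le_right _ _)
    rw [le_div_iff₀ (by positivity)] at this
    linarith
  obtain ⟨k, p, hk, hp, htyp⟩ := exists_whp_typicalSample hV hρ hh hR hD
  have hl : 0 ≤ Real.log (1 + C) := Real.log_nonneg (by linarith)
  have hslope : 0 < farSlope β C k p := by
    unfold farSlope
    positivity
  set v₀ := 1 / (4 * farSlope β C k p) with hv₀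
  have hv₀0 : 0 < v₀ := by positivity
  have hv₀s : v₀ * farSlope β C k p = 1 / 4 := by rw [hv₀]; field_simp
  obtain ⟨r, hr, htyp⟩ := htyp v₀ hv₀0
  obtain ⟨b₀, hb₀β, hb₀0, hb₀⟩ := exists_forall_linear_lt_exp (k := k)
    (c := k * Real.log (1 + C) + ((|β| + 1) * k + 1)) hk (by positivity) hr hv₀0 (|β| + 1)
  have w1 := htyp b₀ η hb₀0 hη0
  have w2 := whp_sum_aliveSet hV hρ hh hR hD hIs hε₁0
  have w3 := whp_sum_aliveSet hV hρ hh hR hD hJs one_pos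
  have w4 := whp_scoreRemainder hV hh hR hD (show 0 < min (c * R / 8) (c * (ε / 2)) by positivity)
  have w := ((w1.and w2).and w3).and w4
  have hsqrt : Tendsto (fun γ => √(γ * m γ * T γ)) (𝓝[>] 0) atTop :=
    Real.tendsto_sqrt_atTop.comp hR.size
  have hJsmall : ∀ᶠ γ in 𝓝[>] (0 : ℝ), R ^ 3 * J / √(γ * m γ * T γ) < τ / 3 :=
    (hsqrt.const_div_atTop (R ^ 3 * J)).eventually (gt_mem_nhds (by positivity))
  have hexp : ∀ᶠ γ in 𝓝[>] (0 : ℝ), Real.exp (-(offset γ / 2)) < 1 / (2 * (C + 1)) := by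
    have h1 : Tendsto (fun γ => Real.exp (-(offset γ / 2))) (𝓝[>] 0) (𝓝 0) :=
      Real.tendsto_exp_neg_atTop_nhds_zero.comp (tendsto_offset.atTop_div_const two_pos)
    exact h1.eventually (gt_mem_nhds (by positivity))
  filter_upwards [w (η₀ / 2) (half_pos hη₀), hD, hM, hR.one_le_T, eventually_pos_le_one,
    hR.size.eventually_ge_atTop 1, hsqrt.eventually_ge_atTop R, hJsmall,
    tendsto_offset.eventually_ge_atTop 1, hexp] with γ hw hDp hMp hT hγ hs hRs hJγ hoff hexpγ
  have hs0 : 0 < γ * m γ * T γ := by linarith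
  have hγa : γ = Real.exp (-offset γ) := by
    rw [offset, one_div, Real.log_inv, neg_neg, Real.exp_log hγ.1]
  obtain ⟨h4, -, h2, -⟩ := hmart _ _ _ γ hγ.1 hγ.2 hDp
  have hmm := measurable_fullMartingale (m := m γ) (T := T γ) (β := β) (a := offset γ) hV
    hh.continuous hDp.measurable measurable_id
  have hbad := real_abs_gt_le_pow (n := 1) one_ne_zero (BernoulliStep.integrable_sq hmm h4)
    (show 0 < c * R / 8 * √(γ * m γ * T γ) by positivity)
  have hbad' : μ.real {ω | ¬ |fullMartingale (m γ) (T γ) V (D γ) h β (offset γ) (fun v => v) ω| ≤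
      c * R / 8 * √(γ * m γ * T γ)} ≤ η₀ / 2 := by
    refine hbad.trans ?_
    rw [div_le_iff₀ (by positivity)]
    simp only [mul_one]
    rw [mul_pow, Real.sq_sqrt hs0.le]
    refine h2.trans ?_
    have := mul_le_mul_of_nonneg_right hRA hs0.le
    linarith
  refine le_trans (le_trans (real_le_of_ae_imp ?_) (measureReal_union_le _ _))
    ((add_le_add hw hbad').trans (add_halves η₀).le)
  filter_upwards [ae_score_eq hV hDp, hMp.2] with ω hscore hmle hω
  by_contra hcon
  simp only [Set.mem_union, Set.mem_ofPred_eq, not_or, not_not] at hcon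
  obtain ⟨⟨⟨⟨hS, hI⟩, hJ⟩, hrem⟩, hMω⟩ := hcon
  refine hω ?_
  simp only [likelihood_eq hT] at hmle
  set M := fullMartingale (m γ) (T γ) V (D γ) h β (offset γ) (fun v => v) ω
  set Q := scoreRemainder (m γ) (T γ) V (D γ) h β γ ω
  have hβb₀ : |β| ≤ b₀ := by linarith
  have hfar : ∀ b, b₀ ≤ |b| → sampleLikelihood h (aliveSet (m γ) (T γ) (D γ) ω)
      (defaultSet (m γ) (T γ) (D γ) ω) (sampleCov V ω) (offset γ) b <
      sampleLikelihood h (aliveSet (m γ) (T γ) (D γ) ω)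
      (defaultSet (m γ) (T γ) (D γ) ω) (sampleCov V ω) (offset γ) β := fun b hb =>
    hS.lt_of_far hh hoff hγa hs hk hp hexpγ.le hη0.le hη2 hη3 hβb₀ hv₀s hv₀0.le
      (fun x hx => by linarith [hb₀ x hx]) hb
  -- On a typical sample a maximiser exists, so the estimator maximises; the comparison with `β`
  -- then confines it to `[-b₀, b₀]`.
  have hmax := hmle (exists_isMaxOn_of_far hh.continuous hβb₀ hfar)
  have hmax' : ∀ b, sampleLikelihood h (aliveSet (m γ) (T γ) (D γ) ω)
      (defaultSet (m γ) (T γ) (D γ) ω) (sampleCov V ω) (offset γ) b ≤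
      sampleLikelihood h (aliveSet (m γ) (T γ) (D γ) ω)
      (defaultSet (m γ) (T γ) (D γ) ω) (sampleCov V ω) (offset γ) (βM γ ω) := fun b =>
    hmax (Set.mem_univ b)
  have hMb : |βM γ ω| ≤ b₀ := by
    by_contra hcon
    exact absurd (hfar _ (not_le.1 hcon).le) (not_lt.2 (hmax' β))
  rw [gaussExp_sq_mul_exp] at hI
  set g := √(γ * m γ * T γ) with hg
  have hg0 : 0 < g := Real.sqrt_pos.2 hs0
  have hrem1 : |Q| ≤ c * R / 8 * g := hrem.trans (mul_le_mul_of_nonneg_right (min_le_left _ _) hg0.le)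
  have hrem2 : |Q| ≤ c * (ε / 2) * g :=
    hrem.trans (mul_le_mul_of_nonneg_right (min_le_right _ _) hg0.le)
  have hJω : γ * ∑ i ∈ aliveSet (m γ) (T γ) (D γ) ω, |sampleCov V ω i| ^ 3 *
      Real.exp |sampleCov V ω i| * Real.exp (β * sampleCov V ω i) ≤ J * (γ * m γ * T γ) := by
    have h5 := (abs_le.1 hJ).2
    refine le_trans (mul_le_mul_of_nonneg_left (Finset.sum_le_sum fun i _ => ?_) hγ.1.le)
      (b := γ * ∑ k ∈ aliveSet (m γ) (T γ) (D γ) ω, (1 + sampleCov V ω k ^ 4) *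
        (Real.exp (1 * sampleCov V ω k) + Real.exp (-1 * sampleCov V ω k)) *
        Real.exp (β * sampleCov V ω k)) (by rw [hJdef]; linarith)
    refine mul_le_mul_of_nonneg_right ?_ (Real.exp_pos _).le
    generalize sampleCov V ω i = x
    have e1 : |x| ^ 3 ≤ 1 + x ^ 4 := by
      have e0 : x ^ 4 = |x| ^ 4 := by rw [← abs_pow, abs_of_nonneg (by positivity)]
      rw [e0]
      have := abs_nonneg x
      generalize |x| = y at *
      rcases le_total y 1 with hy | hy
      · have : y ^ 3 ≤ 1 := pow_le_one₀ this hy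
        have : 0 ≤ y ^ 4 := by positivity
        linarith
      · have : y ^ 3 ≤ y ^ 4 := pow_le_pow_right₀ hy (by norm_num)
        linarith
    have e2 : Real.exp |x| ≤ Real.exp (1 * x) + Real.exp (-1 * x) := by
      rcases abs_cases x with ⟨h1, -⟩ | ⟨h1, -⟩
      · rw [h1, one_mul]
        linarith [Real.exp_pos (-1 * x)]
      · rw [h1, neg_one_mul]
        linarith [Real.exp_pos (1 * x)]
    gcongr
  have hU : |score (aliveSet (m γ) (T γ) (D γ) ω) (defaultSet (m γ) (T γ) (D γ) ω) (sampleCov V ω)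
      γ β| ≤ c * R / 4 * g := by
    rw [hscore]
    refine (abs_add_le _ _).trans ?_
    linarith
  have hmain := hS.abs_maximiser_sub_le hh hγa hη0.le hη2 hb₀β hR0 hc0 hRs hJ0 hU hI hJω
    (half_pos hε).le (by linarith) (by linarith) hMb (hmax' β) (hmax' _)
  rw [hscore] at hmain
  -- The comparison above was with the full score `M + Q`; the remainder `Q` costs at most `ε / 2`.
  have e : g * (βM γ ω - β) - c⁻¹ * M / g =
      (g * (βM γ ω - β) - (M + Q) / (g * c)) + Q / (g * c) := by
    field_simp
    ring
  rw [e]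
  refine (abs_add_le _ _).trans ?_
  have hQ : |Q / (g * c)| ≤ ε / 2 := by
    rw [abs_div, abs_of_pos (mul_pos hg0 hc0), div_le_iff₀ (mul_pos hg0 hc0)]
    linarith
  linarith

end MaximumLikelihood

/-! ### Mean squared error of the maximum likelihood estimator. -/

section MeanSquaredError

variable {Ω : Type*} {V : ℕ → ℕ → Ω → ℝ} {h : ℝ → ℝ} {β C K ρ : ℝ}
  [m0 : MeasurableSpace Ω] {μ : Measure Ω} [IsProbabilityMeasure μ]
  {m T : ℝ → ℕ} {D : ℝ → ℕ → ℕ → Ω → ℝ}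

/-- The bound on `L¹` norms gives integrability, and the uniform smallness over small sets is a
statement about `eLpNorm` of indicators, rewritten here as an integral over `s`. -/
lemma EventuallyUI.of_uniformIntegrable {γ₀ : ℝ} (hγ₀ : 0 < γ₀) {F : ℝ → Ω → ℝ}
    (hF : UniformIntegrable (fun (γ : Set.Ioo (0 : ℝ) γ₀) ω => F γ ω) 1 μ) :
    EventuallyUI μ F := by
  obtain ⟨hm, hu, B, hB⟩ := hF
  intro ε hε
  obtain ⟨d, hd, hud⟩ := hu hε
  refine ⟨d, hd, ?_⟩
  filter_upwards [Ioo_mem_nhdsGT hγ₀] with γ hγ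
  have hi : Integrable (F γ) μ := memLp_one_iff_integrable.1
    ⟨hm ⟨γ, hγ⟩, (hB ⟨γ, hγ⟩).trans_lt ENNReal.coe_lt_top⟩
  refine ⟨hi, fun s hs hsd => ?_⟩
  have h1 := hud ⟨γ, hγ⟩ s hs 
    ((ENNReal.le_ofReal_iff_toReal_le (measure_ne_top _ _) hd.le).2 hsd)
  rw [eLpNorm_indicator_eq_eLpNorm_restrict hs, eLpNorm_one_eq_lintegral_enorm] at h1
  have h2 := integral_norm_eq_lintegral_enorm (μ := μ.restrict s) (f := F γ) hi.1.restrict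
  simp only [Real.norm_eq_abs] at h2
  rw [h2]
  exact ENNReal.toReal_le_of_le_ofReal hε.le h1

/-- The mean squared error of the maximum likelihood estimator. -/
theorem tendsto_maximumLikelihood (hV : IsCovariateProcess μ V K ρ) (hρ : ρ ∈ Set.Ioo (0 : ℝ) 1)
    (hh : IsCorrection h β C) (hR : Regime m T)
    (hD : ∀ᶠ γ in 𝓝[>] (0 : ℝ), IsDefaultProcess μ V (D γ) h β (offset γ) (m γ) (T γ))
    {βM : ℝ → Ω → ℝ}
    (hM : ∀ᶠ γ in 𝓝[>] (0 : ℝ), IsMLE μ h V (D γ) (m γ) (T γ) (offset γ) (βM γ))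
    (hUI : EventuallyUI μ (fun γ ω => (√(γ * m γ * T γ) * (βM γ ω - β)) ^ 2)) :
    Tendsto (fun γ => ∫ ω, (√(γ * m γ * T γ) * (βM γ ω - β)) ^ 2 ∂μ)
      (𝓝[>] 0) (𝓝 (information β)⁻¹) := by
  obtain ⟨hWui, hWlim⟩ := normalised_martingale (w := fun v => v) hV hh hR hD ExpBdd.id
    measurable_id (information β)⁻¹
  rw [gaussExp_sq_mul_exp, ← information, sq, mul_assoc,
    inv_mul_cancel₀ (information_pos β).ne', mul_one] at hWlim
  exact tendsto_integral_sq_of_whp hUI hWui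
    (fun ε hε => whp_maximumLikelihood hV hρ hh hR hD hM hε) hWlim

end MeanSquaredError

end RareDefault

/-! ### The ratio of the mean squared errors. -/

theorem mainTheorem5 {Ω : Type*} [MeasurableSpace Ω] (μ : Measure Ω) [IsProbabilityMeasure μ]
    (β δ ζ γ₀ K ρ C : ℝ) (h : ℝ → ℝ)
    (hδ : δ < 1) (hζ : ζ ∈ Set.Ioo (0 : ℝ) 1) (hδζ : 1 < δ + ζ)
    (hγ₀ : γ₀ ∈ Set.Ioc (0 : ℝ) 1) (hρ : ρ ∈ Set.Ioo (0 : ℝ) 1)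
    (hh : RareDefault.IsCorrection h β C)
    (V : ℕ → ℕ → Ω → ℝ) (hV : RareDefault.IsCovariateProcess μ V K ρ)
    (D : ℝ → ℕ → ℕ → Ω → ℝ)
    (hD : ∀ γ ∈ Set.Ioo 0 γ₀, RareDefault.IsDefaultProcess μ V (D γ) h β (RareDefault.offset γ)
      (RareDefault.numFirms δ γ) (RareDefault.numPeriods ζ γ))
    (βM : ℝ → Ω → ℝ)
    (hβM : ∀ γ ∈ Set.Ioo 0 γ₀, RareDefault.IsMLE μ h V (D γ)
      (RareDefault.numFirms δ γ) (RareDefault.numPeriods ζ γ) (RareDefault.offset γ) (βM γ))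
    (hUI : UniformIntegrable
      (fun (γ : Set.Ioo (0 : ℝ) γ₀) (ω : Ω) =>
        ((γ : ℝ) ^ (-((δ + ζ - 1) / 2)) * (βM γ ω - β)) ^ 2) 1 μ) :
    (∀ᶠ γ in 𝓝[>] (0 : ℝ),
      Integrable (fun ω => (βM γ ω - β) ^ 2) μ ∧
      Integrable (fun ω => (RareDefault.proposedEstimator V (D γ)
        (RareDefault.numFirms δ γ) (RareDefault.numPeriods ζ γ) γ ω - β) ^ 2) μ) ∧
    Tendsto
      (fun γ : ℝ =>
        (∫ ω, (βM γ ω - β) ^ 2 ∂μ) /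
        (∫ ω, (RareDefault.proposedEstimator V (D γ)
          (RareDefault.numFirms δ γ) (RareDefault.numPeriods ζ γ) γ ω - β) ^ 2 ∂μ))
      (𝓝[>] 0) (𝓝 (1 / (1 + β ^ 2))) := by
  have hR := RareDefault.regime hδ hζ hδζ
  have hev : ∀ᶠ γ in 𝓝[>] (0 : ℝ), γ ∈ Set.Ioo 0 γ₀ := Ioo_mem_nhdsGT hγ₀.1
  have hDe := hev.mono hD
  have hMe := hev.mono hβM
  have hsd := RareDefault.tendsto_size_div (show 0 < δ by linarith [hζ.2]) hζ.1
  have hU := RareDefault.EventuallyUI.of_uniformIntegrable hγ₀.1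
    (F := fun γ ω => (γ ^ (-((δ + ζ - 1) / 2)) * (βM γ ω - β)) ^ 2) hUI
  have hpow : ∀ γ : ℝ, 0 < γ → (γ ^ (-((δ + ζ - 1) / 2))) ^ 2 = (γ ^ (δ + ζ - 1))⁻¹ := by
    intro γ hγ
    rw [← Real.rpow_natCast, ← Real.rpow_mul hγ.le, ← Real.rpow_neg hγ.le]
    congr 1
    push_cast
    ring
  -- Change of normalisation: `γ m T · γ ^ (δ + ζ - 1)` tends to one and is eventually below 2, so
  -- the squares differ by a factor of at most 2.
  have hU' : RareDefault.EventuallyUI μ (fun γ ω =>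
      (√(γ * RareDefault.numFirms δ γ * RareDefault.numPeriods ζ γ) * (βM γ ω - β)) ^ 2) := by
    refine hU.of_le (H := fun _ _ => 0) two_pos (Eventually.of_forall fun _ => integrable_zero _ _ _)
      (by simp) ?_
    filter_upwards [hMe, hR.size.eventually_ge_atTop 1, self_mem_nhdsWithin,
      hsd.eventually (gt_mem_nhds one_lt_two)] with γ hMγ hs hγ hlt
    refine ⟨(((hMγ.1.sub_const β).const_mul _).pow_const 2).aestronglyMeasurable, fun ω => ?_⟩
    have hγ' : 0 < γ := hγ
    rw [abs_zero, add_zero, abs_of_nonneg (sq_nonneg _), abs_of_nonneg (sq_nonneg _), mul_pow,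
      mul_pow, Real.sq_sqrt (by linarith), hpow γ hγ', ← mul_assoc]
    refine mul_le_mul_of_nonneg_right ?_ (sq_nonneg _)
    rw [← div_eq_mul_inv, le_div_iff₀ (Real.rpow_pos_of_pos hγ' _)]
    exact hlt.le
  have hlim := RareDefault.tendsto_maximumLikelihood hV hρ hh hR hDe hMe hU'
  have hlim' := RareDefault.tendsto_proposedEstimator hV hρ hh hR hDe
  constructor
  · obtain ⟨d, -, hd⟩ := hU 1 one_pos
    filter_upwards [hd, hDe, hR.size.eventually_ge_atTop 1, self_mem_nhdsWithin]
      with γ hi hDγ hs hγ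
    refine ⟨?_, RareDefault.integrable_proposedEstimator_sub_sq hV hDγ (by linarith)⟩
    have h1 := Real.rpow_pos_of_pos (show (0 : ℝ) < γ from hγ) (-((δ + ζ - 1) / 2))
    refine (hi.1.const_mul ((γ ^ (-((δ + ζ - 1) / 2))) ^ 2)⁻¹).congr (ae_of_all _ fun ω => ?_)
    simp only [mul_pow]
    rw [inv_mul_cancel_left₀ (by positivity)]
  -- Both limits carry the factor `γ m T`, which cancels in the quotient.
  · have h := hlim.div hlim' (inv_pos.2 (Real.exp_pos _)).ne'
    have e : (RareDefault.information β)⁻¹ / (Real.exp (β ^ 2 / 2))⁻¹ = 1 / (1 + β ^ 2) := by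
      have h1 := Real.exp_pos (β ^ 2 / 2)
      have h2 : 0 < 1 + β ^ 2 := by positivity
      rw [RareDefault.information]
      field_simp
    rw [e] at h
    refine h.congr' ?_
    filter_upwards [hR.size.eventually_ge_atTop 1] with γ hs
    have hs0 : 0 < γ * RareDefault.numFirms δ γ * RareDefault.numPeriods ζ γ := by linarith
    simp only [Pi.div_apply, mul_pow, Real.sq_sqrt hs0.le, integral_const_mul]
    exact mul_div_mul_left _ _ hs0.ne'
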